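/- Let $\{X(t),\,t\in[a,b]\}$, $a<b$, be a jointly measurable stochastic process with mean function $\mu(t)=\mathbb E\{X(t)\}$. Let $X_1,X_2,\dots$ be independent realizations of $X$, let $T_{ij}$ ($i,j\ge1$) be random points of $[a,b]$ with common density $f_T$ on $[a,b]$, let $U_{ij}$ ($i,j\ge 1$) be identically distributed errors with mean zero, and let all the $X_i$, $T_{ij}$, $U_{ij}$ be mutually independent. Put $Y_{ij}=X_i(T_{ij})+U_{ij}$. For each sample size $n$ the observations are $(T_{ij},Y_{ij})$, $1\le i\le n$, $1\le j\le m_i$, where the integers $m_i=m_{in}\ge 2$ are nonrandom and may depend on $n$ in an arbitrary way. Put $$\gamma_{n1}=\Bigl(\frac1n\sum_{i=1}^n \frac1{m_i}\Bigr)^{-1},\qquad \delta_{n1}(h)=\bigl[\{1+(h\gamma_{n1})^{-1}\}\log n/n\bigr]^{1/2}.$$ Let $h_\mu=h_{\mu,n}>0$ be bandwidths, $K_h(x)=h^{-1}K(x/h)$, and let $\widehat\mu(t)=\widehat a_0$, where $(\widehat a_0,\widehat a_1)$ is a minimizer over $(a_0,a_1)\in\mathbb R^2$ of $$\frac1n\sum_{i=1}^n\frac1{m_i}\sum_{j=1}^{m_i}\{Y_{ij}-a_0-a_1(T_{ij}-t)\}^2K_{h_\mu}(T_{ij}-t)$$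 (any choice of a minimizer is allowed where it is not unique). Assume: - (C1) $m_T\le f_T(t)\le M_T$ for all $t\in[a,b]$, for some constants $m_T>0$ and $M_T<\infty$, and $f_T$ is differentiable on $[a,b]$ with a bounded derivative; - (C2) $K$ is a symmetric probability density function on $[-1,1]$, vanishing outside $[-1,1]$, and is of bounded variation on $[-1,1]$; - (C3) $\mu$ is twice differentiable on $[a,b]$ with a bounded second derivative; - (C5) for some $\lambda_\mu\in(2,\infty)$, $\mathbb E(|U_{ij}|^{\lambda_\mu})<\infty$ and $\mathbb E(\sup_{t\in[a,b]}|X(t)|^{\lambda_\mu})<\infty$; moreover $h_\mu\to0$ and $(h_\mu^2+h_\mu/\gamma_{n1})^{-1}(\log n/n)^{1-2/\lambda_\mu}\to0$ as $n\to\infty$. Then $$\sup_{t\in[a,b]}|\widehat\mu(t)-\mu(t)|=O\bigl(h_\mu^2+\delta_{n1}(h_\mu)\bigr)\qquad\text{almost surely},$$ that is, for almost every outcome there are a finite constant $C$ and an index from which on the supremum is at most $C\,(h_\mu^2+\delta_{n1}(h_\mu))$. -/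

import Mathlib

open MeasureTheory ProbabilityTheory Filter Set
open scoped Topology ENNReal

noncomputable section

/-- The first-order harmonic mean `γ_{n1}` of the numbers of observations `m n i`, `i < n`. -/
def harmonicMean (m : ℕ → ℕ → ℕ) (n : ℕ) : ℝ :=
  ((n : ℝ)⁻¹ * ∑ i ∈ Finset.range n, (m n i : ℝ)⁻¹)⁻¹

/-- `δ_{n1}(h) = [{1 + (h γ_{n1})⁻¹} log n / n]^{1/2}`. -/
def deltaOne (m : ℕ → ℕ → ℕ) (n : ℕ) (h : ℝ) : ℝ :=
  √((1 + (h * harmonicMean m n)⁻¹) * Real.log n / n)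

/-- The rescaled kernel `K_h(x) = (1/h) K(x/h)`. -/
def scaledKernel (K : ℝ → ℝ) (h x : ℝ) : ℝ := (1 / h) * K (x / h)

/-- The kernel-weighted least squares criterion of local-linear smoothing at the point `t`, for
the observations `(T i j, Y i j)`, `i < n`, `j < m n i`, with bandwidth `h`. Curve `i` gets the
weight `1 / m n i`. -/
def localLinearLoss (K : ℝ → ℝ) (m : ℕ → ℕ → ℕ) (n : ℕ) (h : ℝ) (T Y : ℕ → ℕ → ℝ)
    (t a₀ a₁ : ℝ) : ℝ :=
  (1 / (n : ℝ)) * ∑ i ∈ Finset.range n, (1 / (m n i : ℝ)) * ∑ j ∈ Finset.range (m n i),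
    (Y i j - a₀ - a₁ * (T i j - t)) ^ 2 * scaledKernel K h (T i j - t)

/-- `a₀` is a local-linear estimate at `t`: it is the first coordinate of a minimizer
`(a₀, a₁)` of the criterion over `ℝ²`. -/
def IsLocalLinearEstimate (K : ℝ → ℝ) (m : ℕ → ℕ → ℕ) (n : ℕ) (h : ℝ) (T Y : ℕ → ℕ → ℝ)
    (t a₀ : ℝ) : Prop :=
  ∃ a₁ : ℝ, ∀ b₀ b₁ : ℝ,
    localLinearLoss K m n h T Y t a₀ a₁ ≤ localLinearLoss K m n h T Y t b₀ b₁

/-- The observation `Y_{ij} = X_i(T_{ij}) + U_{ij}`, where `X_i = X (ξ i ·)` is the `i`-th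
realization of the process `X`. -/
def observation {Ω S : Type*} {a b : ℝ} (X : S → Icc a b → ℝ) (ξ : ℕ → Ω → S)
    (T : ℕ → ℕ → Ω → Icc a b) (U : ℕ → ℕ → Ω → ℝ) (ω : Ω) (i j : ℕ) : ℝ :=
  X (ξ i ω) (T i j ω) + U i j ω

/-- The sampling model. `X` is a (jointly measurable) process indexed by `[a, b]`, defined on the
probability space `(S, ν)`. Its realizations are `X_i = X (ξ i ·)`, where `ξ i` has law `ν`. The
design points `T i j` take values in `[a, b]` and have density `f` there; the errors `U i j` are
identically distributed with mean zero; and all the `ξ i`, `T i j`, `U i j` together are mutually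
independent. -/
structure SamplingModel {Ω S : Type*} [MeasurableSpace Ω] [MeasurableSpace S] (P : Measure Ω)
    (ν : Measure S) {a b : ℝ} (X : S → Icc a b → ℝ) (f : ℝ → ℝ) (ξ : ℕ → Ω → S)
    (T : ℕ → ℕ → Ω → Icc a b) (U : ℕ → ℕ → Ω → ℝ) : Prop where
  measurable_process : Measurable fun p : S × Icc a b => X p.1 p.2
  measurable_source : ∀ i, Measurable (ξ i)
  measurable_design : ∀ i j, Measurable (T i j)
  measurable_error : ∀ i j, Measurable (U i j)
  law_source : ∀ i, P.map (ξ i) = ν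
  law_design : ∀ i j, P.map (fun ω => (T i j ω : ℝ)) =
    (volume.restrict (Icc a b)).withDensity fun t => ENNReal.ofReal (f t)
  identDistrib_error : ∀ i j, IdentDistrib (U i j) (U 0 0) P P
  mean_error : ∀ i j, ∫ ω, U i j ω ∂P = 0
  independent : iIndep
    (Sum.elim (fun i : ℕ => MeasurableSpace.comap (ξ i) inferInstance)
      (Sum.elim (fun p : ℕ × ℕ => MeasurableSpace.comap (T p.1 p.2) inferInstance)
        (fun p : ℕ × ℕ => MeasurableSpace.comap (U p.1 p.2) inferInstance))) P

/-- On `[a, b]` the design density `f` is bounded away from zero and infinity, and is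
differentiable (one-sidedly at the end points) with a bounded derivative. -/
structure DesignDensityCondition (a b : ℝ) (f : ℝ → ℝ) : Prop where
  bounds : ∃ mT MT : ℝ, 0 < mT ∧ ∀ t ∈ Icc a b, mT ≤ f t ∧ f t ≤ MT
  differentiable : DifferentiableOn ℝ f (Icc a b)
  deriv_bounded : ∃ B : ℝ, ∀ t ∈ Icc a b, |derivWithin f (Icc a b) t| ≤ B

/-- `K` is a symmetric probability density on `[-1, 1]`, of bounded variation on `[-1, 1]`. -/
structure KernelCondition (K : ℝ → ℝ) : Prop where
  nonneg : ∀ x, 0 ≤ K x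
  symmetric : ∀ x, K (-x) = K x
  support : ∀ x, x ∉ Icc (-1 : ℝ) 1 → K x = 0
  integral_eq_one : ∫ x, K x = 1
  boundedVariation : BoundedVariationOn K (Icc (-1) 1)

/-- `mu` is twice differentiable on `[a, b]` (one-sidedly at the end points), with a bounded second
derivative. -/
structure MeanSmoothnessCondition (a b : ℝ) (mu : ℝ → ℝ) : Prop where
  differentiable : DifferentiableOn ℝ mu (Icc a b)
  twice_differentiable : DifferentiableOn ℝ (derivWithin mu (Icc a b)) (Icc a b)
  second_deriv_bounded : ∃ B : ℝ, ∀ t ∈ Icc a b,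
    |derivWithin (derivWithin mu (Icc a b)) (Icc a b) t| ≤ B

/-- Moment condition of order `lam > 2`: `E |U_{ij}|^lam < ∞` and `E sup_t |X(t)|^lam < ∞`. The
supremum is taken in `[0, ∞]`, and is a random variable up to null sets. -/
structure MomentCondition {Ω S : Type*} [MeasurableSpace Ω] [MeasurableSpace S] (P : Measure Ω)
    (ν : Measure S) {a b : ℝ} (X : S → Icc a b → ℝ) (U : ℕ → ℕ → Ω → ℝ) (lam : ℝ) : Prop where
  two_lt : 2 < lam
  error_moment : ∀ i j, Integrable (fun ω => |U i j ω| ^ lam) P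
  sup_aemeasurable : AEMeasurable (fun s => ⨆ t : Icc a b, ENNReal.ofReal (|X s t| ^ lam)) ν
  sup_moment : ∫⁻ s, (⨆ t : Icc a b, ENNReal.ofReal (|X s t| ^ lam)) ∂ν < ∞

/-- Bandwidth condition: `h n > 0`, `h n → 0` and
`(h² + h / γ_{n1})⁻¹ (log n / n)^{1 - 2/lam} → 0`. -/
structure BandwidthCondition (m : ℕ → ℕ → ℕ) (h : ℕ → ℝ) (lam : ℝ) : Prop where
  pos : ∀ n, 0 < h n
  tendsto_zero : Tendsto h atTop (𝓝 0)
  rate : Tendsto (fun n : ℕ => (h n ^ 2 + h n / harmonicMean m n)⁻¹ *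
    (Real.log n / n) ^ (1 - 2 / lam)) atTop (𝓝 0)

/-- The uniform distance `sup_{t ∈ [a, b]} |g t - mu t|`, as an element of `[0, ∞]`. -/
def uniformError (a b : ℝ) (g mu : ℝ → ℝ) : ℝ≥0∞ :=
  ⨆ t ∈ Icc a b, ENNReal.ofReal |g t - mu t|

end

/-!
Centre the local-linear fit at `t` at the Taylor polynomial of `mu`. By the normal equations and
Cramer's rule (`intercept_mul_det`) the error of the intercept is
`(R₀ S₂ - R₁ S₁) / (S₀ S₂ - S₁ ^ 2)`, where the `S_r` are kernel moments of the design and the `R_r`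
are kernel sums of the noise `Y - mu (T)` plus a Taylor remainder of order `h ^ 2`. It remains to
bound, uniformly in `t`, the determinant from below, the `S_r` from above, and the noise sums.

A function of bounded variation is a difference of monotone functions, so by the layer cake formula
the kernel sums are controlled by sums over the design points in intervals of length at most `2 h`
(`KernelCondition.exists_abs_sum_le`). Such an interval differs from a block of cells of a grid of
width `1 / n` by parts of two cells (`abs_sum_ind_ordConnected_le`). So it suffices to control
polynomially many block sums, and sums of absolute values over single cells. With
`β = h ^ 2 + h / γ`, a truncated block sum has variance of order `n β`; at the truncation level
`Q = √(n β / log n)` the Chernoff bound gives deviations of order `Q log n = n h δ` with probability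
a large negative power of `n`, and the Borel-Cantelli lemma applies (`ae_eventually_sum_lt`). The
same bound for the weighted counts of design points controls the `S_r` and, because `δ → 0` and the
kernel is bounded below on some interval, the determinant (`det_ge`).

The noise has two parts. The centred process `X - mu` is truncated by curve, where an envelope of
it exceeds `Q`; the discarded part is at most `Q ^ (1 - lam)` times a sum of independent integrable
variables, which is of order `n Q ^ (1 - lam) ≤ Q log n` by the strong law of large numbers
and the bandwidth condition (`SamplingModel.ae_sum_curveTerm_comp_le`). The measurement errors are
truncated by observation, at the level `k Q` on a curve with `k` observations, where the weighted
error `U / k` reaches `Q`. Since `k` may depend on `n` in an arbitrary way, the discarded part has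
to be bounded simultaneously for all `k`. The choice of the level makes this possible: the discarded
part of curve `i` is at most `Q ^ (1 - lam)` times `∑ j, |U i j| ^ lam / (j + 1) ^ lam`, which is
integrable because `lam > 1`, and does not involve `k` (`SamplingModel.ae_sum_error_le`).
-/

set_option linter.unusedSectionVars false

/-! ### Chernoff bounds and grouping of independent σ-algebras -/

/-- Chernoff bound with the inverse of the uniform bound `Q` as the parameter of the moment
generating function, for independent variables that need not be centred. -/
theorem ProbabilityTheory.iIndepFun.measureReal_sum_ge_le {Ω ι : Type*} [MeasurableSpace Ω]
    {P : Measure Ω} [IsProbabilityMeasure P] {Y : ι → Ω → ℝ} (hind : iIndepFun Y P)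
    (hmeas : ∀ i, Measurable (Y i)) (s : Finset ι) {Q V e : ℝ} (hQ : 0 < Q)
    (hb : ∀ i ∈ s, ∀ ω, |Y i ω| ≤ Q) (hV : ∑ i ∈ s, ∫ ω, Y i ω ^ 2 ∂P ≤ V)
    (he : ∑ i ∈ s, ∫ ω, Y i ω ∂P ≤ e) (ε : ℝ) :
    P.real {ω | e + ε ≤ ∑ i ∈ s, Y i ω} ≤ Real.exp (-(ε / Q) + V / Q ^ 2) := by
  have hint : ∀ i ∈ s, Integrable (Y i) P := fun i hi =>
    Integrable.of_bound (hmeas i).aestronglyMeasurable Q (Eventually.of_forall (hb i hi))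
  have hint2 : ∀ i ∈ s, Integrable (fun ω => Y i ω ^ 2) P := fun i hi =>
    Integrable.of_bound ((hmeas i).pow_const 2).aestronglyMeasurable (Q ^ 2)
      (Eventually.of_forall fun ω => by
        rw [Real.norm_eq_abs, abs_pow]; exact pow_le_pow_left₀ (abs_nonneg _) (hb i hi ω) 2)
  have hmgf : ∀ i ∈ s, mgf (Y i) P Q⁻¹ ≤
      Real.exp (Q⁻¹ * ∫ ω, Y i ω ∂P + (Q⁻¹) ^ 2 * ∫ ω, Y i ω ^ 2 ∂P) := by
    intro i hi
    have h1 : mgf (Y i) P Q⁻¹ ≤ ∫ ω, (1 + Q⁻¹ * Y i ω + (Q⁻¹) ^ 2 * Y i ω ^ 2) ∂P := by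
      apply integral_mono_of_nonneg (Eventually.of_forall fun ω => (Real.exp_pos _).le)
      · exact ((integrable_const _).add ((hint i hi).const_mul _)).add ((hint2 i hi).const_mul _)
      · refine Eventually.of_forall fun ω => ?_
        have hx : |Q⁻¹ * Y i ω| ≤ 1 := by
          rw [abs_mul, abs_of_pos (inv_pos.2 hQ), inv_mul_le_iff₀ hQ, mul_one]
          exact hb i hi ω
        have := (abs_le.1 (Real.abs_exp_sub_one_sub_id_le hx)).2
        simp only
        nlinarith
    have hint3 : Integrable (fun ω => 1 + Q⁻¹ * Y i ω) P :=
      (integrable_const _).add ((hint i hi).const_mul _)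
    rw [integral_add hint3 ((hint2 i hi).const_mul _),
      integral_add (integrable_const _) ((hint i hi).const_mul _),
      integral_const_mul, integral_const_mul] at h1
    simp only [integral_const, probReal_univ, smul_eq_mul, mul_one] at h1
    refine h1.trans ?_
    have := Real.add_one_le_exp (Q⁻¹ * ∫ ω, Y i ω ∂P + (Q⁻¹) ^ 2 * ∫ ω, Y i ω ^ 2 ∂P)
    linarith
  have hexp : Integrable (fun ω => Real.exp (Q⁻¹ * (∑ i ∈ s, Y i) ω)) P := by
    refine Integrable.of_bound ?_ (Real.exp (Q⁻¹ * ∑ i ∈ s, Q)) (Eventually.of_forall fun ω => ?_)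
    · simp only [Finset.sum_apply]
      exact (by fun_prop : Measurable fun ω =>
        Real.exp (Q⁻¹ * ∑ i ∈ s, Y i ω)).aestronglyMeasurable
    · rw [Real.norm_eq_abs, Real.abs_exp, Finset.sum_apply]
      gcongr with i hi
      exact (le_abs_self _).trans (hb i hi ω)
  have h2 := measure_ge_le_exp_mul_mgf (X := ∑ i ∈ s, Y i) (e + ε) (inv_pos.2 hQ).le hexp
  simp only [Finset.sum_apply] at h2
  refine h2.trans ?_
  rw [hind.mgf_sum hmeas]
  refine (mul_le_mul_of_nonneg_left (Finset.prod_le_prod (fun i _ => mgf_nonneg) hmgf)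
    (Real.exp_pos _).le).trans ?_
  rw [← Real.exp_sum, ← Real.exp_add, Real.exp_le_exp, Finset.sum_add_distrib, ← Finset.mul_sum,
    ← Finset.mul_sum]
  have h3 := mul_le_mul_of_nonneg_left hV (sq_nonneg Q⁻¹)
  have h4 := mul_le_mul_of_nonneg_left he (inv_pos.2 hQ).le
  have e1 : ε / Q = Q⁻¹ * ε := by field_simp
  have e2 : V / Q ^ 2 = (Q⁻¹) ^ 2 * V := by field_simp
  rw [e1, e2]
  linarith

/-- Borel-Cantelli lemma with a union bound over polynomially many index pairs. If the variances and
the means of the sums are of the orders `Q ^ 2 * log n` and `Q * log n`, the sums exceed a multiple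
of `Q * log n` with probability at most `n ^ (-4)`, while there are at most of the order of `n ^ 2`
pairs. -/
theorem ae_eventually_sum_lt {Ω ι : Type*} [MeasurableSpace Ω] {P : Measure Ω}
    [IsProbabilityMeasure P] (s : ℕ → Finset ι) (Y : ℕ → ℕ → ℕ → ι → Ω → ℝ)
    (adm : ℕ → ℕ → ℕ → Prop) (Q : ℕ → ℝ) (c : ℕ) (C : ℝ)
    (hadm : ∀ n p q, adm n p q → p ≤ c * n ∧ q ≤ c * n)
    (hind : ∀ n p q, iIndepFun (Y n p q) P) (hmeas : ∀ n p q i, Measurable (Y n p q i))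
    (H : ∀ᶠ n in atTop, 0 < Q n ∧ ∀ p q, adm n p q →
      (∀ i ∈ s n, ∀ ω, |Y n p q i ω| ≤ Q n) ∧
      ∑ i ∈ s n, ∫ ω, Y n p q i ω ^ 2 ∂P ≤ C * (Q n ^ 2 * Real.log n) ∧
      ∑ i ∈ s n, ∫ ω, Y n p q i ω ∂P ≤ C * (Q n * Real.log n)) :
    ∀ᵐ ω ∂P, ∀ᶠ n in atTop, ∀ p q, adm n p q →
      ∑ i ∈ s n, Y n p q i ω < (2 * C + 4) * (Q n * Real.log n) := by
  classical
  obtain ⟨N, hN⟩ := eventually_atTop.1 (H.and (eventually_ge_atTop 1))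
  set A : ℕ → ℕ → ℕ → Set Ω := fun n p q =>
    {ω | (2 * C + 4) * (Q n * Real.log n) ≤ ∑ i ∈ s n, Y n p q i ω} with hA
  have hbound : ∀ n ≥ N, ∀ p q, adm n p q → P (A n p q) ≤ ENNReal.ofReal ((n : ℝ) ^ (-4 : ℝ)) := by
    intro n hn p q hpq
    obtain ⟨⟨hQ, hH⟩, h1n⟩ := hN n hn
    obtain ⟨hb, hV, he⟩ := hH p q hpq
    have := (hind n p q).measureReal_sum_ge_le (hmeas n p q) (s n) hQ hb hV he
      ((C + 4) * (Q n * Real.log n))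
    rw [← ofReal_measureReal]
    apply ENNReal.ofReal_le_ofReal
    have e1 : C * (Q n * Real.log n) + (C + 4) * (Q n * Real.log n) =
      (2 * C + 4) * (Q n * Real.log n) := by ring
    rw [e1] at this
    refine this.trans (le_of_eq ?_)
    rw [Real.rpow_def_of_pos (by exact_mod_cast h1n)]
    congr 1
    field_simp
    ring
  -- the exceptional event of the union bound, empty where the hypotheses may fail
  set B : ℕ → Set Ω := fun n => if n < N then ∅ else
    ⋃ p ∈ Finset.range (c * n + 1), ⋃ q ∈ Finset.range (c * n + 1),
      {ω | adm n p q ∧ ω ∈ A n p q} with hB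
  have hBb : ∀ n, P (B n) ≤ ENNReal.ofReal (((c : ℝ) + 1) ^ 2 * (n : ℝ) ^ (-2 : ℝ)) := by
    intro n
    by_cases hn : n < N
    · simp [hB, hn]
    · simp only [hB, hn, if_false]
      have h1n := (hN n (not_lt.1 hn)).2
      calc P (⋃ p ∈ Finset.range (c * n + 1), ⋃ q ∈ Finset.range (c * n + 1),
              {ω | adm n p q ∧ ω ∈ A n p q})
          ≤ ∑ p ∈ Finset.range (c * n + 1), ∑ q ∈ Finset.range (c * n + 1),
              ENNReal.ofReal ((n : ℝ) ^ (-4 : ℝ)) := by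
            refine (measure_biUnion_finset_le _ _).trans (Finset.sum_le_sum fun p _ => ?_)
            refine (measure_biUnion_finset_le _ _).trans (Finset.sum_le_sum fun q _ => ?_)
            by_cases hpq : adm n p q
            · simpa [hpq] using hbound n (not_lt.1 hn) p q hpq
            · simp [hpq]
        _ = ENNReal.ofReal (((c * n + 1 : ℕ) : ℝ) * (((c * n + 1 : ℕ) : ℝ) *
              (n : ℝ) ^ (-4 : ℝ))) := by
            rw [ENNReal.ofReal_mul (by positivity), ENNReal.ofReal_mul (by positivity)]
            simp only [Finset.sum_const, Finset.card_range, nsmul_eq_mul, ENNReal.ofReal_natCast]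
        _ ≤ _ := by
            apply ENNReal.ofReal_le_ofReal
            have hn1 : (1 : ℝ) ≤ n := by exact_mod_cast h1n
            have hn0 : (0 : ℝ) < n := by linarith
            have h5 : (((c * n + 1 : ℕ) : ℝ)) ≤ (c + 1) * n := by push_cast; nlinarith
            have h6 : (n : ℝ) ^ (-2 : ℝ) = n * (n * (n : ℝ) ^ (-4 : ℝ)) := by
              rw [← mul_assoc, ← sq, ← Real.rpow_natCast, ← Real.rpow_add hn0]; norm_num
            rw [h6]
            calc _ ≤ ((c + 1) * (n : ℝ)) * (((c + 1) * (n : ℝ)) * (n : ℝ) ^ (-4 : ℝ)) := by gcongr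
              _ = _ := by ring
  have hsum : ∑' n, P (B n) ≠ ∞ := by
    refine ne_top_of_le_ne_top ?_ (ENNReal.tsum_le_tsum hBb)
    apply Summable.tsum_ofReal_ne_top
    exact (Real.summable_nat_rpow.2 (by norm_num)).mul_left _
  filter_upwards [ae_eventually_notMem hsum] with ω hω
  filter_upwards [hω, eventually_ge_atTop N] with n hn hnN p q hpq
  by_contra hcon
  apply hn
  simp only [hB, not_lt.2 hnN, if_false, mem_iUnion]
  obtain ⟨hp, hq⟩ := hadm n p q hpq
  exact ⟨p, by simp; omega, q, by simp; omega, hpq, not_lt.1 hcon⟩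

/-- Independent σ-algebras stay independent when they are merged along a map of index sets. -/
theorem ProbabilityTheory.iIndep.iSup_fiber {Ω κ ι : Type*} {mΩ : MeasurableSpace Ω}
    {P : Measure Ω} [IsProbabilityMeasure P] {m : κ → MeasurableSpace Ω} (hle : ∀ k, m k ≤ mΩ)
    (hm : iIndep m P) (g : κ → ι) : iIndep (fun i => ⨆ k ∈ g ⁻¹' {i}, m k) P := by
  classical
  rw [iIndep_iff]
  intro s
  induction s using Finset.induction_on with
  | empty => intro A _; simp
  | insert i s his ih =>
    intro A hA
    rw [Finset.set_biInter_insert, Finset.prod_insert his,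
      ← ih fun j hj => hA j (Finset.mem_insert_of_mem hj)]
    have hd : Disjoint (g ⁻¹' {i}) (g ⁻¹' (s : Set ι)) := by
      rw [Set.disjoint_left]
      rintro k hk hk'
      simp only [mem_preimage, mem_singleton_iff] at hk
      simp only [mem_preimage, hk, Finset.mem_coe] at hk'
      exact his hk'
    have := indep_iSup_of_disjoint hle hm hd
    refine (Indep_iff _ _ P).1 this _ _ (hA i (Finset.mem_insert_self _ _)) ?_
    refine Finset.measurableSet_biInter s fun j hj => ?_
    refine (?_ : (⨆ k ∈ g ⁻¹' {j}, m k) ≤ ⨆ k ∈ g ⁻¹' (s : Set ι), m k) _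
      (hA j (Finset.mem_insert_of_mem hj))
    refine biSup_mono fun k hk => ?_
    simp only [mem_preimage, mem_singleton_iff] at hk
    simp [hk, hj]

/-! ### Independence and moments in the sampling model -/

theorem MeasurableSpace.comap_pi_le {Ω ι β : Type*} [MeasurableSpace β] {m : MeasurableSpace Ω}
    {g : ι → Ω → β} (h : ∀ i, MeasurableSpace.comap (g i) inferInstance ≤ m) :
    MeasurableSpace.comap (fun ω i => g i ω) inferInstance ≤ m :=
  Measurable.comap_le (measurable_pi_lambda _ fun i => measurable_iff_comap_le.2 (h i))

namespace SamplingModel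

variable {Ω S : Type*} [MeasurableSpace Ω] [MeasurableSpace S] {P : Measure Ω}
  [IsProbabilityMeasure P] {ν : Measure S} {a b : ℝ} {X : S → Icc a b → ℝ}
  {f : ℝ → ℝ} {ξ : ℕ → Ω → S} {T : ℕ → ℕ → Ω → Icc a b} {U : ℕ → ℕ → Ω → ℝ}

theorem generator_le (hM : SamplingModel P ν X f ξ T U) (k : ℕ ⊕ (ℕ × ℕ) ⊕ (ℕ × ℕ)) :
    (Sum.elim (fun i : ℕ => MeasurableSpace.comap (ξ i) inferInstance)
      (Sum.elim (fun p : ℕ × ℕ => MeasurableSpace.comap (T p.1 p.2) inferInstance)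
        (fun p : ℕ × ℕ => MeasurableSpace.comap (U p.1 p.2) inferInstance))) k ≤
      (inferInstance : MeasurableSpace Ω) := by
  rcases k with i | p | p
  · exact (hM.measurable_source i).comap_le
  · exact (hM.measurable_design p.1 p.2).comap_le
  · exact (hM.measurable_error p.1 p.2).comap_le

/-- The data belonging to different curves are independent. -/
theorem iIndepFun_curve (hM : SamplingModel P ν X f ξ T U) :
    iIndepFun (fun i ω => (ξ i ω, (fun j => T i j ω), fun j => U i j ω)) P := by
  rw [iIndepFun_iff_iIndep]
  refine iIndep_of_iIndep_of_le (hM.independent.iSup_fiber hM.generator_le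
    (Sum.elim id (Sum.elim Prod.fst Prod.fst))) fun i => ?_
  refine Measurable.comap_le (@Measurable.prodMk _ _ _ _ _ _ _ _ ?_
    (@Measurable.prodMk _ _ _ _ _ _ _ _ ?_ ?_))
  · exact measurable_iff_comap_le.2 (le_iSup₂_of_le (Sum.inl i) (by simp) le_rfl)
  · exact measurable_iff_comap_le.2 <| MeasurableSpace.comap_pi_le fun j =>
      (le_iSup₂_of_le (Sum.inr (Sum.inl (i, j))) (by simp) le_rfl)
  · exact measurable_iff_comap_le.2 <| MeasurableSpace.comap_pi_le fun j =>
      (le_iSup₂_of_le (Sum.inr (Sum.inr (i, j))) (by simp) le_rfl)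

/-- The pairs of a design point and an error are independent. -/
theorem iIndepFun_pair (hM : SamplingModel P ν X f ξ T U) :
    iIndepFun (fun (p : ℕ × ℕ) ω => (T p.1 p.2 ω, U p.1 p.2 ω)) P := by
  have h1 := hM.independent.iSup_fiber hM.generator_le
    (Sum.elim (fun _ => none) (Sum.elim some some) : ℕ ⊕ (ℕ × ℕ) ⊕ (ℕ × ℕ) → Option (ℕ × ℕ))
  rw [iIndepFun_iff_iIndep]
  refine iIndep_of_iIndep_of_le (h1.precomp (Option.some_injective _)) fun p => ?_
  refine Measurable.comap_le (@Measurable.prodMk _ _ _ _ _ _ _ _ ?_ ?_)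
  · exact measurable_iff_comap_le.2 (le_iSup₂_of_le (Sum.inr (Sum.inl p)) (by simp) le_rfl)
  · exact measurable_iff_comap_le.2 (le_iSup₂_of_le (Sum.inr (Sum.inr p)) (by simp) le_rfl)

theorem iIndepFun_error (hM : SamplingModel P ν X f ξ T U) (i : ℕ) :
    iIndepFun (U i) P := by
  rw [iIndepFun_iff_iIndep]
  exact hM.independent.precomp (g := fun j => Sum.inr (Sum.inr (i, j)))
    fun j j' hj => by simpa using hj

theorem indepFun_source_design (hM : SamplingModel P ν X f ξ T U) (i : ℕ) :
    IndepFun (ξ i) (fun ω j => T i j ω) P := by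
  have h1 := (hM.independent.iSup_fiber hM.generator_le
    (Sum.elim (fun _ => false) (fun _ => true))).indep (i := false) (j := true) (by simp)
  rw [IndepFun_iff_Indep]
  refine indep_of_indep_of_le_left (indep_of_indep_of_le_right h1 ?_) ?_
  · exact MeasurableSpace.comap_pi_le fun j =>
      le_iSup₂_of_le (Sum.inr (Sum.inl (i, j))) (by simp) le_rfl
  · exact le_iSup₂_of_le (Sum.inl i) (by simp) le_rfl

theorem indepFun_design_design (hM : SamplingModel P ν X f ξ T U) (i : ℕ) {j j' : ℕ}
    (hj : j ≠ j') : IndepFun (T i j) (T i j') P := by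
  rw [IndepFun_iff_Indep]
  exact hM.independent.indep (i := Sum.inr (Sum.inl (i, j))) (j := Sum.inr (Sum.inl (i, j')))
    (by simpa using hj)

theorem indepFun_error_design (hM : SamplingModel P ν X f ξ T U) (i j : ℕ) :
    IndepFun (U i j) (T i j) P := by
  rw [IndepFun_iff_Indep]
  exact hM.independent.indep (i := Sum.inr (Sum.inr (i, j))) (j := Sum.inr (Sum.inl (i, j)))
    (by simp)

end SamplingModel

/-- The law of a design point with density `f` on `[a, b]`. -/
noncomputable def designLaw (a b : ℝ) (f : ℝ → ℝ) : Measure ℝ :=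
  (volume.restrict (Icc a b)).withDensity fun t => ENNReal.ofReal (f t)

/-- The indicator function of a set of design points. -/
noncomputable def ind (J : Set ℝ) (t : ℝ) : ℝ := J.indicator (fun _ => 1) t

theorem ind_nonneg (J : Set ℝ) (t : ℝ) : 0 ≤ ind J t := indicator_nonneg (fun _ _ => zero_le_one) t

theorem ind_le_one (J : Set ℝ) (t : ℝ) : ind J t ≤ 1 := by
  unfold ind; by_cases h : t ∈ J <;> simp [h]

theorem ind_mul_self (J : Set ℝ) (t : ℝ) : ind J t * ind J t = ind J t := by
  unfold ind; by_cases h : t ∈ J <;> simp [h]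

theorem measurable_ind {J : Set ℝ} (hJ : MeasurableSet J) : Measurable (ind J) :=
  measurable_const.indicator hJ

theorem designLaw_real_Ico_le {a b MT x y : ℝ} {f : ℝ → ℝ} (hf : ∀ t ∈ Icc a b, f t ≤ MT)
    (hMT : 0 ≤ MT) (hxy : x ≤ y) :
    (designLaw a b f).real (Ico x y) ≤ MT * (y - x) := by
  have h1 : designLaw a b f (Ico x y) ≤ ENNReal.ofReal (MT * (y - x)) := by
    rw [designLaw, withDensity_apply _ measurableSet_Ico,
      Measure.restrict_restrict measurableSet_Ico]
    calc _ ≤ ∫⁻ _ in Ico x y ∩ Icc a b, ENNReal.ofReal MT :=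
          setLIntegral_mono' (measurableSet_Ico.inter measurableSet_Icc)
            fun t ht => ENNReal.ofReal_le_ofReal (hf t ht.2)
      _ = ENNReal.ofReal MT * volume (Ico x y ∩ Icc a b) := by simp
      _ ≤ ENNReal.ofReal MT * volume (Ico x y) := by gcongr; exact inter_subset_left
      _ = _ := by rw [Real.volume_Ico, ← ENNReal.ofReal_mul hMT]
  exact ENNReal.toReal_le_of_le_ofReal (mul_nonneg hMT (by linarith)) h1

theorem le_designLaw_real_Ico {a b mT MT x y : ℝ} {f : ℝ → ℝ}
    (hf : ∀ t ∈ Icc a b, mT ≤ f t ∧ f t ≤ MT) (hmT : 0 ≤ mT) (hx : a ≤ x) (hy : y ≤ b) :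
    mT * (y - x) ≤ (designLaw a b f).real (Ico x y) := by
  have hsub : Ico x y ⊆ Icc a b := fun t ht => ⟨hx.trans ht.1, ht.2.le.trans hy⟩
  have h1 : ENNReal.ofReal (mT * (y - x)) ≤ designLaw a b f (Ico x y) := by
    rw [designLaw, withDensity_apply _ measurableSet_Ico,
      Measure.restrict_restrict measurableSet_Ico, inter_eq_left.2 hsub]
    calc _ = ∫⁻ _ in Ico x y, ENNReal.ofReal mT := by
          rw [setLIntegral_const, Real.volume_Ico, ← ENNReal.ofReal_mul hmT]
      _ ≤ _ := setLIntegral_mono' measurableSet_Ico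
            fun t ht => ENNReal.ofReal_le_ofReal (hf t (hsub ht)).1
  have h2 : designLaw a b f (Ico x y) ≠ ∞ := by
    rw [designLaw, withDensity_apply _ measurableSet_Ico,
      Measure.restrict_restrict measurableSet_Ico]
    refine ne_top_of_le_ne_top ?_ (setLIntegral_mono' (measurableSet_Ico.inter measurableSet_Icc)
            fun t ht => ENNReal.ofReal_le_ofReal (hf t ht.2).2)
    rw [setLIntegral_const]
    exact ENNReal.mul_ne_top ENNReal.ofReal_ne_top
      (ne_top_of_le_ne_top (by simp) (measure_mono inter_subset_left))
  exact (ENNReal.ofReal_le_iff_le_toReal h2).1 h1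

namespace SamplingModel

variable {Ω S : Type*} [MeasurableSpace Ω] [MeasurableSpace S] {P : Measure Ω}
  [IsProbabilityMeasure P] {ν : Measure S} {a b : ℝ} {X : S → Icc a b → ℝ}
  {f : ℝ → ℝ} {ξ : ℕ → Ω → S} {T : ℕ → ℕ → Ω → Icc a b} {U : ℕ → ℕ → Ω → ℝ}

theorem measurable_ind_design (hM : SamplingModel P ν X f ξ T U) {J : Set ℝ} (hJ : MeasurableSet J)
    (i j : ℕ) : Measurable fun ω => ind J (T i j ω) :=
  (measurable_ind hJ).comp (measurable_subtype_coe.comp (hM.measurable_design i j))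

theorem isProbabilityMeasure_designLaw (hM : SamplingModel P ν X f ξ T U) :
    IsProbabilityMeasure (designLaw a b f) := by
  rw [designLaw, ← hM.law_design 0 0]
  exact Measure.isProbabilityMeasure_map
    (measurable_subtype_coe.comp (hM.measurable_design 0 0)).aemeasurable

theorem integral_ind_design (hM : SamplingModel P ν X f ξ T U) {J : Set ℝ} (hJ : MeasurableSet J)
    (i j : ℕ) : ∫ ω, ind J (T i j ω) ∂P = (designLaw a b f).real J := by
  have h := integral_map (μ := P)
    (measurable_subtype_coe.comp (hM.measurable_design i j)).aemeasurable
    (measurable_ind hJ).aestronglyMeasurable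
  simp only [Function.comp_apply] at h
  rw [← h]
  have h2 := hM.law_design i j
  simp only [Function.comp_def]
  rw [h2, ← designLaw]
  exact integral_indicator_one hJ

/-- The design points of one curve are pairwise independent, so the proportion of them in `J` has at
most the binomial variance. -/
theorem integral_sq_proportion_le (hM : SamplingModel P ν X f ξ T U) {J : Set ℝ}
    (hJ : MeasurableSet J) (i : ℕ) {m : ℕ} (hm : 0 < m) :
    ∫ ω, ((m : ℝ)⁻¹ * ∑ j ∈ Finset.range m, ind J (T i j ω)) ^ 2 ∂P ≤
      (designLaw a b f).real J * (m : ℝ)⁻¹ + (designLaw a b f).real J ^ 2 := by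
  classical
  set π := (designLaw a b f).real J
  have hI : ∀ j j', Integrable (fun ω => ind J (T i j ω) * ind J (T i j' ω)) P := fun j j' =>
    Integrable.of_bound ((hM.measurable_ind_design hJ i j).mul
      (hM.measurable_ind_design hJ i j')).aestronglyMeasurable 1 (Eventually.of_forall fun ω => by
        rw [Real.norm_eq_abs, abs_of_nonneg (mul_nonneg (ind_nonneg _ _) (ind_nonneg _ _))]
        exact mul_le_one₀ (ind_le_one _ _) (ind_nonneg _ _) (ind_le_one _ _))
  have hterm : ∀ j j', ∫ ω, ind J (T i j ω) * ind J (T i j' ω) ∂P ≤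
      π ^ 2 + if j = j' then π else 0 := by
    intro j j'
    by_cases hjj : j = j'
    · subst hjj
      simp only [ind_mul_self, if_true]
      rw [hM.integral_ind_design hJ]
      nlinarith [sq_nonneg π]
    · have := ((hM.indepFun_design_design i hjj).comp
        ((measurable_ind hJ).comp measurable_subtype_coe)
        ((measurable_ind hJ).comp measurable_subtype_coe)).integral_fun_mul_eq_mul_integral
        (hM.measurable_ind_design hJ i j).aestronglyMeasurable
        (hM.measurable_ind_design hJ i j').aestronglyMeasurable
      simp only [Function.comp_apply] at this
      rw [this, hM.integral_ind_design hJ, hM.integral_ind_design hJ, if_neg hjj]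
      exact le_of_eq (by ring)
  have hexp : ∀ ω, ((m : ℝ)⁻¹ * ∑ j ∈ Finset.range m, ind J (T i j ω)) ^ 2 =
      ((m : ℝ)⁻¹) ^ 2 * ∑ j ∈ Finset.range m, ∑ j' ∈ Finset.range m,
        ind J (T i j ω) * ind J (T i j' ω) := by
    intro ω; rw [mul_pow, sq (∑ j ∈ _, _), Finset.sum_mul_sum]
  simp only [hexp]
  rw [integral_const_mul,
    integral_finsetSum _ fun j _ => integrable_finsetSum _ fun j' _ => hI j j']
  have h3 : ∑ j ∈ Finset.range m, ∫ ω, ∑ j' ∈ Finset.range m,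
        ind J (T i j ω) * ind J (T i j' ω) ∂P ≤
      ∑ j ∈ Finset.range m, ∑ j' ∈ Finset.range m, (π ^ 2 + if j = j' then π else 0) := by
    refine Finset.sum_le_sum fun j _ => ?_
    rw [integral_finsetSum _ fun j' _ => hI j j']
    exact Finset.sum_le_sum fun j' _ => hterm j j'
  have h4 : ∑ j ∈ Finset.range m, ∑ j' ∈ Finset.range m, (π ^ 2 + if j = j' then π else 0) =
      m * (m * π ^ 2) + m * π := by
    simp only [Finset.sum_add_distrib, Finset.sum_ite_eq, Finset.sum_const, Finset.card_range,
      nsmul_eq_mul, Finset.sum_ite_mem, Finset.inter_self]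
  have hm' : (0 : ℝ) < m := by exact_mod_cast hm
  calc _ ≤ ((m : ℝ)⁻¹) ^ 2 * (m * (m * π ^ 2) + m * π) := by rw [← h4]; gcongr
    _ = _ := by field_simp; ring

/-- The contribution of the `i`-th curve to a weighted sum over the design points in `J`. -/
noncomputable def _root_.curveTerm (g : S → Icc a b → ℝ) (ξ : ℕ → Ω → S) (T : ℕ → ℕ → Ω → Icc a b)
    (m : ℕ) (J : Set ℝ) (i : ℕ) (ω : Ω) : ℝ :=
  (m : ℝ)⁻¹ * ∑ j ∈ Finset.range m, g (ξ i ω) (T i j ω) * ind J (T i j ω)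

theorem measurable_curveTerm (hM : SamplingModel P ν X f ξ T U) {g : S → Icc a b → ℝ}
    (hg : Measurable fun p : S × Icc a b => g p.1 p.2) {J : Set ℝ} (hJ : MeasurableSet J)
    (m i : ℕ) : Measurable (curveTerm g ξ T m J i) :=
  (Finset.measurable_sum _ fun j _ =>
    (hg.comp ((hM.measurable_source i).prodMk (hM.measurable_design i j))).mul
      (hM.measurable_ind_design hJ i j)).const_mul _

theorem iIndepFun_curveTerm (hM : SamplingModel P ν X f ξ T U) {g : S → Icc a b → ℝ}
    (hg : Measurable fun p : S × Icc a b => g p.1 p.2) {J : Set ℝ} (hJ : MeasurableSet J)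
    (m : ℕ → ℕ) : iIndepFun (fun i => curveTerm g ξ T (m i) J i) P := by
  refine hM.iIndepFun_curve.comp (fun i z => ((m i : ℕ) : ℝ)⁻¹ *
    ∑ j ∈ Finset.range (m i), g z.1 (z.2.1 j) * ind J (z.2.1 j)) fun i => ?_
  refine (Finset.measurable_sum _ fun j _ => ?_).const_mul _
  have h1 : Measurable fun z : S × (ℕ → Icc a b) × (ℕ → ℝ) => z.2.1 j := by fun_prop
  exact (hg.comp (measurable_fst.prodMk h1)).mul
    ((measurable_ind hJ).comp (measurable_subtype_coe.comp h1))

theorem abs_curveTerm_le {g : S → Icc a b → ℝ} {i : ℕ} {ω : Ω} {B : ℝ}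
    (hB : ∀ t, |g (ξ i ω) t| ≤ B) (m : ℕ) (J : Set ℝ) :
    |curveTerm g ξ T m J i ω| ≤
      B * ((m : ℝ)⁻¹ * ∑ j ∈ Finset.range m, ind J (T i j ω)) := by
  rw [curveTerm, abs_mul, abs_of_nonneg (by positivity : (0 : ℝ) ≤ (m : ℝ)⁻¹), mul_left_comm]
  gcongr
  rw [Finset.mul_sum]
  refine (Finset.abs_sum_le_sum_abs _ _).trans (Finset.sum_le_sum fun j _ => ?_)
  rw [abs_mul, abs_of_nonneg (ind_nonneg _ _)]
  exact mul_le_mul_of_nonneg_right (hB _) (ind_nonneg _ _)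

theorem _root_.proportion_le_one (T : ℕ → ℕ → Ω → Icc a b) (m : ℕ) (J : Set ℝ) (i : ℕ) (ω : Ω) :
    (m : ℝ)⁻¹ * ∑ j ∈ Finset.range m, ind J (T i j ω) ≤ 1 := by
  have h1 : ∑ j ∈ Finset.range m, ind J (T i j ω) ≤ m := by
    refine (Finset.sum_le_sum fun j _ => ind_le_one J (T i j ω)).trans (by simp)
  exact (mul_le_mul_of_nonneg_left h1 (by positivity)).trans (inv_mul_le_one)

theorem _root_.proportion_nonneg (T : ℕ → ℕ → Ω → Icc a b) (m : ℕ) (J : Set ℝ) (i : ℕ) (ω : Ω) :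
    0 ≤ (m : ℝ)⁻¹ * ∑ j ∈ Finset.range m, ind J (T i j ω) :=
  mul_nonneg (by positivity) (Finset.sum_nonneg fun _ _ => ind_nonneg _ _)

theorem integral_source (hM : SamplingModel P ν X f ξ T U) (i : ℕ) {φ : S → ℝ}
    (hφ : Measurable φ) : ∫ ω, φ (ξ i ω) ∂P = ∫ s, φ s ∂ν := by
  rw [← hM.law_source i, integral_map (hM.measurable_source i).aemeasurable
    hφ.aestronglyMeasurable]

theorem integrable_source (hM : SamplingModel P ν X f ξ T U) (i : ℕ) {φ : S → ℝ}
    (hi : Integrable φ ν) : Integrable (fun ω => φ (ξ i ω)) P :=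
  (hM.law_source i ▸ hi : Integrable φ (P.map (ξ i))).comp_measurable (hM.measurable_source i)

/-- Second moment of a curve term: the design points of one curve share the realization, which
causes the term of order `π ^ 2`. -/
theorem integral_sq_curveTerm_le (hM : SamplingModel P ν X f ξ T U) {g : S → Icc a b → ℝ}
    {F : S → ℝ} (hFm : Measurable F) (hF : ∀ s t, |g s t| ≤ F s)
    (hF2 : Integrable (fun s => F s ^ 2) ν) {J : Set ℝ} (hJ : MeasurableSet J) {m : ℕ}
    (hm : 0 < m) (i : ℕ) :
    ∫ ω, curveTerm g ξ T m J i ω ^ 2 ∂P ≤ (∫ s, F s ^ 2 ∂ν) *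
      ((designLaw a b f).real J * (m : ℝ)⁻¹ + (designLaw a b f).real J ^ 2) := by
  have hA : Measurable fun t : ℕ → Icc a b =>
      ((m : ℝ)⁻¹ * ∑ j ∈ Finset.range m, ind J (t j)) ^ 2 :=
    ((Finset.measurable_sum _ fun j _ => (measurable_ind hJ).comp
      (measurable_subtype_coe.comp (measurable_pi_apply j))).const_mul _).pow_const 2
  have hT : Measurable fun ω j => T i j ω :=
    measurable_pi_lambda _ fun j => hM.measurable_design i j
  have hind := (hM.indepFun_source_design i).comp (hFm.pow_const 2) hA
  have hmul := hind.integral_fun_mul_eq_mul_integral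
    ((hFm.pow_const 2).comp (hM.measurable_source i)).aestronglyMeasurable
    (hA.comp hT).aestronglyMeasurable
  simp only [Function.comp_apply] at hmul
  have hint := hind.integrable_mul (hM.integrable_source i hF2)
    (Integrable.of_bound (hA.comp hT).aestronglyMeasurable 1 (Eventually.of_forall fun ω => by
      simp only [Function.comp_apply, Real.norm_eq_abs, abs_pow]
      rw [abs_of_nonneg (proportion_nonneg T m J i ω)]
      exact pow_le_one₀ (proportion_nonneg T m J i ω) (proportion_le_one T m J i ω)))
  calc ∫ ω, curveTerm g ξ T m J i ω ^ 2 ∂P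
      ≤ ∫ ω, F (ξ i ω) ^ 2 * ((m : ℝ)⁻¹ * ∑ j ∈ Finset.range m, ind J (T i j ω)) ^ 2 ∂P := by
        refine integral_mono_of_nonneg (Eventually.of_forall fun ω => sq_nonneg _) hint
          (Eventually.of_forall fun ω => ?_)
        simp only
        rw [← mul_pow, ← sq_abs]
        exact pow_le_pow_left₀ (abs_nonneg _) (abs_curveTerm_le (hF _) m J) 2
    _ ≤ _ := by
        rw [hmul, hM.integral_source i (hFm.pow_const 2)]
        exact mul_le_mul_of_nonneg_left (hM.integral_sq_proportion_le hJ i hm)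
          (integral_nonneg fun s => sq_nonneg _)

end SamplingModel

/-! ### Rates -/

/-- The inverse harmonic mean `γ_{n1}⁻¹` of the numbers of observations. -/
noncomputable def meanInv (m : ℕ → ℕ → ℕ) (n : ℕ) : ℝ :=
  (n : ℝ)⁻¹ * ∑ i ∈ Finset.range n, (m n i : ℝ)⁻¹

theorem meanInv_nonneg (m : ℕ → ℕ → ℕ) (n : ℕ) : 0 ≤ meanInv m n := by
  unfold meanInv; positivity

theorem meanInv_le_half {m : ℕ → ℕ → ℕ} {n : ℕ} (hm : ∀ i < n, 2 ≤ m n i) :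
    meanInv m n ≤ 1 / 2 := by
  have h1 : ∑ i ∈ Finset.range n, (m n i : ℝ)⁻¹ ≤ ∑ i ∈ Finset.range n, (1 / 2 : ℝ) := by
    refine Finset.sum_le_sum fun i hi => ?_
    have h2 : (2 : ℝ) ≤ m n i := by exact_mod_cast hm i (Finset.mem_range.1 hi)
    rw [one_div]
    exact inv_anti₀ (by norm_num) h2
  rw [Finset.sum_const, Finset.card_range, nsmul_eq_mul] at h1
  unfold meanInv
  rcases Nat.eq_zero_or_pos n with rfl | hn
  · simp
  · have hn' : (0 : ℝ) < n := by exact_mod_cast hn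
    rw [inv_mul_le_iff₀ hn']
    exact h1

/-- The variance scale `h² + h / γ_{n1}`. -/
noncomputable def varScale (m : ℕ → ℕ → ℕ) (h : ℕ → ℝ) (n : ℕ) : ℝ :=
  h n ^ 2 + h n * meanInv m n

/-- The truncation level, at which the Chernoff exponent of the truncated sums is a multiple
of `log n`. -/
noncomputable def truncLevel (m : ℕ → ℕ → ℕ) (h : ℕ → ℝ) (n : ℕ) : ℝ :=
  √(n * varScale m h n / Real.log n)

/-- The relations between the rates that hold for all large `n`. The field `tail_le` bounds the
discarded parts of truncated sums, and `trunc_log` identifies the order of the fluctuations with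
`n h δ`. -/
structure RateBounds (m : ℕ → ℕ → ℕ) (h : ℕ → ℝ) (lam : ℝ) (n : ℕ) : Prop where
  one_le : 1 ≤ n
  one_le_log : 1 ≤ Real.log n
  h_pos : 0 < h n
  h_le : h n ≤ 1 / 2
  log_le : Real.log n ≤ n * h n
  one_le_trunc : 1 ≤ truncLevel m h n
  sq_trunc : truncLevel m h n ^ 2 * Real.log n = n * varScale m h n
  tail_le : n * truncLevel m h n ^ (1 - lam) ≤ truncLevel m h n * Real.log n
  trunc_log : truncLevel m h n * Real.log n = n * h n * deltaOne m n (h n)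

theorem tendsto_log_div_nat : Tendsto (fun n : ℕ => Real.log n / n) atTop (𝓝 0) := by
  have h1 := (Real.isLittleO_log_id_atTop.tendsto_div_nhds_zero).comp
    (tendsto_natCast_atTop_atTop (R := ℝ))
  exact h1

theorem deltaOne_eq (m : ℕ → ℕ → ℕ) (n : ℕ) (h : ℝ) :
    deltaOne m n h = √((1 + meanInv m n / h) * (Real.log n / n)) := by
  unfold deltaOne harmonicMean
  rw [← meanInv, mul_inv, inv_inv, mul_comm h⁻¹, ← div_eq_mul_inv, mul_div_assoc]

theorem eventually_rateBounds {m : ℕ → ℕ → ℕ} {h : ℕ → ℝ} {lam : ℝ}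
    (hm : ∀ n, ∀ i < n, 2 ≤ m n i) (hB : BandwidthCondition m h lam) (hlam : 2 < lam) :
    ∀ᶠ n in atTop, RateBounds m h lam n ∧
      deltaOne m n (h n) ^ 2 ≤ Real.log n / n + (Real.log n / n) ^ (2 / lam) := by
  have hlam0 : 0 < lam := by linarith
  have hr1 : 2 / lam < 1 := (div_lt_one hlam0).2 hlam
  have hr0 : 0 < 2 / lam := by positivity
  have e1 := hB.rate.eventually (eventually_le_nhds (zero_lt_one' ℝ))
  have e2 := hB.tendsto_zero.eventually (eventually_le_nhds (by norm_num : (0 : ℝ) < 1 / 2))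
  have e3 := tendsto_log_div_nat.eventually (eventually_le_nhds (zero_lt_one' ℝ))
  have e4 := (Real.tendsto_log_atTop.comp (tendsto_natCast_atTop_atTop (R := ℝ))).eventually
    (eventually_ge_atTop 1)
  filter_upwards [e1, e2, e3, e4, eventually_ge_atTop 1] with n h1 h2 h3 h4 h5
  simp only [Function.comp_apply] at h4
  have hn : (0 : ℝ) < n := by exact_mod_cast h5
  have hL : 0 < Real.log n := by linarith
  have hh := hB.pos n
  set x := Real.log n / n with hx
  have hx0 : 0 < x := by positivity
  set κ := meanInv m n with hκ
  have hκ0 : 0 ≤ κ := meanInv_nonneg m n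
  have hκ2 : κ ≤ 1 / 2 := meanInv_le_half (hm n)
  set β := varScale m h n with hβ
  have hβe : β = h n ^ 2 + h n * κ := rfl
  have hβ0 : 0 < β := by rw [hβe]; positivity
  have h1' : x ^ (1 - 2 / lam) ≤ β := by
    have e : h n / harmonicMean m n = h n * κ := by
      rw [harmonicMean, ← meanInv, div_inv_eq_mul]
    rw [e, ← hβe, inv_mul_le_iff₀ hβ0, mul_one] at h1
    exact h1
  -- `β ≤ h (h + 1 / 2) ≤ h`, so the bandwidth itself is at least `(log n / n) ^ (1 - 2 / lam)`
  have hβh : β ≤ h n := by rw [hβe]; nlinarith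
  have hxr : x ≤ x ^ (1 - 2 / lam) := by
    conv_lhs => rw [← Real.rpow_one x]
    exact Real.rpow_le_rpow_of_exponent_ge hx0 h3 (by linarith)
  have hQ2 : truncLevel m h n ^ 2 = β / x := by
    rw [truncLevel, Real.sq_sqrt (by positivity), ← hβ, hx]
    field_simp
  have hQ0 : 0 ≤ truncLevel m h n := Real.sqrt_nonneg _
  have hQge : x ^ (-(2 / lam)) ≤ truncLevel m h n ^ 2 := by
    rw [hQ2, le_div_iff₀ hx0]
    calc x ^ (-(2 / lam)) * x = x ^ (1 - 2 / lam) := by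
          rw [← Real.rpow_add_one hx0.ne']; congr 1; ring
      _ ≤ β := h1'
  have hQ1 : 1 ≤ truncLevel m h n := by
    have : 1 ≤ x ^ (-(2 / lam)) := Real.one_le_rpow_of_pos_of_le_one_of_nonpos hx0 h3 (by linarith)
    nlinarith
  have hQpos : 0 < truncLevel m h n := by linarith
  have hQlam : x⁻¹ ≤ truncLevel m h n ^ lam := by
    have e := Real.rpow_le_rpow (by positivity) hQge (by positivity : (0 : ℝ) ≤ lam / 2)
    rw [← Real.rpow_mul hx0.le, ← Real.rpow_natCast, ← Real.rpow_mul hQ0] at e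
    have ea : -(2 / lam) * (lam / 2) = -1 := by field_simp
    have eb : ((2 : ℕ) : ℝ) * (lam / 2) = lam := by push_cast; ring
    rwa [ea, eb, Real.rpow_neg_one] at e
  refine ⟨⟨h5, h4, hh, h2, ?_, hQ1, ?_, ?_, ?_⟩, ?_⟩
  · have : x ≤ h n := by linarith
    rw [hx, div_le_iff₀ hn] at this
    linarith
  · rw [hQ2, hx, ← hβ]; field_simp
  · rw [Real.rpow_sub hQpos, Real.rpow_one]
    have hpos : 0 < truncLevel m h n ^ lam := Real.rpow_pos_of_pos hQpos _
    rw [mul_div_assoc', div_le_iff₀ hpos]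
    have := mul_le_mul_of_nonneg_left hQlam (by positivity : 0 ≤ truncLevel m h n * Real.log n)
    refine le_trans (le_of_eq ?_) this
    rw [hx]; field_simp
  · rw [deltaOne_eq, ← hκ, ← hx]
    have hd0 : 0 ≤ √((1 + κ / h n) * x) := Real.sqrt_nonneg _
    refine (sq_eq_sq₀ (by positivity) (by positivity)).1 ?_
    rw [mul_pow, hQ2, mul_pow, Real.sq_sqrt (by positivity), hβe, hx]
    field_simp
  · rw [deltaOne_eq, ← hκ, ← hx, Real.sq_sqrt (by positivity), add_mul, one_mul]
    gcongr
    have hxh : x ^ (1 - 2 / lam) ≤ h n := h1'.trans hβh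
    have e : x = x ^ (2 / lam) * x ^ (1 - 2 / lam) := by
      rw [← Real.rpow_add hx0]; simp
    have hp : 0 < x ^ (2 / lam) := Real.rpow_pos_of_pos hx0 _
    rw [div_mul_eq_mul_div, div_le_iff₀ hh]
    nlinarith [mul_le_mul_of_nonneg_left hxh hp.le]

theorem tendsto_deltaOne {m : ℕ → ℕ → ℕ} {h : ℕ → ℝ} {lam : ℝ}
    (hm : ∀ n, ∀ i < n, 2 ≤ m n i) (hB : BandwidthCondition m h lam) (hlam : 2 < lam) :
    Tendsto (fun n => deltaOne m n (h n)) atTop (𝓝 0) := by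
  have hr0 : 0 < 2 / lam := by positivity
  have hlim : Tendsto (fun n : ℕ => Real.log n / n + (Real.log n / n) ^ (2 / lam)) atTop (𝓝 0) := by
    have := tendsto_log_div_nat.add (tendsto_log_div_nat.rpow_const (Or.inr hr0.le))
    rwa [Real.zero_rpow hr0.ne', add_zero] at this
  have hsq : Tendsto (fun n => deltaOne m n (h n) ^ 2) atTop (𝓝 0) :=
    squeeze_zero' (Eventually.of_forall fun n => sq_nonneg _)
      ((eventually_rateBounds hm hB hlam).mono fun n hn => hn.2) hlim
  have := (Real.continuous_sqrt.tendsto 0).comp hsq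
  rw [Real.sqrt_zero] at this
  refine this.congr fun n => ?_
  simp only [Function.comp_apply]
  exact Real.sqrt_sq (Real.sqrt_nonneg _)

/-! ### Block sums of truncated curve terms -/

/-- The union of the grid cells of width `1 / n` with numbers in `[p, q)`. -/
def gridBlock (a : ℝ) (n p q : ℕ) : Set ℝ := Ico (a + p / n) (a + q / n)

/-- The index pairs of the grid blocks that are at most four bandwidths long; `c` bounds the
length of the part of the line that the grid covers. -/
def GridPair (c : ℕ) (h : ℕ → ℝ) (n p q : ℕ) : Prop :=
  p ≤ q ∧ q ≤ c * n ∧ (q : ℝ) - p ≤ 4 * (n * h n)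

theorem measurableSet_gridBlock (a : ℝ) (n p q : ℕ) : MeasurableSet (gridBlock a n p q) :=
  measurableSet_Ico

theorem designLaw_gridBlock_le {a b MT : ℝ} {f : ℝ → ℝ} (hf : ∀ t ∈ Icc a b, f t ≤ MT)
    (hMT : 0 ≤ MT) {n p q : ℕ} (hpq : p ≤ q) :
    (designLaw a b f).real (gridBlock a n p q) ≤ MT * (((q : ℝ) - p) / n) := by
  have h1 : (p : ℝ) ≤ q := by exact_mod_cast hpq
  have h2 := designLaw_real_Ico_le hf hMT (x := a + p / n) (y := a + q / n) (by gcongr)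
  refine h2.trans (le_of_eq ?_)
  ring

/-- Partial sums of independent identically distributed integrable variables grow at most
linearly. -/
theorem ae_exists_sum_le_mul {Ω : Type*} [MeasurableSpace Ω] {P : Measure Ω}
    (V : ℕ → Ω → ℝ) (hint : Integrable (V 0) P) (hind : Pairwise fun i j => IndepFun (V i) (V j) P)
    (hid : ∀ i, IdentDistrib (V i) (V 0) P P) :
    ∀ᵐ ω ∂P, ∃ C, 0 ≤ C ∧ ∀ n : ℕ, ∑ i ∈ Finset.range n, V i ω ≤ C * n := by
  filter_upwards [strong_law_ae_real V hint hind hid] with ω hω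
  obtain ⟨C, hC⟩ := hω.bddAbove_range
  refine ⟨|C|, abs_nonneg _, fun n => ?_⟩
  rcases Nat.eq_zero_or_pos n with rfl | hn
  · simp
  · have hn' : (0 : ℝ) < n := by exact_mod_cast hn
    have := (hC (mem_range_self n)).trans (le_abs_self C)
    rwa [div_le_iff₀ hn'] at this

/-- Markov-type bound for a value above the truncation level. -/
theorem le_rpow_mul_rpow_one_sub {lam Q x : ℝ} (hlam : 1 ≤ lam) (hQ : 0 < Q) (hxQ : Q ≤ x) :
    x ≤ x ^ lam * Q ^ (1 - lam) := by
  have hx0 : 0 < x := hQ.trans_le hxQ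
  calc x = x ^ lam * x ^ (1 - lam) := by rw [← Real.rpow_add hx0]; simp
    _ ≤ x ^ lam * Q ^ (1 - lam) := by
      gcongr ?_ * ?_
      exact Real.rpow_le_rpow_of_nonpos hQ hxQ (by linarith)

namespace SamplingModel

variable {Ω S : Type*} [MeasurableSpace Ω] [MeasurableSpace S] {P : Measure Ω}
  [IsProbabilityMeasure P] {ν : Measure S} [IsProbabilityMeasure ν] {a b : ℝ} {X : S → Icc a b → ℝ}
  {f : ℝ → ℝ} {ξ : ℕ → Ω → S} {T : ℕ → ℕ → Ω → Icc a b} {U : ℕ → ℕ → Ω → ℝ}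

/-- A uniform bound on the mean of `g` at fixed design points bounds the mean of a curve term. -/
theorem abs_integral_curveTerm_le (hM : SamplingModel P ν X f ξ T U) {g : S → Icc a b → ℝ}
    (hg : Measurable fun p : S × Icc a b => g p.1 p.2) {B κ : ℝ} (hB : ∀ s t, |g s t| ≤ B)
    (hκ : ∀ t, |∫ s, g s t ∂ν| ≤ κ) {J : Set ℝ} (hJ : MeasurableSet J) (m i : ℕ) :
    |∫ ω, curveTerm g ξ T m J i ω ∂P| ≤ κ * (designLaw a b f).real J := by
  have hκ0 : 0 ≤ κ := (abs_nonneg _).trans (hκ (T 0 0 (nonempty_of_isProbabilityMeasure P).some))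
  have hmeas : Measurable fun p : S × Icc a b => g p.1 p.2 * ind J p.2 :=
    hg.mul ((measurable_ind hJ).comp (measurable_subtype_coe.comp measurable_snd))
  have hbd : ∀ s t, ‖g s t * ind J t‖ ≤ B := fun s t => by
    rw [Real.norm_eq_abs, abs_mul, abs_of_nonneg (ind_nonneg _ _)]
    exact (mul_le_of_le_one_right (abs_nonneg _) (ind_le_one _ _)).trans (hB s t)
  have hpair : ∀ j, Measurable fun ω => (ξ i ω, T i j ω) := fun j =>
    (hM.measurable_source i).prodMk (hM.measurable_design i j)
  have hint : ∀ j, Integrable (fun ω => g (ξ i ω) (T i j ω) * ind J (T i j ω)) P := fun j =>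
    Integrable.of_bound (hmeas.comp (hpair j)).aestronglyMeasurable B
      (Eventually.of_forall fun ω => hbd _ _)
  have hone : ∀ j, |∫ ω, g (ξ i ω) (T i j ω) * ind J (T i j ω) ∂P| ≤
      κ * (designLaw a b f).real J := by
    intro j
    have : IsProbabilityMeasure (P.map (T i j)) :=
      Measure.isProbabilityMeasure_map (hM.measurable_design i j).aemeasurable
    have hind : IndepFun (ξ i) (T i j) P :=
      (hM.indepFun_source_design i).comp measurable_id (measurable_pi_apply j)
    have hmap := (indepFun_iff_map_prod_eq_prod_map_map
      (hM.measurable_source i).aemeasurable (hM.measurable_design i j).aemeasurable).1 hind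
    rw [hM.law_source i] at hmap
    have h1 := integral_map (hpair j).aemeasurable (μ := P)
      (f := fun p : S × Icc a b => g p.1 p.2 * ind J p.2) hmeas.aestronglyMeasurable
    rw [← h1, hmap, integral_prod_symm _ (Integrable.of_bound hmeas.aestronglyMeasurable B
      (Eventually.of_forall fun p => hbd _ _))]
    have h2 : ∀ t : Icc a b, ‖∫ s, g s t * ind J t ∂ν‖ ≤ κ * ind J t := by
      intro t
      rw [integral_mul_const, Real.norm_eq_abs, abs_mul, abs_of_nonneg (ind_nonneg _ _)]
      exact mul_le_mul_of_nonneg_right (hκ t) (ind_nonneg _ _)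
    have hm2 : Measurable fun t : Icc a b => ind J t :=
      (measurable_ind hJ).comp measurable_subtype_coe
    rw [← Real.norm_eq_abs]
    refine (norm_integral_le_of_norm_le ?_ (Eventually.of_forall h2)).trans (le_of_eq ?_)
    · refine (Integrable.of_bound hm2.aestronglyMeasurable 1
        (Eventually.of_forall fun t => ?_)).const_mul _
      rw [Real.norm_eq_abs, abs_of_nonneg (ind_nonneg _ _)]
      exact ind_le_one _ _
    · rw [integral_const_mul, integral_map (hM.measurable_design i j).aemeasurable
        hm2.aestronglyMeasurable, hM.integral_ind_design hJ]
  simp only [curveTerm]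
  rw [integral_const_mul, integral_finsetSum _ fun j _ => hint j, abs_mul,
    abs_of_nonneg (by positivity : (0 : ℝ) ≤ (m : ℝ)⁻¹)]
  calc _ ≤ (m : ℝ)⁻¹ * ∑ j ∈ Finset.range m, κ * (designLaw a b f).real J := by
        gcongr
        exact (Finset.abs_sum_le_sum_abs _ _).trans (Finset.sum_le_sum fun j _ => hone j)
    _ = ((m : ℝ)⁻¹ * m) * (κ * (designLaw a b f).real J) := by simp [mul_assoc]
    _ ≤ _ := mul_le_of_le_one_left (by positivity) inv_mul_le_one

variable {m : ℕ → ℕ → ℕ} {h : ℕ → ℝ} {lam : ℝ}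

/-- At the truncation level, the second moments of the block sums are of the order required by the
Chernoff bound. -/
theorem _root_.sum_moment_factor_le {MT : ℝ} (hMT : 0 ≤ MT) {n : ℕ} (hR : RateBounds m h lam n)
    {π : ℝ} (hπ0 : 0 ≤ π) (hπ : π ≤ 4 * MT * h n) :
    ∑ i ∈ Finset.range n, (π * (m n i : ℝ)⁻¹ + π ^ 2) ≤
      (4 * MT + 16 * MT ^ 2) * (truncLevel m h n ^ 2 * Real.log n) := by
  have hn : (0 : ℝ) < n := by exact_mod_cast hR.one_le
  have e1 : ∑ i ∈ Finset.range n, (π * (m n i : ℝ)⁻¹ + π ^ 2) = n * (π * meanInv m n + π ^ 2) := by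
    rw [Finset.sum_add_distrib, ← Finset.mul_sum, meanInv]
    simp only [Finset.sum_const, Finset.card_range, nsmul_eq_mul]
    field_simp
  have hκ := meanInv_nonneg m n
  have hh := hR.h_pos
  rw [e1, hR.sq_trunc, varScale]
  have h1 : π * meanInv m n ≤ 4 * MT * h n * meanInv m n := by gcongr
  have h2 : π ^ 2 ≤ (4 * MT * h n) ^ 2 := by gcongr
  have h3 : π * meanInv m n + π ^ 2 ≤
      (4 * MT + 16 * MT ^ 2) * (h n ^ 2 + h n * meanInv m n) := by
    have : 0 ≤ MT * h n ^ 2 := by positivity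
    have : 0 ≤ MT ^ 2 * (h n * meanInv m n) := by positivity
    nlinarith
  calc _ ≤ n * ((4 * MT + 16 * MT ^ 2) * (h n ^ 2 + h n * meanInv m n)) := by gcongr
    _ = _ := by ring

theorem _root_.GridPair.designLaw_le {MT : ℝ} {c : ℕ} (hf : ∀ t ∈ Icc a b, f t ≤ MT) (hMT : 0 ≤ MT)
    {n p q : ℕ} (hn : 1 ≤ n) (hpq : GridPair c h n p q) :
    (designLaw a b f).real (gridBlock a n p q) ≤ 4 * MT * h n := by
  have hn : (0 : ℝ) < n := by exact_mod_cast hn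
  refine (designLaw_gridBlock_le hf hMT hpq.1).trans ?_
  have : ((q : ℝ) - p) / n ≤ 4 * h n := by
    rw [div_le_iff₀ hn]; linarith [hpq.2.2]
  nlinarith

/-- Uniform one-sided bound on the sums of curve terms, for a truncated integrand whose mean is of
the order of the fluctuations. -/
theorem ae_eventually_sum_curveTerm_le (hM : SamplingModel P ν X f ξ T U) {MT : ℝ}
    (hf : ∀ t ∈ Icc a b, f t ≤ MT) (hMT : 0 ≤ MT) (hm : ∀ n, ∀ i < n, 2 ≤ m n i)
    (hR : ∀ᶠ n in atTop, RateBounds m h lam n) {g : ℕ → S → Icc a b → ℝ}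
    (hg : ∀ n, Measurable fun p : S × Icc a b => g n p.1 p.2) {F : S → ℝ} (hFm : Measurable F)
    (hF : ∀ n s t, |g n s t| ≤ F s) (hF2 : Integrable (fun s => F s ^ 2) ν)
    (hQ : ∀ᶠ n in atTop, ∀ s t, |g n s t| ≤ truncLevel m h n) {A : ℕ → ℕ → ℕ → Prop} {c : ℕ}
    (hA : ∀ n p q, A n p q → GridPair c h n p q) {C : ℝ}
    (hmean : ∀ᶠ n in atTop, ∀ p q, A n p q →
      ∑ i ∈ Finset.range n, ∫ ω, curveTerm (g n) ξ T (m n i) (gridBlock a n p q) i ω ∂P ≤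
        C * (truncLevel m h n * Real.log n)) :
    ∃ C' : ℝ, ∀ᵐ ω ∂P, ∀ᶠ n in atTop, ∀ p q, A n p q →
      ∑ i ∈ Finset.range n, curveTerm (g n) ξ T (m n i) (gridBlock a n p q) i ω ≤
        C' * (truncLevel m h n * Real.log n) := by
  set D := max C ((∫ s, F s ^ 2 ∂ν) * (4 * MT + 16 * MT ^ 2)) with hD
  have := ae_eventually_sum_lt (P := P) (fun n => Finset.range n)
    (fun n p q i => curveTerm (g n) ξ T (m n i) (gridBlock a n p q) i) A (truncLevel m h) c D
    (fun n p q hpq => ⟨(hA n p q hpq).1.trans (hA n p q hpq).2.1, (hA n p q hpq).2.1⟩)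
    (fun n p q => hM.iIndepFun_curveTerm (hg n) (measurableSet_gridBlock a n p q) (m n))
    (fun n p q i => hM.measurable_curveTerm (hg n) (measurableSet_gridBlock a n p q) _ i) (by
      filter_upwards [hR, hQ, hmean] with n hRn hQn hmn
      have hQ0 : 0 < truncLevel m h n := by linarith [hRn.one_le_trunc]
      have hL := hRn.one_le_log
      refine ⟨hQ0, fun p q hpq => ⟨fun i _ ω => ?_, ?_, ?_⟩⟩
      · exact (abs_curveTerm_le (hQn _) _ _).trans
          (mul_le_of_le_one_right hQ0.le (proportion_le_one _ _ _ _ _))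
      · have hI : 0 ≤ ∫ s, F s ^ 2 ∂ν := integral_nonneg fun s => sq_nonneg _
        calc _ ≤ ∑ i ∈ Finset.range n, (∫ s, F s ^ 2 ∂ν) *
              ((designLaw a b f).real (gridBlock a n p q) * (m n i : ℝ)⁻¹ +
                (designLaw a b f).real (gridBlock a n p q) ^ 2) := by
              refine Finset.sum_le_sum fun i hi => ?_
              have := hm n i (Finset.mem_range.1 hi)
              exact hM.integral_sq_curveTerm_le hFm (hF n) hF2 (measurableSet_gridBlock a n p q)
                (by omega) i
          _ ≤ (∫ s, F s ^ 2 ∂ν) *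
              ((4 * MT + 16 * MT ^ 2) * (truncLevel m h n ^ 2 * Real.log n)) := by
              rw [← Finset.mul_sum]
              gcongr
              exact sum_moment_factor_le hMT hRn measureReal_nonneg
                ((hA n p q hpq).designLaw_le hf hMT hRn.one_le)
          _ ≤ _ := by
              rw [← mul_assoc]
              gcongr
              exact le_max_right _ _
      · refine (hmn p q hpq).trans ?_
        gcongr
        exact le_max_left _ _)
  refine ⟨2 * D + 4, this.mono fun ω hω => hω.mono fun n hn p q hpq => (hn p q hpq).le⟩

end SamplingModel

/-! ### The process part of the noise and the weighted counts -/

theorem sq_le_one_add_rpow {lam x : ℝ} (hlam : 2 ≤ lam) (hx : 0 ≤ x) : x ^ 2 ≤ 1 + x ^ lam := by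
  have h0 : 0 ≤ x ^ lam := Real.rpow_nonneg hx _
  rcases le_total x 1 with h | h
  · have : x ^ 2 ≤ 1 := pow_le_one₀ hx h
    linarith
  · have := Real.rpow_le_rpow_of_exponent_le h hlam
    rw [Real.rpow_ofNat] at this
    linarith

theorem MeasureTheory.Integrable.sq_of_rpow {α : Type*} [MeasurableSpace α] {μ : Measure α}
    [IsFiniteMeasure μ] {F : α → ℝ} {lam : ℝ} (hlam : 2 ≤ lam) (hF : Measurable F)
    (h0 : ∀ x, 0 ≤ F x) (h : Integrable (fun x => F x ^ lam) μ) :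
    Integrable (fun x => F x ^ 2) μ := by
  refine Integrable.mono' ((integrable_const (1 : ℝ)).add h)
    (hF.pow_const 2).aestronglyMeasurable (Eventually.of_forall fun x => ?_)
  rw [Real.norm_eq_abs, abs_of_nonneg (sq_nonneg _)]
  exact sq_le_one_add_rpow hlam (h0 x)

theorem MeasureTheory.Integrable.of_rpow {α : Type*} [MeasurableSpace α] {μ : Measure α}
    [IsFiniteMeasure μ] {F : α → ℝ} {lam : ℝ} (hlam : 2 ≤ lam) (hF : Measurable F)
    (h0 : ∀ x, 0 ≤ F x) (h : Integrable (fun x => F x ^ lam) μ) : Integrable F μ := by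
  refine Integrable.mono' ((integrable_const (1 : ℝ)).add (h.sq_of_rpow hlam hF h0))
    hF.aestronglyMeasurable (Eventually.of_forall fun x => ?_)
  rw [Real.norm_eq_abs, abs_of_nonneg (h0 x)]
  simp only [Pi.add_apply]
  nlinarith [sq_nonneg (F x - 1)]

/-- The process `g₀`, set to zero except for the realizations in the set `S₀` where the
envelope `F` is at most `Q`. -/
noncomputable def truncatedPath {S : Type*} {a b : ℝ} (g₀ : S → Icc a b → ℝ) (F : S → ℝ)
    (S₀ : Set S) (Q : ℝ) (s : S) (t : Icc a b) : ℝ :=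
  (S₀ ∩ {s | F s ≤ Q}).indicator (fun s => g₀ s t) s

section Truncation

variable {S : Type*} [MeasurableSpace S] {a b : ℝ} {g₀ : S → Icc a b → ℝ} {F : S → ℝ} {S₀ : Set S}
  {Q lam : ℝ}

theorem measurable_truncatedPath (hg : Measurable fun p : S × Icc a b => g₀ p.1 p.2)
    (hF : Measurable F) (hS : MeasurableSet S₀) (Q : ℝ) :
    Measurable fun p : S × Icc a b => truncatedPath g₀ F S₀ Q p.1 p.2 := by
  have hG : MeasurableSet (S₀ ∩ {s | F s ≤ Q}) := hS.inter (measurableSet_le hF measurable_const)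
  have : (fun p : S × Icc a b => truncatedPath g₀ F S₀ Q p.1 p.2) =
      (Prod.fst ⁻¹' (S₀ ∩ {s | F s ≤ Q})).indicator fun p => g₀ p.1 p.2 := by
    ext p; rfl
  rw [this]
  exact hg.indicator (measurable_fst hG)

theorem abs_truncatedPath_le (h0 : ∀ s, 0 ≤ F s) (hdom : ∀ s ∈ S₀, ∀ t, |g₀ s t| ≤ F s) (s : S)
    (t : Icc a b) : |truncatedPath g₀ F S₀ Q s t| ≤ F s := by
  unfold truncatedPath
  by_cases h : s ∈ S₀ ∩ {s | F s ≤ Q}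
  · rw [indicator_of_mem h]; exact hdom s h.1 t
  · rw [indicator_of_notMem h, abs_zero]; exact h0 s

theorem abs_truncatedPath_le_level (hQ : 0 ≤ Q) (hdom : ∀ s ∈ S₀, ∀ t, |g₀ s t| ≤ F s) (s : S)
    (t : Icc a b) : |truncatedPath g₀ F S₀ Q s t| ≤ Q := by
  unfold truncatedPath
  by_cases h : s ∈ S₀ ∩ {s | F s ≤ Q}
  · rw [indicator_of_mem h]; exact (hdom s h.1 t).trans h.2
  · rw [indicator_of_notMem h, abs_zero]; exact hQ

theorem truncatedPath_error_le {φ : ℝ → ℝ} (hφ : ∀ x, |φ x| ≤ |x|) (hlam : 1 ≤ lam) (hQ : 0 < Q)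
    (h0 : ∀ s, 0 ≤ F s) (hdom : ∀ s ∈ S₀, ∀ t, |g₀ s t| ≤ F s) {s : S} (hs : s ∈ S₀)
    (t : Icc a b) :
    |φ (g₀ s t) - φ (truncatedPath g₀ F S₀ Q s t)| ≤ F s ^ lam * Q ^ (1 - lam) := by
  unfold truncatedPath
  by_cases h : F s ≤ Q
  · have : s ∈ S₀ ∩ {s | F s ≤ Q} := ⟨hs, h⟩
    rw [indicator_of_mem this, sub_self, abs_zero]
    exact mul_nonneg (Real.rpow_nonneg (h0 s) _) (Real.rpow_nonneg hQ.le _)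
  · have : s ∉ S₀ ∩ {s | F s ≤ Q} := fun h' => h h'.2
    have hφ0 : φ 0 = 0 := by simpa using hφ 0
    rw [indicator_of_notMem this, hφ0, sub_zero]
    exact ((hφ _).trans (hdom s hs t)).trans (le_rpow_mul_rpow_one_sub hlam hQ (not_le.1 h).le)

end Truncation

namespace SamplingModel

variable {Ω S : Type*} [MeasurableSpace Ω] [MeasurableSpace S] {P : Measure Ω}
  [IsProbabilityMeasure P] {ν : Measure S} [IsProbabilityMeasure ν] {a b : ℝ} {X : S → Icc a b → ℝ}
  {f : ℝ → ℝ} {ξ : ℕ → Ω → S} {T : ℕ → ℕ → Ω → Icc a b} {U : ℕ → ℕ → Ω → ℝ}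
  {m : ℕ → ℕ → ℕ} {h : ℕ → ℝ} {lam : ℝ}

theorem ae_forall_source_mem (hM : SamplingModel P ν X f ξ T U) {S₀ : Set S}
    (hS : ∀ᵐ s ∂ν, s ∈ S₀) : ∀ᵐ ω ∂P, ∀ i, ξ i ω ∈ S₀ :=
  ae_all_iff.2 fun i => ae_of_ae_map (hM.measurable_source i).aemeasurable
    (by rw [hM.law_source i]; exact hS)

theorem ae_exists_sum_source_le (hM : SamplingModel P ν X f ξ T U) {φ : S → ℝ}
    (hφ : Measurable φ) (hi : Integrable φ ν) :
    ∀ᵐ ω ∂P, ∃ C, 0 ≤ C ∧ ∀ n : ℕ, ∑ i ∈ Finset.range n, φ (ξ i ω) ≤ C * n := by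
  refine ae_exists_sum_le_mul (fun i ω => φ (ξ i ω)) (hM.integrable_source 0 hi) ?_ fun i => ?_
  · intro i j hij
    exact (hM.iIndepFun_curve.indepFun hij).comp (hφ.comp measurable_fst) (hφ.comp measurable_fst)
  · have : IdentDistrib (ξ i) (ξ 0) P P :=
      ⟨(hM.measurable_source i).aemeasurable, (hM.measurable_source 0).aemeasurable, by
        rw [hM.law_source, hM.law_source]⟩
    exact this.comp hφ

/-- Untruncated version of `ae_eventually_sum_curveTerm_le`, for a transform of a process with an
envelope `F` of finite moment of order `lam`: by the strong law of large numbers for `F ^ lam`, the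
discarded terms are of the order of the fluctuations. -/
theorem ae_sum_curveTerm_comp_le (hM : SamplingModel P ν X f ξ T U) {MT : ℝ}
    (hf : ∀ t ∈ Icc a b, f t ≤ MT) (hMT : 0 ≤ MT) (hm : ∀ n, ∀ i < n, 2 ≤ m n i)
    (hR : ∀ᶠ n in atTop, RateBounds m h lam n) (hlam : 2 < lam) {g₀ : S → Icc a b → ℝ}
    (hg : Measurable fun p : S × Icc a b => g₀ p.1 p.2) {F : S → ℝ} (hFm : Measurable F)
    (h0 : ∀ s, 0 ≤ F s) (hFi : Integrable (fun s => F s ^ lam) ν) {S₀ : Set S}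
    (hS : MeasurableSet S₀) (hS1 : ∀ᵐ s ∂ν, s ∈ S₀) (hdom : ∀ s ∈ S₀, ∀ t, |g₀ s t| ≤ F s)
    {φ : ℝ → ℝ} (hφm : Measurable φ) (hφ : ∀ x, |φ x| ≤ |x|) {A : ℕ → ℕ → ℕ → Prop} {c : ℕ}
    (hA : ∀ n p q, A n p q → GridPair c h n p q) {C : ℝ}
    (hmean : ∀ᶠ n in atTop, ∃ κ,
      (∀ t, |∫ s, φ (truncatedPath g₀ F S₀ (truncLevel m h n) s t) ∂ν| ≤ κ) ∧
      ∀ p q, A n p q → n * (κ * (designLaw a b f).real (gridBlock a n p q)) ≤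
        C * (truncLevel m h n * Real.log n)) :
    ∀ᵐ ω ∂P, ∃ C' : ℝ, ∀ᶠ n in atTop, ∀ p q, A n p q →
      ∑ i ∈ Finset.range n, curveTerm (fun s t => φ (g₀ s t)) ξ T (m n i) (gridBlock a n p q) i ω ≤
        C' * (truncLevel m h n * Real.log n) := by
  have hgm : ∀ n, Measurable fun p : S × Icc a b =>
      φ (truncatedPath g₀ F S₀ (truncLevel m h n) p.1 p.2) := fun n =>
    hφm.comp (measurable_truncatedPath hg hFm hS _)
  have hle : ∀ n s t, |φ (truncatedPath g₀ F S₀ (truncLevel m h n) s t)| ≤ truncLevel m h n :=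
    fun n s t => (hφ _).trans (abs_truncatedPath_le_level (Real.sqrt_nonneg _) hdom s t)
  obtain ⟨C₁, hC₁⟩ := hM.ae_eventually_sum_curveTerm_le hf hMT hm hR hgm hFm
    (fun n s t => (hφ _).trans (abs_truncatedPath_le h0 hdom s t))
    (hFi.sq_of_rpow hlam.le hFm h0) (Eventually.of_forall hle) hA (C := C) (by
      filter_upwards [hmean] with n ⟨κ, hκ, hn⟩ p q hpq
      refine le_trans ?_ (hn p q hpq)
      refine (Finset.sum_le_sum fun i _ => (le_abs_self _).trans
        (hM.abs_integral_curveTerm_le (hgm n) (hle n) hκ (measurableSet_gridBlock a n p q)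
          (m n i) i)).trans ?_
      simp)
  filter_upwards [hC₁, hM.ae_forall_source_mem hS1,
    hM.ae_exists_sum_source_le (hFm.pow_const lam) hFi] with ω h1 h2 ⟨C₂, hC₂0, hC₂⟩
  refine ⟨C₁ + C₂, ?_⟩
  filter_upwards [h1, hR] with n hn hRn p q hpq
  have hQ0 : 0 < truncLevel m h n := by linarith [hRn.one_le_trunc]
  have hpt : ∀ i, curveTerm (fun s t => φ (g₀ s t)) ξ T (m n i) (gridBlock a n p q) i ω ≤
      curveTerm (fun s t => φ (truncatedPath g₀ F S₀ (truncLevel m h n) s t)) ξ T (m n i)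
        (gridBlock a n p q) i ω + F (ξ i ω) ^ lam * truncLevel m h n ^ (1 - lam) := by
    intro i
    have h3 := abs_curveTerm_le (ξ := ξ) (T := T) (i := i) (ω := ω)
      (g := fun s t => φ (g₀ s t) - φ (truncatedPath g₀ F S₀ (truncLevel m h n) s t))
      (fun t => truncatedPath_error_le hφ (by linarith : 1 ≤ lam) hQ0 h0 hdom (h2 i) t)
      (m n i) (gridBlock a n p q)
    have h4 : curveTerm (fun s t => φ (g₀ s t) - φ (truncatedPath g₀ F S₀ (truncLevel m h n) s t))
        ξ T (m n i) (gridBlock a n p q) i ω =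
        curveTerm (fun s t => φ (g₀ s t)) ξ T (m n i) (gridBlock a n p q) i ω -
        curveTerm (fun s t => φ (truncatedPath g₀ F S₀ (truncLevel m h n) s t)) ξ T (m n i)
          (gridBlock a n p q) i ω := by
      simp only [curveTerm, sub_mul, Finset.sum_sub_distrib, mul_sub]
    have h5 : 0 ≤ F (ξ i ω) ^ lam * truncLevel m h n ^ (1 - lam) :=
      mul_nonneg (Real.rpow_nonneg (h0 _) _) (Real.rpow_nonneg hQ0.le _)
    have h6 := h3.trans (mul_le_of_le_one_right h5 (proportion_le_one T _ _ i ω))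
    rw [h4] at h6
    linarith [le_abs_self (curveTerm (fun s t => φ (g₀ s t)) ξ T (m n i) (gridBlock a n p q) i ω -
        curveTerm (fun s t => φ (truncatedPath g₀ F S₀ (truncLevel m h n) s t)) ξ T (m n i)
          (gridBlock a n p q) i ω)]
  refine (Finset.sum_le_sum fun i _ => hpt i).trans ?_
  rw [Finset.sum_add_distrib, ← Finset.sum_mul, add_mul]
  refine add_le_add (hn p q hpq) ?_
  calc _ ≤ C₂ * n * truncLevel m h n ^ (1 - lam) := by
        gcongr
        exact hC₂ n
    _ = C₂ * (n * truncLevel m h n ^ (1 - lam)) := by ring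
    _ ≤ _ := mul_le_mul_of_nonneg_left hRn.tail_le hC₂0

/-- The process part of the errors: sums over grid blocks, and sums of absolute values over single
grid cells. -/
theorem ae_process_bounds (hM : SamplingModel P ν X f ξ T U) {MT : ℝ}
    (hf : ∀ t ∈ Icc a b, f t ≤ MT) (hMT : 0 ≤ MT) (hm : ∀ n, ∀ i < n, 2 ≤ m n i)
    (hR : ∀ᶠ n in atTop, RateBounds m h lam n) (hlam : 2 < lam) {g₀ : S → Icc a b → ℝ}
    (hg : Measurable fun p : S × Icc a b => g₀ p.1 p.2) (hg0 : ∀ t, ∫ s, g₀ s t ∂ν = 0)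
    {F : S → ℝ} (hFm : Measurable F)
    (h0 : ∀ s, 0 ≤ F s) (hFi : Integrable (fun s => F s ^ lam) ν) {S₀ : Set S}
    (hS : MeasurableSet S₀) (hS1 : ∀ᵐ s ∂ν, s ∈ S₀) (hdom : ∀ s ∈ S₀, ∀ t, |g₀ s t| ≤ F s) (c : ℕ) :
    ∀ᵐ ω ∂P, ∃ C : ℝ, ∀ᶠ n in atTop, ∀ p q, GridPair c h n p q →
      |∑ i ∈ Finset.range n, curveTerm g₀ ξ T (m n i) (gridBlock a n p q) i ω| ≤
        C * (truncLevel m h n * Real.log n) ∧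
      (q = p + 1 → ∑ i ∈ Finset.range n,
        curveTerm (fun s t => |g₀ s t|) ξ T (m n i) (gridBlock a n p q) i ω ≤
        C * (truncLevel m h n * Real.log n)) := by
  have hFi1 := hFi.of_rpow hlam.le hFm h0
  have hprob := hM.isProbabilityMeasure_designLaw
  have hsm : ∀ t, Measurable fun s => g₀ s t := fun t => hg.comp measurable_prodMk_right
  have hgi : ∀ t, Integrable (fun s => g₀ s t) ν := fun t =>
    hFi1.mono' (hsm t).aestronglyMeasurable (hS1.mono fun s hs => hdom s hs t)
  have htm : ∀ Q t, Measurable fun s => truncatedPath g₀ F S₀ Q s t := fun Q t =>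
    (measurable_truncatedPath hg hFm hS Q).comp measurable_prodMk_right
  have hti : ∀ Q t, Integrable (fun s => truncatedPath g₀ F S₀ Q s t) ν := fun Q t =>
    hFi1.mono' (htm Q t).aestronglyMeasurable
      (Eventually.of_forall fun s => abs_truncatedPath_le h0 hdom s t)
  -- centring: the mean of the truncated process is minus the mean of the discarded part
  have hcent : ∀ Q, 0 < Q → ∀ t, |∫ s, truncatedPath g₀ F S₀ Q s t ∂ν| ≤
      (∫ s, F s ^ lam ∂ν) * Q ^ (1 - lam) := by
    intro Q hQ t
    have e : ∫ s, truncatedPath g₀ F S₀ Q s t ∂ν =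
        -∫ s, (g₀ s t - truncatedPath g₀ F S₀ Q s t) ∂ν := by
      rw [integral_sub (hgi t) (hti Q t), hg0]; ring
    rw [e, abs_neg, ← integral_mul_const, ← Real.norm_eq_abs]
    refine norm_integral_le_of_norm_le (hFi.mul_const _) (hS1.mono fun s hs => ?_)
    exact truncatedPath_error_le (φ := id) (fun x => le_rfl) (by linarith : 1 ≤ lam) hQ h0 hdom hs t
  set I := ∫ s, F s ^ lam ∂ν with hI
  have hI0 : 0 ≤ I := integral_nonneg fun s => Real.rpow_nonneg (h0 s) _
  have hmeanI : ∀ n, RateBounds m h lam n → ∀ p q,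
      n * ((I * truncLevel m h n ^ (1 - lam)) * (designLaw a b f).real (gridBlock a n p q)) ≤
        I * (truncLevel m h n * Real.log n) := by
    intro n hRn p q
    have hQ0 : 0 < truncLevel m h n := by linarith [hRn.one_le_trunc]
    calc _ ≤ n * ((I * truncLevel m h n ^ (1 - lam)) * 1) := by
          gcongr
          exact measureReal_le_one
      _ = I * (n * truncLevel m h n ^ (1 - lam)) := by ring
      _ ≤ _ := mul_le_mul_of_nonneg_left hRn.tail_le hI0
  have hup := hM.ae_sum_curveTerm_comp_le hf hMT hm hR hlam hg hFm h0 hFi hS hS1 hdom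
    (φ := fun x => x) measurable_id (fun x => le_rfl) (A := GridPair c h)
    (fun _ _ _ hpq => hpq) (C := I) (by
      filter_upwards [hR] with n hRn
      exact ⟨_, hcent _ (by linarith [hRn.one_le_trunc]), fun p q _ => hmeanI n hRn p q⟩)
  have hdown := hM.ae_sum_curveTerm_comp_le hf hMT hm hR hlam hg hFm h0 hFi hS hS1 hdom
    (φ := fun x => -x) measurable_neg (fun x => (abs_neg x).le) (A := GridPair c h)
    (fun _ _ _ hpq => hpq) (C := I) (by
      filter_upwards [hR] with n hRn
      refine ⟨I * truncLevel m h n ^ (1 - lam), fun t => ?_, fun p q _ => hmeanI n hRn p q⟩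
      rw [integral_neg, abs_neg]
      exact hcent _ (by linarith [hRn.one_le_trunc]) t)
  have habs := hM.ae_sum_curveTerm_comp_le hf hMT hm hR hlam hg hFm h0 hFi hS hS1 hdom
    (φ := fun x => |x|) continuous_abs.measurable (fun x => (abs_abs x).le)
    (A := fun n p q => GridPair c h n p q ∧ q = p + 1)
    (fun _ _ _ hpq => hpq.1) (C := (∫ s, F s ∂ν) * MT) (by
      filter_upwards [hR] with n hRn
      have hn : (0 : ℝ) < n := by exact_mod_cast hRn.one_le
      have hE : 0 ≤ ∫ s, F s ∂ν := integral_nonneg h0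
      refine ⟨∫ s, F s ∂ν, fun t => ?_, fun p q hpq => ?_⟩
      · rw [← Real.norm_eq_abs]
        refine norm_integral_le_of_norm_le hFi1 (Eventually.of_forall fun s => ?_)
        rw [Real.norm_eq_abs, abs_abs]
        exact abs_truncatedPath_le h0 hdom s t
      · have hπ := designLaw_gridBlock_le hf hMT (n := n) hpq.1.1
        have e : (q : ℝ) - p = 1 := by rw [hpq.2]; push_cast; ring
        rw [e] at hπ
        calc (n : ℝ) * ((∫ s, F s ∂ν) * (designLaw a b f).real (gridBlock a n p q))
            ≤ n * ((∫ s, F s ∂ν) * (MT * (1 / n))) := by gcongr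
          _ = (∫ s, F s ∂ν) * MT * 1 := by field_simp
          _ ≤ _ := by
            gcongr
            nlinarith [hRn.one_le_trunc, hRn.one_le_log])
  filter_upwards [hup, hdown, habs] with ω ⟨C₁, h1⟩ ⟨C₂, h2⟩ ⟨C₃, h3⟩
  refine ⟨max C₁ (max C₂ C₃), ?_⟩
  filter_upwards [h1, h2, h3, hR] with n h1 h2 h3 hRn p q hpq
  have hQL : 0 ≤ truncLevel m h n * Real.log n :=
    mul_nonneg (Real.sqrt_nonneg _) (by linarith [hRn.one_le_log])
  refine ⟨abs_le'.2 ⟨(h1 p q hpq).trans ?_, le_trans (le_of_eq ?_) ((h2 p q hpq).trans ?_)⟩,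
    fun hq => (h3 p q ⟨hpq, hq⟩).trans ?_⟩
  · gcongr; exact le_max_left _ _
  · simp only [curveTerm, neg_mul, Finset.sum_neg_distrib, mul_neg]
  · gcongr; exact (le_max_left _ _).trans (le_max_right _ _)
  · gcongr; exact (le_max_right _ _).trans (le_max_right _ _)

/-- The weighted numbers of design points in the grid blocks are uniformly close to their means. -/
theorem ae_count_bounds (hM : SamplingModel P ν X f ξ T U) {MT : ℝ}
    (hf : ∀ t ∈ Icc a b, f t ≤ MT) (hMT : 0 ≤ MT) (hm : ∀ n, ∀ i < n, 2 ≤ m n i)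
    (hR : ∀ᶠ n in atTop, RateBounds m h lam n) (c : ℕ) :
    ∃ C : ℝ, ∀ᵐ ω ∂P, ∀ᶠ n in atTop, ∀ p q, GridPair c h n p q →
      |∑ i ∈ Finset.range n, (m n i : ℝ)⁻¹ * ∑ j ∈ Finset.range (m n i),
        ind (gridBlock a n p q) (T i j ω) - n * (designLaw a b f).real (gridBlock a n p q)| ≤
        C * (truncLevel m h n * Real.log n) := by
  have hprob := hM.isProbabilityMeasure_designLaw
  set pr : ℕ → ℕ → ℕ → ℕ → Ω → ℝ := fun n p q i ω =>
    (m n i : ℝ)⁻¹ * ∑ j ∈ Finset.range (m n i), ind (gridBlock a n p q) (T i j ω) with hpr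
  set π : ℕ → ℕ → ℕ → ℝ := fun n p q => (designLaw a b f).real (gridBlock a n p q) with hπ
  have hπ0 : ∀ n p q, 0 ≤ π n p q := fun n p q => measureReal_nonneg
  have hπ1 : ∀ n p q, π n p q ≤ 1 := fun n p q => measureReal_le_one
  have hpm : ∀ n p q i, Measurable (pr n p q i) := fun n p q i =>
    (Finset.measurable_sum _ fun j _ =>
      hM.measurable_ind_design (measurableSet_gridBlock a n p q) i j).const_mul _
  have hpi : ∀ n p q i, Integrable (pr n p q i) P := fun n p q i =>
    Integrable.of_bound (hpm n p q i).aestronglyMeasurable 1 (Eventually.of_forall fun ω => by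
      rw [Real.norm_eq_abs, abs_of_nonneg (proportion_nonneg _ _ _ _ _)]
      exact proportion_le_one _ _ _ _ _)
  have hp2 : ∀ n p q i, Integrable (fun ω => pr n p q i ω ^ 2) P := fun n p q i =>
    Integrable.of_bound ((hpm n p q i).pow_const 2).aestronglyMeasurable 1
      (Eventually.of_forall fun ω => by
        rw [Real.norm_eq_abs, abs_of_nonneg (sq_nonneg _)]
        exact pow_le_one₀ (proportion_nonneg _ _ _ _ _) (proportion_le_one _ _ _ _ _))
  have hEp : ∀ n p q, ∀ i < n, ∫ ω, pr n p q i ω ∂P = π n p q := by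
    intro n p q i hi
    have h2 : (2 : ℝ) ≤ m n i := by exact_mod_cast hm n i hi
    simp only [hpr]
    rw [integral_const_mul, integral_finsetSum]
    · simp only [hM.integral_ind_design (measurableSet_gridBlock a n p q)]
      rw [Finset.sum_const, Finset.card_range, nsmul_eq_mul, inv_mul_cancel_left₀ (by linarith)]
    · intro j _
      refine Integrable.of_bound (hM.measurable_ind_design (measurableSet_gridBlock a n p q)
        i j).aestronglyMeasurable 1 (Eventually.of_forall fun ω => ?_)
      rw [Real.norm_eq_abs, abs_of_nonneg (ind_nonneg _ _)]
      exact ind_le_one _ _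
  set D := 2 * (4 * MT + 16 * MT ^ 2) with hD
  have key : ∀ σ : ℝ, |σ| = 1 → ∀ᵐ ω ∂P, ∀ᶠ n in atTop, ∀ p q, GridPair c h n p q →
      ∑ i ∈ Finset.range n, σ * (pr n p q i ω - π n p q) <
        (2 * D + 4) * (truncLevel m h n * Real.log n) := by
    intro σ hσ
    refine ae_eventually_sum_lt (P := P) (fun n => Finset.range n)
      (fun n p q i ω => σ * (pr n p q i ω - π n p q)) (GridPair c h) (truncLevel m h) c D
      (fun n p q hpq => ⟨hpq.1.trans hpq.2.1, hpq.2.1⟩) (fun n p q => ?_)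
      (fun n p q i => ((hpm n p q i).sub_const _).const_mul _) ?_
    · refine hM.iIndepFun_curve.comp (fun i z => σ * ((m n i : ℝ)⁻¹ *
        ∑ j ∈ Finset.range (m n i), ind (gridBlock a n p q) (z.2.1 j) - π n p q)) fun i => ?_
      refine (((Finset.measurable_sum _ fun j _ => ?_).const_mul _).sub_const _).const_mul _
      have h1 : Measurable fun z : S × (ℕ → Icc a b) × (ℕ → ℝ) => z.2.1 j := by fun_prop
      exact (measurable_ind (measurableSet_gridBlock a n p q)).comp (measurable_subtype_coe.comp h1)
    · filter_upwards [hR] with n hRn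
      have hQ1 := hRn.one_le_trunc
      have hL := hRn.one_le_log
      refine ⟨by linarith, fun p q hpq => ⟨fun i _ ω => ?_, ?_, ?_⟩⟩
      · rw [abs_mul, hσ, one_mul]
        have h1 : 0 ≤ pr n p q i ω := proportion_nonneg _ _ _ _ _
        have h2 : pr n p q i ω ≤ 1 := proportion_le_one _ _ _ _ _
        exact (abs_le.2 ⟨by linarith [hπ1 n p q], by linarith [hπ0 n p q]⟩ : _ ≤ (1 : ℝ)).trans hQ1
      · calc _ ≤ ∑ i ∈ Finset.range n, 2 * (π n p q * (m n i : ℝ)⁻¹ + π n p q ^ 2) := by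
              refine Finset.sum_le_sum fun i hi => ?_
              have hmi := hm n i (Finset.mem_range.1 hi)
              have h1 : ∫ ω, (σ * (pr n p q i ω - π n p q)) ^ 2 ∂P ≤
                  ∫ ω, (pr n p q i ω ^ 2 + π n p q ^ 2) ∂P := by
                refine integral_mono_of_nonneg (Eventually.of_forall fun ω => sq_nonneg _)
                  ((hp2 n p q i).add (integrable_const _)) (Eventually.of_forall fun ω => ?_)
                have h1 : 0 ≤ pr n p q i ω := proportion_nonneg _ _ _ _ _
                simp only
                rw [mul_pow, ← sq_abs σ, hσ]
                nlinarith [hπ0 n p q, mul_nonneg h1 (hπ0 n p q)]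
              rw [integral_add (hp2 n p q i) (integrable_const _)] at h1
              simp only [integral_const, probReal_univ, smul_eq_mul, one_mul] at h1
              have h2 := hM.integral_sq_proportion_le (measurableSet_gridBlock a n p q) i
                (m := m n i) (by omega)
              have h3 : 0 ≤ π n p q * (m n i : ℝ)⁻¹ := mul_nonneg (hπ0 n p q) (by positivity)
              simp only [hpr, hπ] at h1 h3 ⊢
              linarith
          _ ≤ _ := by
              rw [← Finset.mul_sum, hD, mul_assoc]
              gcongr
              exact sum_moment_factor_le hMT hRn (hπ0 n p q) (hpq.designLaw_le hf hMT hRn.one_le)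
      · rw [Finset.sum_eq_zero]
        · positivity
        · intro i hi
          rw [integral_const_mul, integral_sub (hpi n p q i) (integrable_const _),
            hEp n p q i (Finset.mem_range.1 hi)]
          simp
  refine ⟨2 * D + 4, ?_⟩
  filter_upwards [key 1 (by simp), key (-1) (by simp)] with ω h1 h2
  filter_upwards [h1, h2] with n h1 h2 p q hpq
  have h1 := h1 p q hpq
  have h2 := h2 p q hpq
  have e : ∑ i ∈ Finset.range n, (pr n p q i ω - π n p q) =
      ∑ i ∈ Finset.range n, pr n p q i ω - n * π n p q := by
    rw [Finset.sum_sub_distrib]; simp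
  rw [← Finset.mul_sum, e] at h1 h2
  exact abs_le.2 ⟨by linarith, by linarith⟩

end SamplingModel

/-! ### The measurement errors -/

/-- Truncation of a real number at the level `c`: larger values are replaced by zero. -/
noncomputable def truncAt (c u : ℝ) : ℝ := {u : ℝ | |u| ≤ c}.indicator id u

theorem measurable_truncAt (c : ℝ) : Measurable (truncAt c) :=
  measurable_id.indicator (measurableSet_le continuous_abs.measurable measurable_const)

theorem abs_truncAt_le (c u : ℝ) : |truncAt c u| ≤ |u| := by
  unfold truncAt
  by_cases h : u ∈ {u : ℝ | |u| ≤ c}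
  · rw [indicator_of_mem h]; rfl
  · rw [indicator_of_notMem h, abs_zero]; exact abs_nonneg u

theorem abs_truncAt_le_level {c : ℝ} (hc : 0 ≤ c) (u : ℝ) : |truncAt c u| ≤ c := by
  unfold truncAt
  by_cases h : u ∈ {u : ℝ | |u| ≤ c}
  · rw [indicator_of_mem h]; exact h
  · rw [indicator_of_notMem h, abs_zero]; exact hc

theorem truncAt_error_le {φ : ℝ → ℝ} (hφ : ∀ x, |φ x| ≤ |x|) {lam c : ℝ} (hlam : 1 ≤ lam)
    (hc : 0 < c) (u : ℝ) : |φ u - φ (truncAt c u)| ≤ |u| ^ lam * c ^ (1 - lam) := by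
  unfold truncAt
  by_cases h : u ∈ {u : ℝ | |u| ≤ c}
  · rw [indicator_of_mem h, id, sub_self, abs_zero]
    exact mul_nonneg (Real.rpow_nonneg (abs_nonneg _) _) (Real.rpow_nonneg hc.le _)
  · have hφ0 : φ 0 = 0 := by simpa using hφ 0
    rw [indicator_of_notMem h, hφ0, sub_zero]
    exact (hφ u).trans (le_rpow_mul_rpow_one_sub hlam hc (not_le.1 h).le)

/-- A weighted sum of moments of all the errors of one curve. It dominates the discarded parts of
the averages of the first `m` errors simultaneously for all `m`; the supremum of the averages of
`|u j| ^ lam` itself need not be integrable. -/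
noncomputable def errorEnvelope (lam : ℝ) (u : ℕ → ℝ) : ℝ :=
  (∑' j : ℕ, ENNReal.ofReal (|u j| ^ lam * ((j : ℝ) + 1) ^ (-lam))).toReal

theorem measurable_errorEnvelope (lam : ℝ) : Measurable (errorEnvelope lam) := by
  refine (Measurable.tsum fun j => ?_).ennreal_toReal
  have h1 : Measurable fun u : ℕ → ℝ => |u j| :=
    continuous_abs.measurable.comp (measurable_pi_apply j)
  exact ((h1.pow_const lam).mul_const _).ennreal_ofReal

theorem sum_le_errorEnvelope {lam : ℝ} {u : ℕ → ℝ}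
    (hu : ∑' j : ℕ, ENNReal.ofReal (|u j| ^ lam * ((j : ℝ) + 1) ^ (-lam)) ≠ ∞) (m : ℕ) :
    ∑ j ∈ Finset.range m, |u j| ^ lam * ((j : ℝ) + 1) ^ (-lam) ≤ errorEnvelope lam u := by
  have h1 : ∀ j ∈ Finset.range m, 0 ≤ |u j| ^ lam * ((j : ℝ) + 1) ^ (-lam) := fun j _ =>
    mul_nonneg (Real.rpow_nonneg (abs_nonneg _) _) (Real.rpow_nonneg (by positivity) _)
  rw [errorEnvelope, ← ENNReal.ofReal_le_iff_le_toReal hu, ENNReal.ofReal_sum_of_nonneg h1]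
  exact ENNReal.sum_le_tsum _

namespace SamplingModel

variable {Ω S : Type*} [MeasurableSpace Ω] [MeasurableSpace S] {P : Measure Ω}
  [IsProbabilityMeasure P] {ν : Measure S} [IsProbabilityMeasure ν] {a b : ℝ} {X : S → Icc a b → ℝ}
  {f : ℝ → ℝ} {ξ : ℕ → Ω → S} {T : ℕ → ℕ → Ω → Icc a b} {U : ℕ → ℕ → Ω → ℝ}
  {m : ℕ → ℕ → ℕ} {h : ℕ → ℝ} {lam : ℝ}

theorem lintegral_errorEnvelope_ne_top (hM : SamplingModel P ν X f ξ T U) (hlam : 2 < lam)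
    (hU : Integrable (fun ω => |U 0 0 ω| ^ lam) P) (i : ℕ) :
    ∫⁻ ω, ∑' j : ℕ, ENNReal.ofReal (|U i j ω| ^ lam * ((j : ℝ) + 1) ^ (-lam)) ∂P ≠ ∞ := by
  have hm : ∀ j, Measurable fun ω => |U i j ω| ^ lam := fun j =>
    (continuous_abs.measurable.comp (hM.measurable_error i j)).pow_const lam
  have hpw : Measurable fun x : ℝ => |x| ^ lam := continuous_abs.measurable.pow_const lam
  rw [lintegral_tsum fun j => ((hm j).mul_const _).ennreal_ofReal.aemeasurable]
  have h1 : ∀ j : ℕ, ∫⁻ ω, ENNReal.ofReal (|U i j ω| ^ lam * ((j : ℝ) + 1) ^ (-lam)) ∂P =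
      (∫⁻ ω, ENNReal.ofReal (|U 0 0 ω| ^ lam) ∂P) * ENNReal.ofReal (((j : ℝ) + 1) ^ (-lam)) := by
    intro j
    have h2 := ((hM.identDistrib_error i j).comp hpw.ennreal_ofReal).lintegral_eq
    simp only [Function.comp_apply] at h2
    rw [← h2, ← lintegral_mul_const _ (hm j).ennreal_ofReal]
    refine lintegral_congr fun ω => ?_
    exact ENNReal.ofReal_mul (Real.rpow_nonneg (abs_nonneg _) _)
  simp only [h1]
  rw [ENNReal.tsum_mul_left]
  refine ENNReal.mul_ne_top hU.lintegral_lt_top.ne ?_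
  apply Summable.tsum_ofReal_ne_top
  have h3 := (summable_nat_add_iff 1).2 (Real.summable_nat_rpow.2 (by linarith : -lam < -1))
  simpa using h3

theorem ae_exists_sum_errorEnvelope_le (hM : SamplingModel P ν X f ξ T U) (hlam : 2 < lam)
    (hU : Integrable (fun ω => |U 0 0 ω| ^ lam) P) :
    ∀ᵐ ω ∂P, ∃ C, 0 ≤ C ∧ ∀ n : ℕ,
      ∑ i ∈ Finset.range n, errorEnvelope lam (fun j => U i j ω) ≤ C * n := by
  have hmU : ∀ i, Measurable fun ω j => U i j ω := fun i =>
    measurable_pi_lambda _ fun j => hM.measurable_error i j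
  refine ae_exists_sum_le_mul (fun i ω => errorEnvelope lam fun j => U i j ω) ?_ ?_ fun i => ?_
  · refine integrable_toReal_of_lintegral_ne_top ?_ (hM.lintegral_errorEnvelope_ne_top hlam hU 0)
    refine (Measurable.tsum fun j => ?_).aemeasurable
    exact (((continuous_abs.measurable.comp (hM.measurable_error 0 j)).pow_const lam).mul_const
      _).ennreal_ofReal
  · intro i j hij
    exact (hM.iIndepFun_curve.indepFun hij).comp
      ((measurable_errorEnvelope lam).comp (measurable_snd.comp measurable_snd))
      ((measurable_errorEnvelope lam).comp (measurable_snd.comp measurable_snd))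
  · have : IdentDistrib (fun ω j => U i j ω) (fun ω j => U 0 j ω) P P := by
      refine ⟨(hmU i).aemeasurable, (hmU 0).aemeasurable, ?_⟩
      rw [(hM.iIndepFun_error i).map_fun_eq_infinitePi_map (hM.measurable_error i),
        (hM.iIndepFun_error 0).map_fun_eq_infinitePi_map (hM.measurable_error 0)]
      congr 1
      funext j
      rw [(hM.identDistrib_error i j).map_eq, (hM.identDistrib_error 0 j).map_eq]
    exact this.comp (measurable_errorEnvelope lam)

/-- The contribution of one observation to a weighted sum of transformed truncated errors over the
design points in `J`; `k` is the number of observations on the curve and `Q` the truncation level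
of the weighted error. -/
noncomputable def _root_.errorTerm (φ : ℝ → ℝ) (T : ℕ → ℕ → Ω → Icc a b) (U : ℕ → ℕ → Ω → ℝ)
    (k : ℕ) (Q : ℝ) (J : Set ℝ) (x : Σ _ : ℕ, ℕ) (ω : Ω) : ℝ :=
  (k : ℝ)⁻¹ * φ (truncAt (k * Q) (U x.1 x.2 ω)) * ind J (T x.1 x.2 ω)

theorem _root_.abs_errorTerm_le {φ : ℝ → ℝ} (hφ : ∀ x, |φ x| ≤ |x|) (T : ℕ → ℕ → Ω → Icc a b)
    (U : ℕ → ℕ → Ω → ℝ) (k : ℕ) {Q : ℝ} (hQ : 0 ≤ Q) (J : Set ℝ) (x : Σ _ : ℕ, ℕ) (ω : Ω) :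
    |errorTerm φ T U k Q J x ω| ≤ Q := by
  rw [errorTerm, abs_mul, abs_mul, abs_of_nonneg (ind_nonneg _ _),
    abs_of_nonneg (by positivity : (0 : ℝ) ≤ (k : ℝ)⁻¹)]
  have h1 := (hφ _).trans (abs_truncAt_le_level (c := k * Q) (by positivity) (U x.1 x.2 ω))
  calc _ ≤ (k : ℝ)⁻¹ * (k * Q) * 1 := by
        gcongr
        · exact ind_nonneg _ _
        · exact ind_le_one _ _
    _ = ((k : ℝ)⁻¹ * k) * Q := by ring
    _ ≤ Q := mul_le_of_le_one_left hQ inv_mul_le_one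

theorem measurable_errorTerm (hM : SamplingModel P ν X f ξ T U) {φ : ℝ → ℝ} (hφ : Measurable φ)
    (k : ℕ) (Q : ℝ) {J : Set ℝ} (hJ : MeasurableSet J) (x : Σ _ : ℕ, ℕ) :
    Measurable (errorTerm φ T U k Q J x) :=
  (((hφ.comp (measurable_truncAt _)).comp (hM.measurable_error x.1 x.2)).const_mul _).mul
    (hM.measurable_ind_design hJ x.1 x.2)

theorem iIndepFun_errorTerm (hM : SamplingModel P ν X f ξ T U) {φ : ℝ → ℝ} (hφ : Measurable φ)
    (k : ℕ → ℕ) (Q : ℝ) {J : Set ℝ} (hJ : MeasurableSet J) :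
    iIndepFun (fun x : Σ _ : ℕ, ℕ => errorTerm φ T U (k x.1) Q J x) P := by
  have h1 := hM.iIndepFun_pair.precomp (g := fun x : Σ _ : ℕ, ℕ => (x.1, x.2)) (by
    rintro ⟨i, j⟩ ⟨i', j'⟩ h; simpa using h)
  refine h1.comp (fun x z => (k x.1 : ℝ)⁻¹ * φ (truncAt (k x.1 * Q) z.2) * ind J z.1) fun x => ?_
  exact (((hφ.comp (measurable_truncAt _)).comp measurable_snd).const_mul _).mul
    ((measurable_ind hJ).comp (measurable_subtype_coe.comp measurable_fst))

theorem integral_error_mul_ind (hM : SamplingModel P ν X f ξ T U) {ψ : ℝ → ℝ} (hψ : Measurable ψ)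
    {J : Set ℝ} (hJ : MeasurableSet J) (i j : ℕ) :
    ∫ ω, ψ (U i j ω) * ind J (T i j ω) ∂P =
      (∫ ω, ψ (U 0 0 ω) ∂P) * (designLaw a b f).real J := by
  have h1 := ((hM.indepFun_error_design i j).comp hψ
    ((measurable_ind hJ).comp measurable_subtype_coe)).integral_fun_mul_eq_mul_integral
    (hψ.comp (hM.measurable_error i j)).aestronglyMeasurable
    (hM.measurable_ind_design hJ i j).aestronglyMeasurable
  simp only [Function.comp_apply] at h1
  have h2 := ((hM.identDistrib_error i j).comp hψ).integral_eq
  simp only [Function.comp_apply] at h2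
  rw [h1, h2, hM.integral_ind_design hJ]

theorem integral_sq_errorTerm_le (hM : SamplingModel P ν X f ξ T U) {φ : ℝ → ℝ}
    (hφm : Measurable φ) (hφ : ∀ x, |φ x| ≤ |x|) (hU2 : Integrable (fun ω => |U 0 0 ω| ^ 2) P)
    (k : ℕ) (Q : ℝ) {J : Set ℝ} (hJ : MeasurableSet J) (x : Σ _ : ℕ, ℕ) :
    ∫ ω, errorTerm φ T U k Q J x ω ^ 2 ∂P ≤
      ((k : ℝ)⁻¹) ^ 2 * ((∫ ω, |U 0 0 ω| ^ 2 ∂P) * (designLaw a b f).real J) := by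
  have e : ∀ ω, errorTerm φ T U k Q J x ω ^ 2 = ((k : ℝ)⁻¹) ^ 2 *
      (φ (truncAt (k * Q) (U x.1 x.2 ω)) ^ 2 * ind J (T x.1 x.2 ω)) := fun ω => by
    rw [errorTerm, mul_pow, mul_pow, sq (ind J _), ind_mul_self, mul_assoc]
  simp only [e]
  rw [integral_const_mul, hM.integral_error_mul_ind (ψ := fun u => φ (truncAt (k * Q) u) ^ 2)
    ((hφm.comp (measurable_truncAt _)).pow_const 2) hJ]
  gcongr ?_ * (?_ * ?_)
  refine integral_mono_of_nonneg (Eventually.of_forall fun ω => sq_nonneg _) hU2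
    (Eventually.of_forall fun ω => ?_)
  simp only
  rw [← sq_abs (φ _)]
  exact pow_le_pow_left₀ (abs_nonneg _) ((hφ _).trans (abs_truncAt_le _ _)) 2

/-- Uniform one-sided bound on weighted sums of transformed measurement errors. The error of an
observation on a curve with `k` observations is truncated at `k` times the truncation level. -/
theorem ae_sum_error_le (hM : SamplingModel P ν X f ξ T U) {MT : ℝ}
    (hf : ∀ t ∈ Icc a b, f t ≤ MT) (hMT : 0 ≤ MT) (hm : ∀ n, ∀ i < n, 2 ≤ m n i)
    (hR : ∀ᶠ n in atTop, RateBounds m h lam n) (hlam : 2 < lam)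
    (hU : Integrable (fun ω => |U 0 0 ω| ^ lam) P)
    {φ : ℝ → ℝ} (hφm : Measurable φ) (hφ : ∀ x, |φ x| ≤ |x|) {A : ℕ → ℕ → ℕ → Prop} {c : ℕ}
    (hA : ∀ n p q, A n p q → GridPair c h n p q) {C : ℝ}
    (hmean : ∀ᶠ n in atTop, ∃ κ, (∀ i < n,
        |∫ ω, φ (truncAt (m n i * truncLevel m h n) (U 0 0 ω)) ∂P| ≤ κ) ∧
      ∀ p q, A n p q → n * (κ * (designLaw a b f).real (gridBlock a n p q)) ≤
        C * (truncLevel m h n * Real.log n)) :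
    ∀ᵐ ω ∂P, ∃ C' : ℝ, ∀ᶠ n in atTop, ∀ p q, A n p q →
      ∑ i ∈ Finset.range n, (m n i : ℝ)⁻¹ * ∑ j ∈ Finset.range (m n i),
        φ (U i j ω) * ind (gridBlock a n p q) (T i j ω) ≤
        C' * (truncLevel m h n * Real.log n) := by
  have hUm : Measurable fun ω => |U 0 0 ω| :=
    continuous_abs.measurable.comp (hM.measurable_error 0 0)
  have hU2 := hU.sq_of_rpow hlam.le hUm fun ω => abs_nonneg _
  set E2 := ∫ ω, |U 0 0 ω| ^ 2 ∂P with hE2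
  have hE20 : 0 ≤ E2 := integral_nonneg fun ω => sq_nonneg _
  set D := max C (E2 * (4 * MT + 16 * MT ^ 2)) with hD
  have hAS := ae_eventually_sum_lt (P := P)
    (fun n => (Finset.range n).sigma fun i => Finset.range (m n i))
    (fun n p q x => errorTerm φ T U (m n x.1) (truncLevel m h n) (gridBlock a n p q) x) A
    (truncLevel m h) c D
    (fun n p q hpq => ⟨(hA n p q hpq).1.trans (hA n p q hpq).2.1, (hA n p q hpq).2.1⟩)
    (fun n p q => hM.iIndepFun_errorTerm hφm (m n) _ (measurableSet_gridBlock a n p q))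
    (fun n p q x => hM.measurable_errorTerm hφm _ _ (measurableSet_gridBlock a n p q) x) (by
      filter_upwards [hR, hmean] with n hRn ⟨κ, hκ, hmn⟩
      have hQ0 : 0 < truncLevel m h n := by linarith [hRn.one_le_trunc]
      have hL := hRn.one_le_log
      refine ⟨hQ0, fun p q hpq => ⟨fun x _ ω => abs_errorTerm_le hφ T U _ hQ0.le _ x ω, ?_, ?_⟩⟩
      · set π := (designLaw a b f).real (gridBlock a n p q) with hπ
        have hπ0 : 0 ≤ π := measureReal_nonneg
        calc _ ≤ ∑ x ∈ (Finset.range n).sigma fun i => Finset.range (m n i),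
              ((m n x.1 : ℝ)⁻¹) ^ 2 * (E2 * π) :=
              Finset.sum_le_sum fun x _ => hM.integral_sq_errorTerm_le hφm hφ hU2 _ _
                (measurableSet_gridBlock a n p q) x
          _ = ∑ i ∈ Finset.range n, E2 * (π * (m n i : ℝ)⁻¹) := by
              rw [Finset.sum_sigma]
              refine Finset.sum_congr rfl fun i hi => ?_
              have h2 : (2 : ℝ) ≤ m n i := by exact_mod_cast hm n i (Finset.mem_range.1 hi)
              simp only [Finset.sum_const, Finset.card_range, nsmul_eq_mul]
              field_simp
          _ ≤ E2 * ∑ i ∈ Finset.range n, (π * (m n i : ℝ)⁻¹ + π ^ 2) := by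
              rw [← Finset.mul_sum]
              gcongr
              exact le_add_of_nonneg_right (sq_nonneg _)
          _ ≤ E2 * ((4 * MT + 16 * MT ^ 2) * (truncLevel m h n ^ 2 * Real.log n)) := by
              gcongr
              exact sum_moment_factor_le hMT hRn measureReal_nonneg
                ((hA n p q hpq).designLaw_le hf hMT hRn.one_le)
          _ ≤ _ := by
              rw [← mul_assoc]
              gcongr
              exact le_max_right _ _
      · set π := (designLaw a b f).real (gridBlock a n p q) with hπ
        have hπ0 : 0 ≤ π := measureReal_nonneg
        have h1 : ∀ i < n, ∀ j, ∫ ω, errorTerm φ T U (m n i) (truncLevel m h n)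
            (gridBlock a n p q) ⟨i, j⟩ ω ∂P ≤ (m n i : ℝ)⁻¹ * (κ * π) := by
          intro i hi j
          simp only [errorTerm, mul_assoc]
          rw [integral_const_mul, hM.integral_error_mul_ind
            (ψ := fun u => φ (truncAt (m n i * truncLevel m h n) u))
            (hφm.comp (measurable_truncAt _)) (measurableSet_gridBlock a n p q)]
          gcongr
          exact (le_abs_self _).trans (hκ i hi)
        calc _ ≤ ∑ x ∈ (Finset.range n).sigma fun i => Finset.range (m n i),
              ((m n x.1 : ℝ)⁻¹) * (κ * π) := by
              refine Finset.sum_le_sum fun x hx => ?_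
              exact h1 x.1 (by simpa using (Finset.mem_sigma.1 hx).1) x.2
          _ = n * (κ * π) := by
              rw [Finset.sum_sigma]
              rw [Finset.sum_congr rfl (g := fun _ => κ * π)]
              · simp
              intro i hi
              have h2 : (2 : ℝ) ≤ m n i := by exact_mod_cast hm n i (Finset.mem_range.1 hi)
              simp only [Finset.sum_const, Finset.card_range, nsmul_eq_mul]
              field_simp
          _ ≤ C * (truncLevel m h n * Real.log n) := hmn p q hpq
          _ ≤ _ := by gcongr; exact le_max_left _ _)
  have hfin : ∀ᵐ ω ∂P, ∀ i,
      ∑' j : ℕ, ENNReal.ofReal (|U i j ω| ^ lam * ((j : ℝ) + 1) ^ (-lam)) ≠ ∞ := by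
    refine ae_all_iff.2 fun i => ?_
    refine (ae_lt_top ?_ (hM.lintegral_errorEnvelope_ne_top hlam hU i)).mono fun ω h => h.ne
    exact Measurable.tsum fun j => (((continuous_abs.measurable.comp
      (hM.measurable_error i j)).pow_const lam).mul_const _).ennreal_ofReal
  filter_upwards [hAS, hfin, hM.ae_exists_sum_errorEnvelope_le hlam hU] with ω h1 h2 ⟨C₂, hC₂0, hC₂⟩
  refine ⟨2 * D + 4 + C₂, ?_⟩
  filter_upwards [h1, hR] with n hn hRn p q hpq
  set Q := truncLevel m h n with hQdef
  have hQ0 : 0 < Q := by linarith [hRn.one_le_trunc]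
  have hn := hn p q hpq
  rw [Finset.sum_sigma] at hn
  have hcurve : ∀ i ∈ Finset.range n, (m n i : ℝ)⁻¹ * ∑ j ∈ Finset.range (m n i),
      φ (U i j ω) * ind (gridBlock a n p q) (T i j ω) ≤
      ∑ j ∈ Finset.range (m n i), errorTerm φ T U (m n i) Q (gridBlock a n p q) ⟨i, j⟩ ω +
        errorEnvelope lam (fun j => U i j ω) * Q ^ (1 - lam) := by
    intro i hi
    have hk2 : 2 ≤ m n i := hm n i (Finset.mem_range.1 hi)
    have hk : (0 : ℝ) < m n i := by exact_mod_cast (by omega : 0 < m n i)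
    refine le_trans ?_ (add_le_add le_rfl (mul_le_mul_of_nonneg_right
      (sum_le_errorEnvelope (h2 i) (m n i)) (Real.rpow_nonneg hQ0.le _)))
    rw [Finset.sum_mul, ← Finset.sum_add_distrib, Finset.mul_sum]
    refine Finset.sum_le_sum fun j hj => ?_
    have h3 := (le_abs_self _).trans
      (truncAt_error_le hφ (by linarith : 1 ≤ lam) (mul_pos hk hQ0) (U i j ω))
    have hjk : (j : ℝ) + 1 ≤ m n i := by exact_mod_cast Finset.mem_range.1 hj
    -- the factor `1 / k` turns the level `k * Q` into a gain of `k ^ (-lam)`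
    have h4 : (m n i : ℝ)⁻¹ * (|U i j ω| ^ lam * (m n i * Q) ^ (1 - lam)) ≤
        |U i j ω| ^ lam * ((j : ℝ) + 1) ^ (-lam) * Q ^ (1 - lam) := by
      have e : (m n i : ℝ)⁻¹ * (m n i : ℝ) ^ (1 - lam) = (m n i : ℝ) ^ (-lam) := by
        rw [← Real.rpow_neg_one, ← Real.rpow_add hk]; congr 1; ring
      rw [Real.mul_rpow hk.le hQ0.le]
      calc _ = |U i j ω| ^ lam * ((m n i : ℝ)⁻¹ * (m n i : ℝ) ^ (1 - lam)) * Q ^ (1 - lam) := by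
            ring
        _ ≤ _ := by
            rw [e]
            gcongr ?_ * ?_ * ?_
            exact Real.rpow_le_rpow_of_nonpos (by positivity) hjk (by linarith)
    have h5 : 0 ≤ |U i j ω| ^ lam * (m n i * Q) ^ (1 - lam) :=
      mul_nonneg (Real.rpow_nonneg (abs_nonneg _) _) (Real.rpow_nonneg (by positivity) _)
    rw [errorTerm]
    simp only
    have h6 : φ (U i j ω) * ind (gridBlock a n p q) (T i j ω) ≤
        φ (truncAt (m n i * Q) (U i j ω)) * ind (gridBlock a n p q) (T i j ω) +
          |U i j ω| ^ lam * (m n i * Q) ^ (1 - lam) := by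
      have hi0 := ind_nonneg (gridBlock a n p q) (T i j ω)
      have hi1 := ind_le_one (gridBlock a n p q) (T i j ω)
      nlinarith
    have h7 := mul_le_mul_of_nonneg_left h6 (inv_pos.2 hk).le
    rw [mul_add] at h7
    linarith
  refine (Finset.sum_le_sum hcurve).trans ?_
  rw [Finset.sum_add_distrib, ← Finset.sum_mul, add_mul]
  refine add_le_add hn.le ?_
  calc _ ≤ C₂ * n * Q ^ (1 - lam) := by
        gcongr
        exact hC₂ n
    _ = C₂ * (n * Q ^ (1 - lam)) := by ring
    _ ≤ _ := mul_le_mul_of_nonneg_left hRn.tail_le hC₂0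

/-- The measurement errors: sums over grid blocks, and sums of absolute values over single grid
cells. -/
theorem ae_error_bounds (hM : SamplingModel P ν X f ξ T U) {MT : ℝ}
    (hf : ∀ t ∈ Icc a b, f t ≤ MT) (hMT : 0 ≤ MT) (hm : ∀ n, ∀ i < n, 2 ≤ m n i)
    (hR : ∀ᶠ n in atTop, RateBounds m h lam n) (hlam : 2 < lam)
    (hU : Integrable (fun ω => |U 0 0 ω| ^ lam) P) (c : ℕ) :
    ∀ᵐ ω ∂P, ∃ C : ℝ, ∀ᶠ n in atTop, ∀ p q, GridPair c h n p q →
      |∑ i ∈ Finset.range n, (m n i : ℝ)⁻¹ * ∑ j ∈ Finset.range (m n i),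
        U i j ω * ind (gridBlock a n p q) (T i j ω)| ≤ C * (truncLevel m h n * Real.log n) ∧
      (q = p + 1 → ∑ i ∈ Finset.range n, (m n i : ℝ)⁻¹ * ∑ j ∈ Finset.range (m n i),
        |U i j ω| * ind (gridBlock a n p q) (T i j ω) ≤ C * (truncLevel m h n * Real.log n)) := by
  have hprob := hM.isProbabilityMeasure_designLaw
  have hUm : Measurable fun ω => |U 0 0 ω| :=
    continuous_abs.measurable.comp (hM.measurable_error 0 0)
  have hU1a := hU.of_rpow hlam.le hUm fun ω => abs_nonneg _
  have hU1 : Integrable (U 0 0) P :=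
    (integrable_norm_iff (hM.measurable_error 0 0).aestronglyMeasurable).1 hU1a
  set I := ∫ ω, |U 0 0 ω| ^ lam ∂P with hI
  have hI0 : 0 ≤ I := integral_nonneg fun s => Real.rpow_nonneg (abs_nonneg _) _
  have hti : ∀ c, Integrable (fun ω => truncAt c (U 0 0 ω)) P := fun c =>
    hU1a.mono' ((measurable_truncAt c).comp (hM.measurable_error 0 0)).aestronglyMeasurable
      (Eventually.of_forall fun ω => abs_truncAt_le _ _)
  have hcent : ∀ c, 0 < c → |∫ ω, truncAt c (U 0 0 ω) ∂P| ≤ I * c ^ (1 - lam) := by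
    intro c hc
    have e : ∫ ω, truncAt c (U 0 0 ω) ∂P = -∫ ω, (U 0 0 ω - truncAt c (U 0 0 ω)) ∂P := by
      rw [integral_sub hU1 (hti c), hM.mean_error]; ring
    rw [e, abs_neg, ← integral_mul_const, ← Real.norm_eq_abs]
    exact norm_integral_le_of_norm_le (hU.mul_const _) (Eventually.of_forall fun ω =>
      truncAt_error_le (φ := id) (fun x => le_rfl) (by linarith : 1 ≤ lam) hc _)
  have hcent' : ∀ n, RateBounds m h lam n → ∀ i < n,
      |∫ ω, truncAt (m n i * truncLevel m h n) (U 0 0 ω) ∂P| ≤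
        I * truncLevel m h n ^ (1 - lam) := by
    intro n hRn i hi
    have hQ0 : 0 < truncLevel m h n := by linarith [hRn.one_le_trunc]
    have h2 : (2 : ℝ) ≤ m n i := by exact_mod_cast hm n i hi
    refine (hcent _ (by positivity)).trans ?_
    gcongr ?_ * ?_
    exact Real.rpow_le_rpow_of_nonpos hQ0 (by nlinarith) (by linarith)
  have hmeanI : ∀ n, RateBounds m h lam n → ∀ p q,
      n * ((I * truncLevel m h n ^ (1 - lam)) * (designLaw a b f).real (gridBlock a n p q)) ≤
        I * (truncLevel m h n * Real.log n) := by
    intro n hRn p q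
    have hQ0 : 0 < truncLevel m h n := by linarith [hRn.one_le_trunc]
    calc _ ≤ n * ((I * truncLevel m h n ^ (1 - lam)) * 1) := by
          gcongr
          exact measureReal_le_one
      _ = I * (n * truncLevel m h n ^ (1 - lam)) := by ring
      _ ≤ _ := mul_le_mul_of_nonneg_left hRn.tail_le hI0
  have hup := hM.ae_sum_error_le hf hMT hm hR hlam hU (φ := fun x => x)
    measurable_id (fun x => le_rfl) (A := GridPair c h) (fun _ _ _ hpq => hpq) (C := I) (by
      filter_upwards [hR] with n hRn
      exact ⟨_, hcent' n hRn, fun p q _ => hmeanI n hRn p q⟩)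
  have hdown := hM.ae_sum_error_le hf hMT hm hR hlam hU
    (φ := fun x => -x) measurable_neg (fun x => (abs_neg x).le) (A := GridPair c h)
    (fun _ _ _ hpq => hpq) (C := I) (by
      filter_upwards [hR] with n hRn
      refine ⟨I * truncLevel m h n ^ (1 - lam), fun i hi => ?_, fun p q _ => hmeanI n hRn p q⟩
      rw [integral_neg, abs_neg]
      exact hcent' n hRn i hi)
  have habs := hM.ae_sum_error_le hf hMT hm hR hlam hU
    (φ := fun x => |x|) continuous_abs.measurable (fun x => (abs_abs x).le)
    (A := fun n p q => GridPair c h n p q ∧ q = p + 1)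
    (fun _ _ _ hpq => hpq.1) (C := (∫ ω, |U 0 0 ω| ∂P) * MT) (by
      filter_upwards [hR] with n hRn
      have hn : (0 : ℝ) < n := by exact_mod_cast hRn.one_le
      have hE : 0 ≤ ∫ ω, |U 0 0 ω| ∂P := integral_nonneg fun ω => abs_nonneg _
      refine ⟨∫ ω, |U 0 0 ω| ∂P, fun i _ => ?_, fun p q hpq => ?_⟩
      · rw [← Real.norm_eq_abs]
        refine norm_integral_le_of_norm_le hU1a (Eventually.of_forall fun s => ?_)
        rw [Real.norm_eq_abs, abs_abs]
        exact abs_truncAt_le _ _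
      · have hπ := designLaw_gridBlock_le hf hMT (n := n) hpq.1.1
        have e : (q : ℝ) - p = 1 := by rw [hpq.2]; push_cast; ring
        rw [e] at hπ
        calc (n : ℝ) * ((∫ ω, |U 0 0 ω| ∂P) * (designLaw a b f).real (gridBlock a n p q))
            ≤ n * ((∫ ω, |U 0 0 ω| ∂P) * (MT * (1 / n))) := by gcongr
          _ = (∫ ω, |U 0 0 ω| ∂P) * MT * 1 := by field_simp
          _ ≤ _ := by
            gcongr
            nlinarith [hRn.one_le_trunc, hRn.one_le_log])
  filter_upwards [hup, hdown, habs] with ω ⟨C₁, h1⟩ ⟨C₂, h2⟩ ⟨C₃, h3⟩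
  refine ⟨max C₁ (max C₂ C₃), ?_⟩
  filter_upwards [h1, h2, h3, hR] with n h1 h2 h3 hRn p q hpq
  have hQL : 0 ≤ truncLevel m h n * Real.log n :=
    mul_nonneg (Real.sqrt_nonneg _) (by linarith [hRn.one_le_log])
  refine ⟨abs_le'.2 ⟨(h1 p q hpq).trans ?_, le_trans (le_of_eq ?_) ((h2 p q hpq).trans ?_)⟩,
    fun hq => (h3 p q ⟨hpq, hq⟩).trans ?_⟩
  · gcongr; exact le_max_left _ _
  · simp only [neg_mul, Finset.sum_neg_distrib, mul_neg]
  · gcongr; exact (le_max_left _ _).trans (le_max_right _ _)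
  · gcongr; exact (le_max_right _ _).trans (le_max_right _ _)

end SamplingModel

/-! ### Deterministic bounds for kernel sums and weighted least squares -/

theorem mem_gridBlock_iff {a t : ℝ} (hat : a ≤ t) {n : ℕ} (hn : 1 ≤ n) (p q : ℕ) :
    t ∈ gridBlock a n p q ↔ p ≤ ⌊n * (t - a)⌋₊ ∧ ⌊n * (t - a)⌋₊ < q := by
  have hn' : (0 : ℝ) < n := by exact_mod_cast hn
  have h0 : 0 ≤ n * (t - a) := mul_nonneg hn'.le (by linarith)
  rw [Nat.le_floor_iff h0, Nat.floor_lt h0, gridBlock, mem_Ico, ← le_sub_iff_add_le',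
    ← sub_lt_iff_lt_add', div_le_iff₀ hn', lt_div_iff₀ hn', mul_comm (n : ℝ)]

theorem ind_of_mem {J : Set ℝ} {t : ℝ} (h : t ∈ J) : ind J t = 1 := indicator_of_mem h _

theorem ind_of_notMem {J : Set ℝ} {t : ℝ} (h : t ∉ J) : ind J t = 0 := indicator_of_notMem h _

/-- An interval differs from a block of grid cells by parts of two cells. -/
theorem abs_sum_ind_ordConnected_le {ι : Type*} (s : Finset ι) {a b t₀ : ℝ} {h : ℕ → ℝ} {n c : ℕ}
    (hn : 1 ≤ n) (hnh : 1 ≤ n * h n) (hc : b - a + 1 ≤ c) {t : ι → ℝ} (ht : ∀ k ∈ s, t k ∈ Icc a b)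
    {z : ι → ℝ} {B : ℝ}
    (hblock : ∀ p q, GridPair c h n p q → |∑ k ∈ s, z k * ind (gridBlock a n p q) (t k)| ≤ B)
    (hcell : ∀ p, GridPair c h n p (p + 1) →
      ∑ k ∈ s, |z k| * ind (gridBlock a n p (p + 1)) (t k) ≤ B)
    {I : Set ℝ} (hI : I.OrdConnected) (hIt : ∀ x ∈ I, |x - t₀| ≤ h n) :
    |∑ k ∈ s, z k * ind I (t k)| ≤ 3 * B := by
  classical
  have hn' : (1 : ℝ) ≤ n := by exact_mod_cast hn
  have hB : 0 ≤ B := (abs_nonneg _).trans (hblock 0 0 ⟨le_rfl, Nat.zero_le _, by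
    push_cast; linarith⟩)
  set κ : ι → ℕ := fun k => ⌊n * (t k - a)⌋₊ with hκ
  have hfl : ∀ k ∈ s, (κ k : ℝ) ≤ n * (t k - a) ∧ n * (t k - a) < κ k + 1 := fun k hk =>
    ⟨Nat.floor_le (mul_nonneg (by linarith) (by linarith [(ht k hk).1])), Nat.lt_floor_add_one _⟩
  have hκc : ∀ k ∈ s, κ k + 1 ≤ c * n := by
    intro k hk
    have h1 := (hfl k hk).1
    have h2 := (ht k hk).2
    have : ((κ k + 1 : ℕ) : ℝ) ≤ ((c * n : ℕ) : ℝ) := by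
      push_cast
      nlinarith
    exact_mod_cast this
  have hcell' : ∀ k ∈ s, ∑ l ∈ s, |z l| * ind (gridBlock a n (κ k) (κ k + 1)) (t l) ≤ B :=
    fun k hk => hcell _ ⟨by omega, hκc k hk, by push_cast; linarith⟩
  by_cases hne : (s.filter fun k => t k ∈ I).Nonempty
  swap
  · rw [Finset.not_nonempty_iff_eq_empty, Finset.filter_eq_empty_iff] at hne
    rw [Finset.sum_eq_zero fun k hk => by rw [ind_of_notMem (hne hk), mul_zero], abs_zero]
    positivity
  obtain ⟨k₁, hk₁, hmin⟩ := Finset.exists_min_image _ κ hne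
  obtain ⟨k₂, hk₂, hmax⟩ := Finset.exists_max_image _ κ hne
  simp only [Finset.mem_filter] at hk₁ hk₂ hmin hmax
  have hκ12 : κ k₁ ≤ κ k₂ := hmin k₂ hk₂
  have hnear : |∑ k ∈ s, z k * ind (gridBlock a n (κ k₁ + 1) (κ k₂)) (t k)| ≤ B := by
    rcases lt_or_ge (κ k₁) (κ k₂) with hlt | hge
    · refine hblock _ _ ⟨hlt, by have := hκc k₂ hk₂.1; omega, ?_⟩
      have h1 := (hfl k₁ hk₁.1).2
      have h2 := (hfl k₂ hk₂.1).1
      have h3 := abs_le.1 (hIt _ hk₁.2)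
      have h4 := abs_le.1 (hIt _ hk₂.2)
      push_cast
      nlinarith
    · rw [Finset.sum_eq_zero, abs_zero]
      · exact hB
      · intro k hk
        rw [ind_of_notMem, mul_zero]
        rw [mem_gridBlock_iff (ht k hk).1 hn]
        omega
  have hpt : ∀ k ∈ s, |ind I (t k) - ind (gridBlock a n (κ k₁ + 1) (κ k₂)) (t k)| ≤
      ind (gridBlock a n (κ k₁) (κ k₁ + 1)) (t k) +
        ind (gridBlock a n (κ k₂) (κ k₂ + 1)) (t k) := by
    intro k hk
    have hm := mem_gridBlock_iff (ht k hk).1 hn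
    have hz := ind_nonneg (gridBlock a n (κ k₁) (κ k₁ + 1)) (t k)
    have hz' := ind_nonneg (gridBlock a n (κ k₂) (κ k₂ + 1)) (t k)
    by_cases hkb : t k ∈ gridBlock a n (κ k₁ + 1) (κ k₂)
    · have hkb' := (hm _ _).1 hkb
      have hkI : t k ∈ I := by
        refine hI.out hk₁.2 hk₂.2 ⟨?_, ?_⟩
        · have h1 := (hfl k₁ hk₁.1).2
          have h2 := (hfl k hk).1
          have h3 : (κ k₁ : ℝ) + 1 ≤ κ k := by exact_mod_cast hkb'.1
          nlinarith
        · have h1 := (hfl k hk).2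
          have h2 := (hfl k₂ hk₂.1).1
          have h3 : (κ k : ℝ) + 1 ≤ κ k₂ := by exact_mod_cast hkb'.2
          nlinarith
      rw [ind_of_mem hkI, ind_of_mem hkb]
      simpa using add_nonneg hz hz'
    · rw [ind_of_notMem hkb, sub_zero, abs_of_nonneg (ind_nonneg _ _)]
      by_cases hkI : t k ∈ I
      · have h1 := hmin k ⟨hk, hkI⟩
        have h2 := hmax k ⟨hk, hkI⟩
        rw [hm] at hkb
        have h3 : κ k = κ k₁ ∨ κ k = κ k₂ := by
          simp only [hκ] at h1 h2 hkb ⊢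
          omega
        rcases h3 with h3 | h3
        · rw [ind_of_mem hkI, ind_of_mem ((hm _ _).2 ⟨h3.ge, by simp only [hκ] at h3 ⊢; omega⟩)]
          linarith
        · rw [ind_of_mem hkI, ind_of_mem (J := gridBlock a n (κ k₂) (κ k₂ + 1))
            ((hm _ _).2 ⟨h3.ge, by simp only [hκ] at h3 ⊢; omega⟩)]
          linarith
      · rw [ind_of_notMem hkI]
        exact add_nonneg hz hz'
  have hdiff : |∑ k ∈ s, z k * (ind I (t k) - ind (gridBlock a n (κ k₁ + 1) (κ k₂)) (t k))| ≤
      B + B := by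
    refine (Finset.abs_sum_le_sum_abs _ _).trans ?_
    calc _ ≤ ∑ k ∈ s, |z k| * (ind (gridBlock a n (κ k₁) (κ k₁ + 1)) (t k) +
            ind (gridBlock a n (κ k₂) (κ k₂ + 1)) (t k)) := by
          refine Finset.sum_le_sum fun k hk => ?_
          rw [abs_mul]
          exact mul_le_mul_of_nonneg_left (hpt k hk) (abs_nonneg _)
      _ ≤ B + B := by
          simp only [mul_add, Finset.sum_add_distrib]
          exact add_le_add (hcell' k₁ hk₁.1) (hcell' k₂ hk₂.1)
  have e : ∑ k ∈ s, z k * ind I (t k) =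
      ∑ k ∈ s, z k * ind (gridBlock a n (κ k₁ + 1) (κ k₂)) (t k) +
      ∑ k ∈ s, z k * (ind I (t k) - ind (gridBlock a n (κ k₁ + 1) (κ k₂)) (t k)) := by
    rw [← Finset.sum_add_distrib]
    exact Finset.sum_congr rfl fun k _ => by ring
  rw [e]
  refine (abs_add_le _ _).trans ?_
  linarith

/-- Layer cake: a weighted sum of the values of a nonnegative monotone function is an average of
weighted numbers of points in intervals. -/
theorem abs_sum_mul_monotone_le {ι : Type*} (s : Finset ι) {x z : ι → ℝ} {B M : ℝ} {φ : ℝ → ℝ}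
    (hφ : MonotoneOn φ (Icc (-1) 1)) (hM : 0 ≤ M) (h0 : ∀ y ∈ Icc (-1 : ℝ) 1, 0 ≤ φ y ∧ φ y ≤ M)
    (hB : ∀ I : Set ℝ, I.OrdConnected → I ⊆ Icc (-1) 1 → |∑ k ∈ s, z k * ind I (x k)| ≤ B) :
    |∑ k ∈ s, z k * (ind (Icc (-1) 1) (x k) * φ (x k))| ≤ M * B := by
  have hlayer : ∀ y : ℝ, ind (Icc (-1) 1) y * φ y =
      ∫ r in Ioc 0 M, ind {y ∈ Icc (-1 : ℝ) 1 | r ≤ φ y} y := by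
    intro y
    by_cases hy : y ∈ Icc (-1 : ℝ) 1
    · have e : ∀ r, ind {y ∈ Icc (-1 : ℝ) 1 | r ≤ φ y} y = (Iic (φ y)).indicator 1 r := by
        intro r
        by_cases hr : r ≤ φ y
        · rw [ind_of_mem (show y ∈ {y ∈ Icc (-1 : ℝ) 1 | r ≤ φ y} from ⟨hy, hr⟩),
            indicator_of_mem (by exact hr)]
          rfl
        · rw [ind_of_notMem (J := {y ∈ Icc (-1 : ℝ) 1 | r ≤ φ y}) fun h => hr h.2,
            indicator_of_notMem (by exact hr)]
      simp only [e]
      rw [integral_indicator_one measurableSet_Iic, measureReal_restrict_apply measurableSet_Iic,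
        ind_of_mem hy, one_mul, inter_comm, Ioc_inter_Iic, min_eq_right (h0 y hy).2,
        Real.volume_real_Ioc_of_le (h0 y hy).1, sub_zero]
    · have e : ∀ r, ind {y ∈ Icc (-1 : ℝ) 1 | r ≤ φ y} y = 0 := fun r =>
        ind_of_notMem fun h => hy h.1
      simp only [e, ind_of_notMem hy, zero_mul, integral_zero]
  have hint : ∀ y : ℝ, Integrable (fun r => ind {y ∈ Icc (-1 : ℝ) 1 | r ≤ φ y} y)
      (volume.restrict (Ioc 0 M)) := by
    intro y
    have e : (fun r => ind {y ∈ Icc (-1 : ℝ) 1 | r ≤ φ y} y) =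
        fun r => ind (Icc (-1) 1) y * ind (Iic (φ y)) r := by
      funext r
      by_cases hy : y ∈ Icc (-1 : ℝ) 1
      · by_cases hr : r ≤ φ y
        · rw [ind_of_mem (show y ∈ {y ∈ Icc (-1 : ℝ) 1 | r ≤ φ y} from ⟨hy, hr⟩), ind_of_mem hy,
            ind_of_mem (by exact hr), one_mul]
        · rw [ind_of_notMem (J := {y ∈ Icc (-1 : ℝ) 1 | r ≤ φ y}) fun h => hr h.2,
            ind_of_notMem (J := Iic (φ y)) (by exact hr), mul_zero]
      · rw [ind_of_notMem (J := {y ∈ Icc (-1 : ℝ) 1 | r ≤ φ y}) fun h => hy h.1,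
          ind_of_notMem hy, zero_mul]
    rw [e]
    refine (Integrable.of_bound (measurable_ind measurableSet_Iic).aestronglyMeasurable 1
      (Eventually.of_forall fun r => ?_)).const_mul _
    rw [Real.norm_eq_abs, abs_of_nonneg (ind_nonneg _ _)]
    exact ind_le_one _ _
  simp only [hlayer, ← integral_const_mul]
  rw [← integral_finsetSum _ fun k _ => (hint (x k)).const_mul _, ← Real.norm_eq_abs]
  refine (norm_setIntegral_le_of_norm_le_const (C := B) (by simp) fun r _ => ?_).trans ?_
  · rw [Real.norm_eq_abs]
    refine hB _ ⟨fun y hy y' hy' w hw => ?_⟩ fun y hy => hy.1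
    have hw1 : w ∈ Icc (-1 : ℝ) 1 := ⟨hy.1.1.trans hw.1, hw.2.trans hy'.1.2⟩
    exact ⟨hw1, hy.2.trans (hφ hy.1 hw1 hw.1)⟩
  · rw [Real.volume_real_Ioc_of_le hM, sub_zero, mul_comm]

/-- A kernel is a difference of nonnegative, bounded, monotone functions on its support. -/
theorem KernelCondition.exists_monotone_sub {K : ℝ → ℝ} (hK : KernelCondition K) :
    ∃ (φ₁ φ₂ : ℝ → ℝ) (M : ℝ), 0 ≤ M ∧ MonotoneOn φ₁ (Icc (-1) 1) ∧ MonotoneOn φ₂ (Icc (-1) 1) ∧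
      (∀ y ∈ Icc (-1 : ℝ) 1, 0 ≤ φ₁ y ∧ φ₁ y ≤ M) ∧ (∀ y ∈ Icc (-1 : ℝ) 1, 0 ≤ φ₂ y ∧ φ₂ y ≤ M) ∧
      ∀ y ∈ Icc (-1 : ℝ) 1, K y = φ₁ y - φ₂ y := by
  obtain ⟨p, q, hp, hq, hpq⟩ :=
    hK.boundedVariation.locallyBoundedVariationOn.exists_monotoneOn_sub_monotoneOn
  have hl : (-1 : ℝ) ∈ Icc (-1 : ℝ) 1 := by norm_num
  have hr : (1 : ℝ) ∈ Icc (-1 : ℝ) 1 := by norm_num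
  have hK0 := hK.nonneg (-1)
  have hK1 : K (-1) = p (-1) - q (-1) := congrFun hpq _
  have hpp := hp hl hr (by norm_num)
  have hqq := hq hl hr (by norm_num)
  refine ⟨fun y => p y - p (-1) + K (-1), fun y => q y - q (-1),
    max (p 1 - p (-1) + K (-1)) (q 1 - q (-1)), le_max_of_le_right (by linarith),
    fun y hy y' hy' h => by linarith [hp hy hy' h], fun y hy y' hy' h => by linarith [hq hy hy' h],
    fun y hy => ⟨by linarith [hp hl hy hy.1], le_max_of_le_left (by linarith [hp hy hr hy.2])⟩,
    fun y hy => ⟨by linarith [hq hl hy hy.1], le_max_of_le_right (by linarith [hq hy hr hy.2])⟩,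
    fun y hy => ?_⟩
  have : K y = p y - q y := congrFun hpq y
  linarith

/-- Weighted sums against the kernel and its first moment function are controlled by weighted
numbers of points in intervals. -/
theorem KernelCondition.exists_abs_sum_le {K : ℝ → ℝ} (hK : KernelCondition K) :
    ∃ M : ℝ, 0 ≤ M ∧ (∀ y, K y ≤ M) ∧ ∀ {ι : Type} (s : Finset ι) (x z : ι → ℝ) (B : ℝ),
      (∀ I : Set ℝ, I.OrdConnected → I ⊆ Icc (-1) 1 → |∑ k ∈ s, z k * ind I (x k)| ≤ B) →
      |∑ k ∈ s, z k * K (x k)| ≤ M * B ∧ |∑ k ∈ s, z k * (K (x k) * x k)| ≤ M * B := by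
  obtain ⟨φ₁, φ₂, M, hM, hm₁, hm₂, hb₁, hb₂, hKe⟩ := hK.exists_monotone_sub
  refine ⟨6 * M, by positivity, fun y => ?_, fun {ι} s x z B hB => ?_⟩
  · by_cases hy : y ∈ Icc (-1 : ℝ) 1
    · linarith [hKe y hy, hb₁ y hy, hb₂ y hy]
    · rw [hK.support y hy]; positivity
  -- `y * K y = (1 + y) * K y - K y`, where multiplication by `1 + y` preserves monotonicity
  have hmul : ∀ φ : ℝ → ℝ, MonotoneOn φ (Icc (-1) 1) → (∀ y ∈ Icc (-1 : ℝ) 1, 0 ≤ φ y ∧ φ y ≤ M) →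
      |∑ k ∈ s, z k * (ind (Icc (-1) 1) (x k) * ((1 + x k) * φ (x k)))| ≤ 2 * M * B := by
    intro φ hφ hb
    refine abs_sum_mul_monotone_le s (φ := fun y => (1 + y) * φ y) (fun y hy y' hy' h => ?_)
      (by positivity) (fun y hy => ⟨?_, ?_⟩) hB
    · have := hφ hy hy' h
      have := (hb y hy).1
      have := hy.1
      have := hy'.1
      simp only
      gcongr
      linarith
    · exact mul_nonneg (by linarith [hy.1]) (hb y hy).1
    · have := hb y hy
      nlinarith [hy.1, hy.2]
  have h1 := abs_sum_mul_monotone_le s hm₁ hM hb₁ hB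
  have h2 := abs_sum_mul_monotone_le s hm₂ hM hb₂ hB
  have h3 := hmul φ₁ hm₁ hb₁
  have h4 := hmul φ₂ hm₂ hb₂
  have hB0 : 0 ≤ B := (abs_nonneg _).trans (hB ∅ ordConnected_empty (empty_subset _))
  have hMB : 0 ≤ M * B := by positivity
  have hKi : ∀ y, K y = ind (Icc (-1) 1) y * φ₁ y - ind (Icc (-1) 1) y * φ₂ y := by
    intro y
    by_cases hy : y ∈ Icc (-1 : ℝ) 1
    · rw [ind_of_mem hy, hKe y hy]; ring
    · rw [ind_of_notMem hy, hK.support y hy]; ring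
  have e1 : ∑ k ∈ s, z k * K (x k) = ∑ k ∈ s, z k * (ind (Icc (-1) 1) (x k) * φ₁ (x k)) -
      ∑ k ∈ s, z k * (ind (Icc (-1) 1) (x k) * φ₂ (x k)) := by
    rw [← Finset.sum_sub_distrib]
    exact Finset.sum_congr rfl fun k _ => by rw [hKi]; ring
  have e2 : ∑ k ∈ s, z k * (K (x k) * x k) =
      ∑ k ∈ s, z k * (ind (Icc (-1) 1) (x k) * ((1 + x k) * φ₁ (x k))) -
      ∑ k ∈ s, z k * (ind (Icc (-1) 1) (x k) * ((1 + x k) * φ₂ (x k))) -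
      ∑ k ∈ s, z k * K (x k) := by
    rw [← Finset.sum_sub_distrib, ← Finset.sum_sub_distrib]
    exact Finset.sum_congr rfl fun k _ => by rw [hKi]; ring
  rw [abs_le] at h1 h2 h3 h4
  have h5 : |∑ k ∈ s, z k * K (x k)| ≤ 2 * (M * B) := by
    rw [e1, abs_le]; constructor <;> linarith
  refine ⟨by linarith, ?_⟩
  rw [abs_le] at h5
  rw [e2, abs_le]
  constructor <;> linarith

/-- The kernel is bounded away from zero on some interval to the right of the origin. -/
theorem KernelCondition.exists_pos_on_Icc {K : ℝ → ℝ} (hK : KernelCondition K) :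
    ∃ u v κ : ℝ, 0 ≤ u ∧ u < v ∧ v ≤ 1 ∧ 0 < κ ∧ ∀ y ∈ Icc u v, κ ≤ K y := by
  have hdiff := hK.boundedVariation.locallyBoundedVariationOn.ae_differentiableWithinAt_of_mem
  have hex : ∃ x ∈ Ioo (-1 : ℝ) 1, x ≠ 0 ∧ 0 < K x ∧ ContinuousWithinAt K (Icc (-1) 1) x := by
    by_contra hcon
    have h0 : K =ᵐ[volume] 0 := by
      have hfin : ∀ᵐ x : ℝ, x ∉ ({-1, 0, 1} : Set ℝ) :=
        (measure_eq_zero_iff_ae_notMem.1 (Set.Finite.measure_zero (by simp) volume))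
      filter_upwards [hdiff, hfin] with x hx hx'
      simp only [mem_insert_iff, mem_singleton_iff, not_or] at hx'
      by_contra hKx
      by_cases hxI : x ∈ Icc (-1 : ℝ) 1
      · exact hcon ⟨x, ⟨lt_of_le_of_ne hxI.1 (Ne.symm hx'.1), lt_of_le_of_ne hxI.2 hx'.2.2⟩,
          hx'.2.1, lt_of_le_of_ne (hK.nonneg x) (Ne.symm hKx), (hx hxI).continuousWithinAt⟩
      · exact hKx (hK.support x hxI)
    have := hK.integral_eq_one
    rw [integral_congr_ae h0] at this
    simp at this
  obtain ⟨x, hx, hx0, hKx, hcont⟩ := hex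
  have hca : ContinuousAt K x := hcont.continuousAt (Icc_mem_nhds hx.1 hx.2)
  have hev : ∀ᶠ y in 𝓝 x, K x / 2 < K y ∧ y ∈ Ioo (-1 : ℝ) 1 ∧ y ≠ 0 :=
    (hca.eventually (lt_mem_nhds (half_lt_self hKx))).and
      (Filter.Eventually.and (Ioo_mem_nhds hx.1 hx.2) (isOpen_ne.mem_nhds hx0))
  obtain ⟨r, hr, hball⟩ := Metric.eventually_nhds_iff.1 hev
  have hin : ∀ y ∈ Icc (x - r / 2) (x + r / 2), K x / 2 < K y ∧ y ∈ Ioo (-1 : ℝ) 1 ∧ y ≠ 0 := by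
    intro y hy
    apply hball
    rw [Real.dist_eq, abs_lt]
    constructor <;> linarith [hy.1, hy.2]
  have hl := hin (x - r / 2) ⟨le_rfl, by linarith⟩
  have hr' := hin (x + r / 2) ⟨by linarith, le_rfl⟩
  -- an interval without the origin lies on one side of it, and `K` is symmetric
  rcases lt_or_gt_of_ne hx0 with hneg | hpos
  · refine ⟨-(x + r / 2), -(x - r / 2), K x / 2, ?_, by linarith, by linarith [hl.2.1.1],
      by linarith, fun y hy => ?_⟩
    · by_contra hlt
      exact (hin 0 ⟨by linarith, by linarith⟩).2.2 rfl
    · rw [← hK.symmetric y]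
      exact (hin (-y) ⟨by linarith [hy.2], by linarith [hy.1]⟩).1.le
  · refine ⟨x - r / 2, x + r / 2, K x / 2, ?_, by linarith, by linarith [hr'.2.1.2], by linarith,
      fun y hy => (hin y hy).1.le⟩
    by_contra hlt
    exact (hin 0 ⟨by linarith, by linarith⟩).2.2 rfl

theorem eq_zero_of_forall_quadratic_nonneg {A B : ℝ} (h : ∀ ε : ℝ, 0 ≤ -(2 * ε * A) + ε ^ 2 * B) :
    A = 0 := by
  by_contra hA
  have hA2 : 0 < A ^ 2 := by positivity
  have hB : 0 < |B| + 1 := by positivity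
  have h1 := h (A / (|B| + 1))
  have h2 : -(2 * (A / (|B| + 1)) * A) + (A / (|B| + 1)) ^ 2 * B =
      A ^ 2 / (|B| + 1) ^ 2 * (B - 2 * (|B| + 1)) := by field_simp; ring
  rw [h2] at h1
  have h3 : B - 2 * (|B| + 1) < 0 := by linarith [le_abs_self B, abs_nonneg B]
  have h4 : 0 < A ^ 2 / (|B| + 1) ^ 2 := by positivity
  nlinarith

/-- Normal equations of weighted least squares. -/
theorem normal_equations {ι : Type*} (s : Finset ι) (v y x : ι → ℝ) {a₀ a₁ : ℝ}
    (hmin : ∀ b₀ b₁ : ℝ, ∑ k ∈ s, (y k - a₀ - a₁ * x k) ^ 2 * v k ≤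
      ∑ k ∈ s, (y k - b₀ - b₁ * x k) ^ 2 * v k) :
    ∑ k ∈ s, v k * (y k - a₀ - a₁ * x k) = 0 ∧
      ∑ k ∈ s, v k * (x k * (y k - a₀ - a₁ * x k)) = 0 := by
  have key : ∀ u₀ u₁ : ℝ, ∑ k ∈ s, v k * ((u₀ + u₁ * x k) * (y k - a₀ - a₁ * x k)) = 0 := by
    intro u₀ u₁
    refine eq_zero_of_forall_quadratic_nonneg (B := ∑ k ∈ s, v k * (u₀ + u₁ * x k) ^ 2) fun ε => ?_
    have h1 := hmin (a₀ + ε * u₀) (a₁ + ε * u₁)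
    have h2 : ∑ k ∈ s, (y k - (a₀ + ε * u₀) - (a₁ + ε * u₁) * x k) ^ 2 * v k =
        ∑ k ∈ s, (y k - a₀ - a₁ * x k) ^ 2 * v k +
        (-(2 * ε * ∑ k ∈ s, v k * ((u₀ + u₁ * x k) * (y k - a₀ - a₁ * x k))) +
          ε ^ 2 * ∑ k ∈ s, v k * (u₀ + u₁ * x k) ^ 2) := by
      rw [Finset.mul_sum, Finset.mul_sum, ← Finset.sum_neg_distrib, ← Finset.sum_add_distrib,
        ← Finset.sum_add_distrib]
      exact Finset.sum_congr rfl fun k _ => by ring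
    linarith
  have h0 := key 1 0
  have h1 := key 0 1
  simp only [zero_mul, add_zero, one_mul, zero_add] at h0 h1
  exact ⟨h0, h1⟩

/-- The centred intercept of a weighted least squares fit, by Cramer's rule. -/
theorem intercept_mul_det {ι : Type*} (s : Finset ι) (v e x : ι → ℝ) {c₀ c₁ : ℝ}
    (h0 : ∑ k ∈ s, v k * (e k - c₀ - c₁ * x k) = 0)
    (h1 : ∑ k ∈ s, v k * (x k * (e k - c₀ - c₁ * x k)) = 0) :
    c₀ * ((∑ k ∈ s, v k) * (∑ k ∈ s, v k * x k ^ 2) - (∑ k ∈ s, v k * x k) ^ 2) =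
      (∑ k ∈ s, v k * e k) * (∑ k ∈ s, v k * x k ^ 2) -
        (∑ k ∈ s, v k * (x k * e k)) * (∑ k ∈ s, v k * x k) := by
  have e0 : ∑ k ∈ s, v k * (e k - c₀ - c₁ * x k) =
      ∑ k ∈ s, v k * e k - c₀ * ∑ k ∈ s, v k - c₁ * ∑ k ∈ s, v k * x k := by
    rw [Finset.mul_sum, Finset.mul_sum, ← Finset.sum_sub_distrib, ← Finset.sum_sub_distrib]
    exact Finset.sum_congr rfl fun k _ => by ring
  have e1 : ∑ k ∈ s, v k * (x k * (e k - c₀ - c₁ * x k)) =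
      ∑ k ∈ s, v k * (x k * e k) - c₀ * ∑ k ∈ s, v k * x k - c₁ * ∑ k ∈ s, v k * x k ^ 2 := by
    rw [Finset.mul_sum, Finset.mul_sum, ← Finset.sum_sub_distrib, ← Finset.sum_sub_distrib]
    exact Finset.sum_congr rfl fun k _ => by ring
  rw [e0] at h0
  rw [e1] at h1
  linear_combination (-(∑ k ∈ s, v k * x k ^ 2)) * h0 + (∑ k ∈ s, v k * x k) * h1

/-- The determinant of the design is bounded below if two separated sets carry mass `W` each: one
of them is at distance at least half the separation from the weighted mean. -/
theorem det_ge_of_separated {ι : Type*} (s : Finset ι) {v x : ι → ℝ} (hv : ∀ k ∈ s, 0 ≤ v k)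
    {W ℓ y₁ y₂ : ℝ} {A₁ A₂ : Set ℝ} (hW : 0 < W) (hℓ : 0 ≤ ℓ) (hsep : y₁ + ℓ ≤ y₂)
    (hA₁ : ∀ y ∈ A₁, y ≤ y₁) (hA₂ : ∀ y ∈ A₂, y₂ ≤ y)
    (hW₁ : W ≤ ∑ k ∈ s, v k * ind A₁ (x k)) (hW₂ : W ≤ ∑ k ∈ s, v k * ind A₂ (x k)) :
    W ^ 2 * (ℓ / 2) ^ 2 ≤
      (∑ k ∈ s, v k) * (∑ k ∈ s, v k * x k ^ 2) - (∑ k ∈ s, v k * x k) ^ 2 := by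
  have hS0 : W ≤ ∑ k ∈ s, v k := hW₁.trans (Finset.sum_le_sum fun k hk =>
    mul_le_of_le_one_right (hv k hk) (ind_le_one _ _))
  set S0 := ∑ k ∈ s, v k
  set S1 := ∑ k ∈ s, v k * x k
  set S2 := ∑ k ∈ s, v k * x k ^ 2
  set θ := S1 / S0 with hθ
  have hS0p : 0 < S0 := hW.trans_le hS0
  have e1 : ∑ k ∈ s, v k * (x k - θ) ^ 2 = S2 - 2 * θ * S1 + θ ^ 2 * S0 := by
    simp only [S0, S1, S2]
    rw [Finset.mul_sum, Finset.mul_sum, ← Finset.sum_sub_distrib, ← Finset.sum_add_distrib]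
    exact Finset.sum_congr rfl fun k _ => by ring
  have e2 : S0 * S2 - S1 ^ 2 = S0 * ∑ k ∈ s, v k * (x k - θ) ^ 2 := by
    rw [e1, hθ]; field_simp; ring
  have key : ∀ A : Set ℝ, (∀ y ∈ A, (ℓ / 2) ^ 2 ≤ (y - θ) ^ 2) →
      W ≤ ∑ k ∈ s, v k * ind A (x k) → W * (ℓ / 2) ^ 2 ≤ ∑ k ∈ s, v k * (x k - θ) ^ 2 := by
    intro A hA hWA
    refine (mul_le_mul_of_nonneg_right hWA (sq_nonneg _)).trans ?_
    rw [Finset.sum_mul]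
    refine Finset.sum_le_sum fun k hk => ?_
    by_cases hk' : x k ∈ A
    · rw [ind_of_mem hk', mul_one]
      exact mul_le_mul_of_nonneg_left (hA _ hk') (hv k hk)
    · rw [ind_of_notMem hk', mul_zero, zero_mul]
      exact mul_nonneg (hv k hk) (sq_nonneg _)
  have hmain : W * (ℓ / 2) ^ 2 ≤ ∑ k ∈ s, v k * (x k - θ) ^ 2 := by
    rcases le_total (y₁ + ℓ / 2) θ with hc | hc
    · exact key A₁ (fun y hy => by nlinarith [hA₁ y hy]) hW₁
    · exact key A₂ (fun y hy => by nlinarith [hA₂ y hy]) hW₂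
  rw [e2]
  calc W ^ 2 * (ℓ / 2) ^ 2 = W * (W * (ℓ / 2) ^ 2) := by ring
    _ ≤ _ := mul_le_mul hS0 hmain (by positivity) hS0p.le

theorem MeanSmoothnessCondition.exists_taylor {a b : ℝ} {mu : ℝ → ℝ}
    (hmu : MeanSmoothnessCondition a b mu) : ∃ B : ℝ, 0 ≤ B ∧ ∀ t ∈ Icc a b, ∀ r ∈ Icc a b,
      |mu r - mu t - derivWithin mu (Icc a b) t * (r - t)| ≤ B * (r - t) ^ 2 := by
  obtain ⟨B, hB⟩ := hmu.second_deriv_bounded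
  refine ⟨|B|, abs_nonneg _, fun t ht r hr => ?_⟩
  set D := derivWithin mu (Icc a b) with hD
  have hlip : ∀ w ∈ Icc a b, |D w - D t| ≤ |B| * |w - t| := fun w hw =>
    (convex_Icc a b).norm_image_sub_le_of_norm_derivWithin_le hmu.twice_differentiable
      (fun x hx => (hB x hx).trans (le_abs_self B)) ht hw
  have hsub : uIcc t r ⊆ Icc a b := uIcc_subset_Icc ht hr
  have h1 : ∀ w ∈ uIcc t r,
      HasDerivWithinAt (fun w => mu w - D t * w) (D w - D t) (uIcc t r) w := by
    intro w hw
    have h2 := (hmu.differentiable w (hsub hw)).hasDerivWithinAt.mono hsub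
    have h3 : HasDerivWithinAt (fun w => D t * w) (D t) (uIcc t r) w := by
      simpa using (hasDerivWithinAt_id w (uIcc t r)).const_mul (D t)
    exact h2.sub h3
  have h4 := (convex_uIcc t r).norm_image_sub_le_of_norm_hasDerivWithin_le h1
    (C := |B| * |r - t|) (fun w hw => ?_) left_mem_uIcc right_mem_uIcc
  · rw [Real.norm_eq_abs, Real.norm_eq_abs, mul_assoc, abs_mul_abs_self, ← sq] at h4
    convert h4 using 2
    ring
  · refine (hlip w (hsub hw)).trans ?_
    exact mul_le_mul_of_nonneg_left (abs_sub_left_of_mem_uIcc hw) (abs_nonneg _)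

/-! ### The local-linear design -/

section Mass

variable {ι : Type*} {s : Finset ι} {a b : ℝ} {f : ℝ → ℝ} {h : ℕ → ℝ} {n c : ℕ} {t w : ι → ℝ}
  {r mT MT : ℝ}

/-- Upper bound for the weight in a window of one bandwidth around a point. -/
theorem window_mass_le (hf : ∀ t ∈ Icc a b, f t ≤ MT) (hMT : 0 ≤ MT) (hn : 1 ≤ n) (hh : h n ≤ 1 / 2)
    (hnh : 1 ≤ n * h n) (hc : b - a + 2 ≤ c) (ht : ∀ k ∈ s, t k ∈ Icc a b)
    (hw : ∀ k ∈ s, 0 ≤ w k)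
    (hcnt : ∀ p q, GridPair c h n p q → |∑ k ∈ s, w k * ind (gridBlock a n p q) (t k) -
      n * (designLaw a b f).real (gridBlock a n p q)| ≤ r) {t₀ : ℝ} (ht₀ : t₀ ∈ Icc a b) :
    ∑ k ∈ s, w k * ind (Icc (t₀ - h n) (t₀ + h n)) (t k) ≤ 4 * MT * (n * h n) + r := by
  have hn' : (1 : ℝ) ≤ n := by exact_mod_cast hn
  have hh0 : 0 < h n := by by_contra hneg; nlinarith
  set p := ⌊n * (t₀ - h n - a)⌋₊ with hp
  set q := ⌊n * (t₀ + h n - a)⌋₊ + 1 with hq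
  have h1 : n * (t₀ - h n - a) < p + 1 := Nat.lt_floor_add_one _
  have h2 : ((q : ℕ) : ℝ) ≤ n * (t₀ + h n - a) + 1 := by
    rw [hq]
    push_cast
    have := Nat.floor_le (a := n * (t₀ + h n - a)) (mul_nonneg (by linarith) (by linarith [ht₀.1]))
    linarith
  have hpq : p ≤ q := (Nat.floor_le_floor (by nlinarith)).trans (Nat.le_succ _)
  have hgp : GridPair c h n p q := by
    refine ⟨hpq, ?_, by nlinarith⟩
    have : ((q : ℕ) : ℝ) ≤ ((c * n : ℕ) : ℝ) := by
      push_cast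
      nlinarith [ht₀.2]
    exact_mod_cast this
  have h3 := (abs_le.1 (hcnt p q hgp)).2
  have h4 := hgp.designLaw_le hf hMT hn
  have h5 : ∑ k ∈ s, w k * ind (Icc (t₀ - h n) (t₀ + h n)) (t k) ≤
      ∑ k ∈ s, w k * ind (gridBlock a n p q) (t k) := by
    refine Finset.sum_le_sum fun k hk => mul_le_mul_of_nonneg_left ?_ (hw k hk)
    by_cases hk' : t k ∈ Icc (t₀ - h n) (t₀ + h n)
    · rw [ind_of_mem hk', ind_of_mem]
      rw [mem_gridBlock_iff (ht k hk).1 hn]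
      refine ⟨Nat.floor_le_floor ?_, Nat.lt_succ_of_le (Nat.floor_le_floor ?_)⟩
      · have := hk'.1; gcongr
      · have := hk'.2; gcongr
    · rw [ind_of_notMem hk']
      exact ind_nonneg _ _
  nlinarith

/-- Lower bound for the weight in an interval of length proportional to the bandwidth. -/
theorem interval_mass_ge (hf : ∀ t ∈ Icc a b, mT ≤ f t ∧ f t ≤ MT) (hmT : 0 ≤ mT) (hn : 1 ≤ n)
    (hc : b - a + 2 ≤ c) (hw : ∀ k ∈ s, 0 ≤ w k)
    (hcnt : ∀ p q, GridPair c h n p q → |∑ k ∈ s, w k * ind (gridBlock a n p q) (t k) -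
      n * (designLaw a b f).real (gridBlock a n p q)| ≤ r) {ℓ y₁ y₂ : ℝ} (hℓ1 : ℓ ≤ 1)
    (hℓ : 4 ≤ ℓ * (n * h n)) (hnh : 0 < n * h n) (hr : r ≤ mT * ℓ / 4 * (n * h n)) (hy₁ : a ≤ y₁)
    (hy₂ : y₂ ≤ b) (hy : y₂ - y₁ = ℓ * h n) :
    mT * ℓ / 4 * (n * h n) ≤ ∑ k ∈ s, w k * ind (Icc y₁ y₂) (t k) := by
  have hn' : (1 : ℝ) ≤ n := by exact_mod_cast hn
  have hn0 : (0 : ℝ) < n := by linarith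
  have hyn : n * (y₂ - y₁) = ℓ * (n * h n) := by rw [hy]; ring
  set p := ⌈n * (y₁ - a)⌉₊ with hp
  set q := ⌊n * (y₂ - a)⌋₊ with hq
  have hp0 : 0 ≤ n * (y₁ - a) := mul_nonneg hn0.le (by linarith)
  have hq0 : 0 ≤ n * (y₂ - a) := by nlinarith
  have p1 : n * (y₁ - a) ≤ p := Nat.le_ceil _
  have p2 : (p : ℝ) < n * (y₁ - a) + 1 := Nat.ceil_lt_add_one hp0
  have q1 : (q : ℝ) ≤ n * (y₂ - a) := Nat.floor_le hq0
  have q2 : n * (y₂ - a) < q + 1 := Nat.lt_floor_add_one _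
  have hpq' : (p : ℝ) ≤ q := by nlinarith
  have hgp : GridPair c h n p q := by
    refine ⟨by exact_mod_cast hpq', ?_, by nlinarith⟩
    have : (q : ℝ) ≤ ((c * n : ℕ) : ℝ) := by
      push_cast
      nlinarith
    exact_mod_cast this
  have hleft : y₁ ≤ a + p / n := by
    have : y₁ - a ≤ p / n := (le_div_iff₀ hn0).2 (by linarith)
    linarith
  have hright : a + q / n ≤ y₂ := by
    have : q / n ≤ y₂ - a := (div_le_iff₀ hn0).2 (by linarith)
    linarith
  have h1 := (abs_le.1 (hcnt p q hgp)).1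
  have h2 := le_designLaw_real_Ico hf hmT (x := a + p / n) (y := a + q / n) (by linarith)
    (by linarith)
  have h3 : n * (mT * (a + q / n - (a + p / n))) = mT * (q - p) := by field_simp; ring
  have h4 : n * (mT * (a + q / n - (a + p / n))) ≤ n * (designLaw a b f).real (gridBlock a n p q) :=
    mul_le_mul_of_nonneg_left h2 hn0.le
  have h5 : ∑ k ∈ s, w k * ind (gridBlock a n p q) (t k) ≤
      ∑ k ∈ s, w k * ind (Icc y₁ y₂) (t k) := by
    refine Finset.sum_le_sum fun k hk => mul_le_mul_of_nonneg_left ?_ (hw k hk)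
    by_cases hk' : t k ∈ gridBlock a n p q
    · rw [ind_of_mem hk', ind_of_mem (J := Icc y₁ y₂) ⟨hleft.trans hk'.1, hk'.2.le.trans hright⟩]
    · rw [ind_of_notMem hk']
      exact ind_nonneg _ _
  have h6 : ℓ * (n * h n) / 2 ≤ (q : ℝ) - p := by nlinarith
  have h7 : mT * (ℓ * (n * h n) / 2) ≤ mT * (q - p) := mul_le_mul_of_nonneg_left h6 hmT
  linarith

/-- Uniform lower bound for the determinant of the local-linear design. Near an end point of
`[a, b]`, the half of the window that lies inside `[a, b]` carries enough weight. -/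
theorem det_ge {K : ℝ → ℝ} (hK : KernelCondition K) (hf : ∀ t ∈ Icc a b, mT ≤ f t ∧ f t ≤ MT)
    (hmT : 0 < mT) (hn : 1 ≤ n) (hh0 : 0 < h n) (hhab : h n ≤ (b - a) / 2) (hc : b - a + 2 ≤ c)
    (hw : ∀ k ∈ s, 0 ≤ w k)
    (hcnt : ∀ p q, GridPair c h n p q → |∑ k ∈ s, w k * ind (gridBlock a n p q) (t k) -
      n * (designLaw a b f).real (gridBlock a n p q)| ≤ r) {u v κ : ℝ} (hu : 0 ≤ u) (huv : u < v)
    (hv : v ≤ 1) (hκ : 0 < κ) (hKκ : ∀ y ∈ Icc u v, κ ≤ K y) (hℓ : 4 ≤ (v - u) / 3 * (n * h n))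
    (hr : r ≤ mT * ((v - u) / 3) / 4 * (n * h n)) {t₀ : ℝ} (ht₀ : t₀ ∈ Icc a b) :
    (κ * (mT * ((v - u) / 3) / 4)) ^ 2 * ((v - u) / 3 / 2) ^ 2 * (n * h n) ^ 2 ≤
      (∑ k ∈ s, w k * K ((t k - t₀) / h n)) *
        (∑ k ∈ s, w k * K ((t k - t₀) / h n) * ((t k - t₀) / h n) ^ 2) -
        (∑ k ∈ s, w k * K ((t k - t₀) / h n) * ((t k - t₀) / h n)) ^ 2 := by
  set ℓ := (v - u) / 3 with hℓd
  have hn0 : (0 : ℝ) < n := by exact_mod_cast hn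
  have hnh : 0 < n * h n := by positivity
  have hℓ0 : 0 < ℓ := by rw [hℓd]; linarith
  have hmass : ∀ x₁ x₂ : ℝ, x₂ - x₁ = ℓ → a ≤ t₀ + h n * x₁ → t₀ + h n * x₂ ≤ b →
      (∀ y ∈ Icc x₁ x₂, κ ≤ K y) → κ * (mT * ℓ / 4) * (n * h n) ≤
        ∑ k ∈ s, w k * K ((t k - t₀) / h n) * ind (Icc x₁ x₂) ((t k - t₀) / h n) := by
    intro x₁ x₂ hx hx₁ hx₂ hKx
    have h1 := interval_mass_ge hf hmT.le hn hc hw hcnt (by linarith : ℓ ≤ 1) hℓ hnh hr hx₁ hx₂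
      (by rw [← hx]; ring)
    have h2 := mul_le_mul_of_nonneg_left h1 hκ.le
    rw [mul_assoc]
    refine h2.trans ?_
    rw [Finset.mul_sum]
    refine Finset.sum_le_sum fun k hk => ?_
    have hiff : t k ∈ Icc (t₀ + h n * x₁) (t₀ + h n * x₂) ↔ (t k - t₀) / h n ∈ Icc x₁ x₂ := by
      rw [mem_Icc, mem_Icc, le_div_iff₀ hh0, div_le_iff₀ hh0]
      constructor <;> rintro ⟨h1, h2⟩ <;> constructor <;> linarith
    by_cases hk' : (t k - t₀) / h n ∈ Icc x₁ x₂
    · rw [ind_of_mem hk', ind_of_mem (hiff.2 hk'), mul_one, mul_one, mul_comm κ]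
      exact mul_le_mul_of_nonneg_left (hKx _ hk') (hw k hk)
    · rw [ind_of_notMem hk', ind_of_notMem fun h' => hk' (hiff.1 h')]
      simp
  have hvw : ∀ k ∈ s, 0 ≤ w k * K ((t k - t₀) / h n) := fun k hk =>
    mul_nonneg (hw k hk) (hK.nonneg _)
  have hW : 0 < κ * (mT * ℓ / 4) * (n * h n) := by positivity
  have hmain : ∀ x₁ x₂ x₃ x₄ : ℝ, x₂ - x₁ = ℓ → x₄ - x₃ = ℓ → x₂ + ℓ ≤ x₃ → a ≤ t₀ + h n * x₁ →
      t₀ + h n * x₄ ≤ b → (∀ y ∈ Icc x₁ x₄, κ ≤ K y) →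
      (κ * (mT * ℓ / 4) * (n * h n)) ^ 2 * (ℓ / 2) ^ 2 ≤
      (∑ k ∈ s, w k * K ((t k - t₀) / h n)) *
        (∑ k ∈ s, w k * K ((t k - t₀) / h n) * ((t k - t₀) / h n) ^ 2) -
        (∑ k ∈ s, w k * K ((t k - t₀) / h n) * ((t k - t₀) / h n)) ^ 2 := by
    intro x₁ x₂ x₃ x₄ h12 h34 h23 h1 h4 hKx
    refine det_ge_of_separated s hvw hW hℓ0.le h23 (A₁ := Icc x₁ x₂) (A₂ := Icc x₃ x₄)
      (fun y hy => hy.2) (fun y hy => hy.1) ?_ ?_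
    · exact hmass x₁ x₂ h12 h1 (by nlinarith) fun y hy => hKx y ⟨hy.1, by linarith [hy.2]⟩
    · exact hmass x₃ x₄ h34 (by nlinarith) h4 fun y hy => hKx y ⟨by linarith [hy.1], hy.2⟩
  refine le_trans (le_of_eq (by ring)) (?_ : (κ * (mT * ℓ / 4) * (n * h n)) ^ 2 * (ℓ / 2) ^ 2 ≤ _)
  rcases le_total t₀ ((a + b) / 2) with hmid | hmid
  · exact hmain u (u + ℓ) (v - ℓ) v (by ring) (by ring) (by rw [hℓd]; linarith)
      (by nlinarith [ht₀.1]) (by nlinarith) hKκ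
  · refine hmain (-v) (-v + ℓ) (-u - ℓ) (-u) (by ring) (by ring) (by rw [hℓd]; linarith)
      (by nlinarith) (by nlinarith [ht₀.2]) fun y hy => ?_
    rw [← hK.symmetric y]
    exact hKκ _ ⟨by linarith [hy.2], by linarith [hy.1]⟩

end Mass

/-- The error of a weighted local-linear fit, given bounds for the mass of the window, the
determinant, the noise sums over intervals, and the Taylor remainder. -/
theorem abs_intercept_le {K : ℝ → ℝ} (hK : KernelCondition K) {M : ℝ} (hM0 : 0 ≤ M)
    (hM : ∀ y, K y ≤ M) {ι : Type} (s : Finset ι)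
    (hKsum : ∀ (x z : ι → ℝ) (B : ℝ),
      (∀ I : Set ℝ, I.OrdConnected → I ⊆ Icc (-1) 1 → |∑ k ∈ s, z k * ind I (x k)| ≤ B) →
      |∑ k ∈ s, z k * K (x k)| ≤ M * B ∧ |∑ k ∈ s, z k * (K (x k) * x k)| ≤ M * B)
    {η t₀ c₀ c₁ N R D B A : ℝ} {t w ε ρ : ι → ℝ} (hη : 0 < η) (hw : ∀ k ∈ s, 0 ≤ w k)
    (hwin : ∑ k ∈ s, w k * ind (Icc (t₀ - η) (t₀ + η)) (t k) ≤ A * N)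
    (hnoise : ∀ I : Set ℝ, I.OrdConnected → (∀ x ∈ I, |x - t₀| ≤ η) →
      |∑ k ∈ s, w k * ε k * ind I (t k)| ≤ R * N)
    (hρ : ∀ k ∈ s, |ρ k| ≤ B * (t k - t₀) ^ 2) (hB : 0 ≤ B) (hD : 0 < D) (hN : 0 < N)
    (hdet : D * N ^ 2 ≤ (∑ k ∈ s, w k * K ((t k - t₀) / η)) *
        (∑ k ∈ s, w k * K ((t k - t₀) / η) * ((t k - t₀) / η) ^ 2) -
        (∑ k ∈ s, w k * K ((t k - t₀) / η) * ((t k - t₀) / η)) ^ 2)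
    (h0 : ∑ k ∈ s, w k * K ((t k - t₀) / η) * (ε k + ρ k - c₀ - c₁ * ((t k - t₀) / η)) = 0)
    (h1 : ∑ k ∈ s, w k * K ((t k - t₀) / η) *
      (((t k - t₀) / η) * (ε k + ρ k - c₀ - c₁ * ((t k - t₀) / η))) = 0) :
    |c₀| ≤ 2 * (M * R + B * η ^ 2 * (M * A)) * (M * A) / D := by
  set x : ι → ℝ := fun k => (t k - t₀) / η with hx
  have htx : ∀ k, t k - t₀ = η * x k := fun k => by rw [hx]; field_simp
  have hvn : ∀ k ∈ s, 0 ≤ w k * K (x k) := fun k hk => mul_nonneg (hw k hk) (hK.nonneg _)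
  have hmem : ∀ k, x k ∈ Icc (-1 : ℝ) 1 → t k ∈ Icc (t₀ - η) (t₀ + η) := fun k hk => by
    have h2 := htx k
    constructor <;> nlinarith [hk.1, hk.2]
  have hS0 : ∑ k ∈ s, w k * K (x k) ≤ M * A * N := by
    calc _ ≤ ∑ k ∈ s, M * (w k * ind (Icc (t₀ - η) (t₀ + η)) (t k)) := by
          refine Finset.sum_le_sum fun k hk => ?_
          by_cases hk' : x k ∈ Icc (-1 : ℝ) 1
          · rw [ind_of_mem (hmem k hk'), mul_one, mul_comm M]
            exact mul_le_mul_of_nonneg_left (hM _) (hw k hk)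
          · rw [hK.support _ hk', mul_zero]
            exact mul_nonneg hM0 (mul_nonneg (hw k hk) (ind_nonneg _ _))
      _ ≤ _ := by
          rw [← Finset.mul_sum, mul_assoc]
          gcongr
  -- outside `[-1, 1]` all terms vanish, inside the powers of `x` are at most one
  have hvx : ∀ k ∈ s, ∀ y : ℝ, (x k ∈ Icc (-1 : ℝ) 1 → |y| ≤ 1) →
      |w k * K (x k) * y| ≤ w k * K (x k) := by
    intro k hk y hy
    rw [abs_mul, abs_of_nonneg (hvn k hk)]
    by_cases hk' : x k ∈ Icc (-1 : ℝ) 1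
    · exact mul_le_of_le_one_right (hvn k hk) (hy hk')
    · rw [hK.support _ hk']; simp
  have hS1 : |∑ k ∈ s, w k * K (x k) * x k| ≤ M * A * N :=
    ((Finset.abs_sum_le_sum_abs _ _).trans (Finset.sum_le_sum fun k hk =>
      hvx k hk _ fun hk' => abs_le.2 hk')).trans hS0
  have hS2 : |∑ k ∈ s, w k * K (x k) * x k ^ 2| ≤ M * A * N :=
    ((Finset.abs_sum_le_sum_abs _ _).trans (Finset.sum_le_sum fun k hk =>
      hvx k hk _ fun hk' => by
        rw [abs_pow]; exact pow_le_one₀ (abs_nonneg _) (abs_le.2 hk'))).trans hS0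
  have hxnoise : ∀ I : Set ℝ, I.OrdConnected → I ⊆ Icc (-1) 1 →
      |∑ k ∈ s, w k * ε k * ind I (x k)| ≤ R * N := by
    intro I hI hI1
    have e : ∀ k, ind I (x k) = ind {y | (y - t₀) / η ∈ I} (t k) := fun k => by
      by_cases hk : x k ∈ I
      · rw [ind_of_mem hk, ind_of_mem (J := {y | (y - t₀) / η ∈ I}) hk]
      · rw [ind_of_notMem hk, ind_of_notMem (J := {y | (y - t₀) / η ∈ I}) hk]
    simp only [e]
    refine hnoise _ ⟨fun y hy y' hy' z hz => hI.out hy hy' ⟨?_, ?_⟩⟩ fun y hy => ?_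
    · have := hz.1; gcongr
    · have := hz.2; gcongr
    · have := abs_le.2 (hI1 hy)
      rwa [abs_div, abs_of_pos hη, div_le_one hη] at this
  obtain ⟨hε0, hε1⟩ := hKsum x (fun k => w k * ε k) (R * N) hxnoise
  have hρ0 : ∀ y : ι → ℝ, (∀ k ∈ s, x k ∈ Icc (-1 : ℝ) 1 → |y k| ≤ 1) →
      |∑ k ∈ s, w k * K (x k) * (y k * ρ k)| ≤ B * η ^ 2 * (M * A * N) := by
    intro y hy
    refine (Finset.abs_sum_le_sum_abs _ _).trans ?_
    refine le_trans ?_ (mul_le_mul_of_nonneg_left hS0 (by positivity : 0 ≤ B * η ^ 2))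
    rw [Finset.mul_sum]
    refine Finset.sum_le_sum fun k hk => ?_
    rw [abs_mul, abs_of_nonneg (hvn k hk), mul_comm (B * η ^ 2)]
    by_cases hk' : x k ∈ Icc (-1 : ℝ) 1
    · refine mul_le_mul_of_nonneg_left ?_ (hvn k hk)
      have h2 := hρ k hk
      rw [htx k, mul_pow] at h2
      have h3 : x k ^ 2 ≤ 1 := by rw [← sq_abs]; exact pow_le_one₀ (abs_nonneg _) (abs_le.2 hk')
      rw [abs_mul]
      calc |y k| * |ρ k| ≤ 1 * (B * (η ^ 2 * x k ^ 2)) :=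
            mul_le_mul (hy k hk hk') h2 (abs_nonneg _) zero_le_one
        _ ≤ 1 * (B * (η ^ 2 * 1)) := by gcongr
        _ = _ := by ring
    · rw [hK.support _ hk']; simp
  have hR0 : |∑ k ∈ s, w k * K (x k) * (ε k + ρ k)| ≤ (M * R + B * η ^ 2 * (M * A)) * N := by
    have e : ∑ k ∈ s, w k * K (x k) * (ε k + ρ k) =
        ∑ k ∈ s, w k * ε k * K (x k) + ∑ k ∈ s, w k * K (x k) * (1 * ρ k) := by
      rw [← Finset.sum_add_distrib]; exact Finset.sum_congr rfl fun k _ => by ring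
    rw [e]
    refine (abs_add_le _ _).trans
      ((add_le_add hε0 (hρ0 (fun _ => 1) fun _ _ _ => by simp)).trans ?_)
    exact le_of_eq (by ring)
  have hR1 : |∑ k ∈ s, w k * K (x k) * (x k * (ε k + ρ k))| ≤
      (M * R + B * η ^ 2 * (M * A)) * N := by
    have e : ∑ k ∈ s, w k * K (x k) * (x k * (ε k + ρ k)) =
        ∑ k ∈ s, w k * ε k * (K (x k) * x k) + ∑ k ∈ s, w k * K (x k) * (x k * ρ k) := by
      rw [← Finset.sum_add_distrib]; exact Finset.sum_congr rfl fun k _ => by ring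
    rw [e]
    refine (abs_add_le _ _).trans ((add_le_add hε1 (hρ0 x fun _ _ hk => abs_le.2 hk)).trans ?_)
    exact le_of_eq (by ring)
  have hcr := intercept_mul_det s (fun k => w k * K (x k)) (fun k => ε k + ρ k) x h0 h1
  have hdetpos : 0 < D * N ^ 2 := by positivity
  have hG0 : 0 ≤ (M * R + B * η ^ 2 * (M * A)) * N := (abs_nonneg _).trans hR0
  have hbound : |c₀| * (D * N ^ 2) ≤
      2 * ((M * R + B * η ^ 2 * (M * A)) * N) * (M * A * N) := by
    calc |c₀| * (D * N ^ 2) ≤ |c₀| * _ := mul_le_mul_of_nonneg_left hdet (abs_nonneg _)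
      _ = |c₀ * _| := by rw [abs_mul, abs_of_pos (hdetpos.trans_le hdet)]
      _ = |_| := congrArg abs hcr
      _ ≤ _ := by
        refine (abs_sub _ _).trans ?_
        rw [abs_mul, abs_mul, two_mul, add_mul]
        exact add_le_add (mul_le_mul hR0 hS2 (abs_nonneg _) hG0)
          (mul_le_mul hR1 hS1 (abs_nonneg _) hG0)
  rw [le_div_iff₀ hD]
  have hN2 : 0 < N ^ 2 := by positivity
  refine le_of_mul_le_mul_right ?_ hN2
  calc _ = |c₀| * (D * N ^ 2) := by ring
    _ ≤ _ := hbound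
    _ = _ := by ring

/-! ### Uniform convergence -/

/-- The moment condition provides a measurable envelope of the centred process. -/
theorem MomentCondition.exists_envelope {Ω S : Type*} [MeasurableSpace Ω] [MeasurableSpace S]
    {P : Measure Ω} {ν : Measure S} [IsProbabilityMeasure ν] {a b : ℝ} {X : S → Icc a b → ℝ}
    {U : ℕ → ℕ → Ω → ℝ} {lam : ℝ} (hmom : MomentCondition P ν X U lam) {mu : ℝ → ℝ} {B : ℝ}
    (hB0 : 0 ≤ B) (hB : ∀ t ∈ Icc a b, |mu t| ≤ B) :
    ∃ (F : S → ℝ) (S₀ : Set S), Measurable F ∧ (∀ s, 0 ≤ F s) ∧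
      Integrable (fun s => F s ^ lam) ν ∧ MeasurableSet S₀ ∧ (∀ᵐ s ∂ν, s ∈ S₀) ∧
      ∀ s ∈ S₀, ∀ t, |X s t - mu t| ≤ F s := by
  have hlam := hmom.two_lt
  have hlam0 : 0 < lam := by linarith
  set G := hmom.sup_aemeasurable.mk _ with hG
  have hGm : Measurable G := hmom.sup_aemeasurable.measurable_mk
  have hGe := hmom.sup_aemeasurable.ae_eq_mk
  have hGfin : ∫⁻ s, G s ∂ν ≠ ∞ := by
    rw [← lintegral_congr_ae hGe]; exact hmom.sup_moment.ne
  have hGi : Integrable (fun s => (G s).toReal) ν :=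
    integrable_toReal_of_lintegral_ne_top hGm.aemeasurable hGfin
  set F : S → ℝ := fun s => (G s).toReal ^ lam⁻¹ + B with hF
  have hF0 : ∀ s, 0 ≤ F s := fun s =>
    add_nonneg (Real.rpow_nonneg ENNReal.toReal_nonneg _) hB0
  have hFm : Measurable F := (hGm.ennreal_toReal.pow_const _).add_const _
  have hgood : ∀ᵐ s ∂ν, (⨆ t : Icc a b, ENNReal.ofReal (|X s t| ^ lam)) = G s ∧ G s < ∞ :=
    hGe.and (ae_lt_top hGm hGfin)
  obtain ⟨N, hN1, hN2, hN3⟩ := exists_measurable_superset_of_null (ae_iff.1 hgood)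
  refine ⟨F, Nᶜ, hFm, hF0, ?_, hN2.compl, measure_eq_zero_iff_ae_notMem.1 hN3, fun s hs t => ?_⟩
  · have hdom : Integrable (fun s => 2 ^ (lam - 1) * ((G s).toReal + B ^ lam)) ν :=
      (hGi.add (integrable_const _)).const_mul _
    refine hdom.mono' (hFm.pow_const _).aestronglyMeasurable (Eventually.of_forall fun s => ?_)
    rw [Real.norm_eq_abs, abs_of_nonneg (Real.rpow_nonneg (hF0 s) _)]
    have h1 : ((G s).toReal ^ lam⁻¹ + B) ^ lam ≤
        2 ^ (lam - 1) * (((G s).toReal ^ lam⁻¹) ^ lam + B ^ lam) := by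
      exact_mod_cast NNReal.rpow_add_le_mul_rpow_add_rpow
        ⟨_, Real.rpow_nonneg (ENNReal.toReal_nonneg (a := G s)) lam⁻¹⟩ ⟨B, hB0⟩
        (by linarith : 1 ≤ lam)
    rwa [Real.rpow_inv_rpow ENNReal.toReal_nonneg hlam0.ne'] at h1
  · obtain ⟨h1, h2⟩ := not_not.1 fun h => hs (hN1 h)
    have h3 : ENNReal.ofReal (|X s t| ^ lam) ≤ G s := by
      rw [← h1]; exact le_iSup (fun t : Icc a b => ENNReal.ofReal (|X s t| ^ lam)) t
    have h4 : |X s t| ^ lam ≤ (G s).toReal := (ENNReal.ofReal_le_iff_le_toReal h2.ne).1 h3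
    have h5 : |X s t| ≤ (G s).toReal ^ lam⁻¹ :=
      (Real.le_rpow_inv_iff_of_pos (abs_nonneg _) ENNReal.toReal_nonneg hlam0).2 h4
    exact (abs_sub _ _).trans (add_le_add h5 (hB t t.2))

theorem sum_sigma_weight (n : ℕ) (k : ℕ → ℕ) (g : ℕ → ℕ → ℝ) :
    ∑ x ∈ (Finset.range n).sigma fun i => Finset.range (k i), (k x.1 : ℝ)⁻¹ * g x.1 x.2 =
      ∑ i ∈ Finset.range n, (k i : ℝ)⁻¹ * ∑ j ∈ Finset.range (k i), g i j := by
  rw [Finset.sum_sigma]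
  simp only [Finset.mul_sum]

/-- In the rescaled design the local-linear criterion is a weighted least squares criterion. -/
theorem localLinearLoss_eq (K : ℝ → ℝ) (m : ℕ → ℕ → ℕ) (n : ℕ) {h : ℝ} (hh : h ≠ 0)
    (T Y : ℕ → ℕ → ℝ) (t a₀ a₁ : ℝ) :
    localLinearLoss K m n h T Y t a₀ a₁ = (1 / (n : ℝ)) * (1 / h) *
      ∑ x ∈ (Finset.range n).sigma fun i => Finset.range (m n i),
        (Y x.1 x.2 - a₀ - a₁ * h * ((T x.1 x.2 - t) / h)) ^ 2 *
          ((m n x.1 : ℝ)⁻¹ * K ((T x.1 x.2 - t) / h)) := by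
  have e := sum_sigma_weight n (m n)
    fun i j => (Y i j - a₀ - a₁ * (T i j - t)) ^ 2 * scaledKernel K h (T i j - t)
  rw [localLinearLoss]
  simp only [one_div (_ : ℝ)] at *
  rw [← e, mul_assoc, Finset.mul_sum _ _ h⁻¹]
  congr 1
  refine Finset.sum_congr rfl fun x _ => ?_
  have e2 : a₁ * h * ((T x.1 x.2 - t) / h) = a₁ * (T x.1 x.2 - t) := by field_simp
  rw [e2, scaledKernel]
  ring

/-- The centred coefficients of a local-linear fit satisfy the normal equations of the rescaled
design. -/
theorem IsLocalLinearEstimate.normal_equations {K : ℝ → ℝ} {m : ℕ → ℕ → ℕ} {n : ℕ} (hn : 1 ≤ n)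
    {h : ℝ} (hh : 0 < h) {T Y : ℕ → ℕ → ℝ} {t a₀ : ℝ}
    (hest : IsLocalLinearEstimate K m n h T Y t a₀) (α β : ℝ) :
    ∃ c₁ : ℝ,
      ∑ x ∈ (Finset.range n).sigma fun i => Finset.range (m n i),
        (m n x.1 : ℝ)⁻¹ * K ((T x.1 x.2 - t) / h) *
        (Y x.1 x.2 - α - β * (T x.1 x.2 - t) - (a₀ - α) - c₁ * ((T x.1 x.2 - t) / h)) = 0 ∧
      ∑ x ∈ (Finset.range n).sigma fun i => Finset.range (m n i),
        (m n x.1 : ℝ)⁻¹ * K ((T x.1 x.2 - t) / h) * ((T x.1 x.2 - t) / h *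
        (Y x.1 x.2 - α - β * (T x.1 x.2 - t) - (a₀ - α) - c₁ * ((T x.1 x.2 - t) / h))) = 0 := by
  obtain ⟨a₁, hmin⟩ := hest
  have hn0 : (0 : ℝ) < n := by exact_mod_cast hn
  have hne := _root_.normal_equations ((Finset.range n).sigma fun i => Finset.range (m n i))
    (fun x => (m n x.1 : ℝ)⁻¹ * K ((T x.1 x.2 - t) / h)) (fun x => Y x.1 x.2)
    (fun x => (T x.1 x.2 - t) / h) (a₀ := a₀) (a₁ := a₁ * h) fun b₀ b₁ => by
      have h1 := hmin b₀ (b₁ / h)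
      rw [localLinearLoss_eq K m n hh.ne', localLinearLoss_eq K m n hh.ne',
        div_mul_cancel₀ _ hh.ne'] at h1
      exact le_of_mul_le_mul_left h1 (by positivity)
  have e : ∀ x : Σ _ : ℕ, ℕ, Y x.1 x.2 - α - β * (T x.1 x.2 - t) - (a₀ - α) -
      (a₁ * h - β * h) * ((T x.1 x.2 - t) / h) =
      Y x.1 x.2 - a₀ - a₁ * h * ((T x.1 x.2 - t) / h) := fun x => by field_simp; ring
  refine ⟨a₁ * h - β * h, ?_, ?_⟩
  · simp only [e]; exact hne.1
  · simp only [e]; exact hne.2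

namespace SamplingModel

variable {Ω S : Type*} [MeasurableSpace Ω] [MeasurableSpace S] {P : Measure Ω}
  [IsProbabilityMeasure P] {ν : Measure S} [IsProbabilityMeasure ν] {a b : ℝ} {X : S → Icc a b → ℝ}
  {f : ℝ → ℝ} {ξ : ℕ → Ω → S} {T : ℕ → ℕ → Ω → Icc a b} {U : ℕ → ℕ → Ω → ℝ}
  {m : ℕ → ℕ → ℕ} {h : ℕ → ℝ} {lam : ℝ}

/-- Uniform bounds for the noise `Y - mu (T)` over grid blocks and cells. -/
theorem ae_noise_bounds (hM : SamplingModel P ν X f ξ T U) {mu : ℝ → ℝ}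
    (hmu : ∀ t : Icc a b, mu t = ∫ s, X s t ∂ν) (hmuc : ContinuousOn mu (Icc a b)) {MT : ℝ}
    (hf : ∀ t ∈ Icc a b, f t ≤ MT) (hMT : 0 ≤ MT) (hm : ∀ n, ∀ i < n, 2 ≤ m n i)
    (hR : ∀ᶠ n in atTop, RateBounds m h lam n) (hmom : MomentCondition P ν X U lam) (c : ℕ) :
    ∀ᵐ ω ∂P, ∃ C : ℝ, ∀ᶠ n in atTop, ∀ p q, GridPair c h n p q →
      |∑ x ∈ (Finset.range n).sigma fun i => Finset.range (m n i), (m n x.1 : ℝ)⁻¹ *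
        (observation X ξ T U ω x.1 x.2 - mu (T x.1 x.2 ω)) *
          ind (gridBlock a n p q) (T x.1 x.2 ω)| ≤ C * (truncLevel m h n * Real.log n) ∧
      (q = p + 1 → ∑ x ∈ (Finset.range n).sigma fun i => Finset.range (m n i),
        |(m n x.1 : ℝ)⁻¹ * (observation X ξ T U ω x.1 x.2 - mu (T x.1 x.2 ω))| *
          ind (gridBlock a n p q) (T x.1 x.2 ω) ≤ C * (truncLevel m h n * Real.log n)) := by
  obtain ⟨B, hB⟩ := isCompact_Icc.exists_bound_of_continuousOn hmuc
  obtain ⟨F, S₀, hFm, hF0, hFi, hS, hS1, hdom⟩ := hmom.exists_envelope (mu := mu) (abs_nonneg B)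
    fun t ht => (hB t ht).trans (le_abs_self B)
  have hlam := hmom.two_lt
  have hXm : ∀ t, Measurable fun s => X s t := fun t =>
    hM.measurable_process.comp measurable_prodMk_right
  have hmum : Measurable fun t : Icc a b => mu t :=
    (continuousOn_iff_continuous_domRestrict.1 hmuc).measurable
  have hFi1 := hFi.of_rpow hlam.le hFm hF0
  have hXi : ∀ t, Integrable (fun s => X s t) ν := fun t => by
    have h1 : Integrable (fun s => X s t - mu t) ν :=
      hFi1.mono' ((hXm t).sub_const _).aestronglyMeasurable (hS1.mono fun s hs => hdom s hs t)
    exact (h1.add (integrable_const (mu t))).congr (Eventually.of_forall fun s => by simp)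
  have hproc := hM.ae_process_bounds hf hMT hm hR hlam (g₀ := fun s t => X s t - mu t)
    (hM.measurable_process.sub (hmum.comp measurable_snd))
    (fun t => by rw [integral_sub (hXi t) (integrable_const _), ← hmu]; simp)
    hFm hF0 hFi hS hS1 hdom c
  have herr := hM.ae_error_bounds hf hMT hm hR hlam (hmom.error_moment 0 0) c
  filter_upwards [hproc, herr] with ω ⟨C₁, h1⟩ ⟨C₂, h2⟩
  refine ⟨C₁ + C₂, ?_⟩
  filter_upwards [h1, h2] with n h1 h2 p q hpq
  obtain ⟨h1a, h1b⟩ := h1 p q hpq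
  obtain ⟨h2a, h2b⟩ := h2 p q hpq
  simp only [curveTerm] at h1a h1b
  rw [← sum_sigma_weight] at h2a
  rw [← sum_sigma_weight n (m n) fun i j => (X (ξ i ω) (T i j ω) - mu (T i j ω)) *
    ind (gridBlock a n p q) (T i j ω)] at h1a
  rw [add_mul]
  constructor
  · refine le_trans (le_of_eq ?_) ((abs_add_le _ _).trans (add_le_add h1a h2a))
    rw [← Finset.sum_add_distrib]
    congr 1
    refine Finset.sum_congr rfl fun x _ => ?_
    simp only [observation]
    ring
  · intro hq
    have h1b := h1b hq
    have h2b := h2b hq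
    rw [← sum_sigma_weight] at h2b
    rw [← sum_sigma_weight n (m n) fun i j => |X (ξ i ω) (T i j ω) - mu (T i j ω)| *
      ind (gridBlock a n p q) (T i j ω)] at h1b
    refine le_trans ?_ (add_le_add h1b h2b)
    rw [← Finset.sum_add_distrib]
    refine Finset.sum_le_sum fun x _ => ?_
    have hi := ind_nonneg (gridBlock a n p q) (T x.1 x.2 ω)
    have hmi : (0 : ℝ) ≤ (m n x.1 : ℝ)⁻¹ := by positivity
    rw [abs_mul, abs_of_nonneg hmi, mul_assoc, ← mul_add, ← add_mul]
    refine mul_le_mul_of_nonneg_left (mul_le_mul_of_nonneg_right ?_ hi) hmi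
    simp only [observation]
    rw [add_sub_right_comm]
    exact abs_add_le _ _

end SamplingModel

theorem theorem3p1 {Ω S : Type*} [MeasurableSpace Ω] [MeasurableSpace S]
    (P : Measure Ω) [IsProbabilityMeasure P] (ν : Measure S) [IsProbabilityMeasure ν]
    (a b : ℝ) (hab : a < b)
    -- the process, its mean function, and the data
    (X : S → Icc a b → ℝ) (mu : ℝ → ℝ) (hmu : ∀ t : Icc a b, mu t = ∫ s, X s t ∂ν)
    (f : ℝ → ℝ) (ξ : ℕ → Ω → S) (T : ℕ → ℕ → Ω → Icc a b) (U : ℕ → ℕ → Ω → ℝ)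
    (hmodel : SamplingModel P ν X f ξ T U)
    -- the numbers of observations per curve, which may depend on the sample size `n`
    (m : ℕ → ℕ → ℕ) (hm : ∀ n, ∀ i < n, 2 ≤ m n i)
    (K : ℝ → ℝ) (h : ℕ → ℝ) (lam : ℝ)
    (hC1 : DesignDensityCondition a b f)
    (hC2 : KernelCondition K)
    (hC3 : MeanSmoothnessCondition a b mu)
    (hC5_moment : MomentCondition P ν X U lam)
    (hC5_bandwidth : BandwidthCondition m h lam)
    -- the local-linear estimator, with an arbitrary choice of minimizer where it is not unique
    (muHat : ℕ → Ω → ℝ → ℝ)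
    (hmuHat : ∀ n ω, ∀ t ∈ Icc a b, IsLocalLinearEstimate K m n (h n)
      (fun i j => (T i j ω : ℝ)) (observation X ξ T U ω) t (muHat n ω t)) :
    ∀ᵐ ω ∂P, ∃ C : ℝ, ∀ᶠ n in atTop,
      uniformError a b (muHat n ω) mu ≤
        ENNReal.ofReal (C * (h n ^ 2 + deltaOne m n (h n))) := by
  obtain ⟨mT, MT, hmT, hf⟩ := hC1.bounds
  have hMT : 0 ≤ MT := by
    have := hf a ⟨le_rfl, hab.le⟩
    linarith
  have hf' : ∀ t ∈ Icc a b, f t ≤ MT := fun t ht => (hf t ht).2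
  have hlam := hC5_moment.two_lt
  have hR : ∀ᶠ n in atTop, RateBounds m h lam n :=
    (eventually_rateBounds hm hC5_bandwidth hlam).mono fun n hn => hn.1
  obtain ⟨c, hc⟩ : ∃ c : ℕ, b - a + 2 ≤ c := exists_nat_ge _
  obtain ⟨Cc, hcount⟩ := hmodel.ae_count_bounds hf' hMT hm hR c
  obtain ⟨M, hM0, hM, hKsum⟩ := hC2.exists_abs_sum_le
  obtain ⟨u, v, κ, hu, huv, hv, hκ, hKκ⟩ := hC2.exists_pos_on_Icc
  obtain ⟨B, hB0, hB⟩ := hC3.exists_taylor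
  set ℓ := (v - u) / 3 with hℓ
  have hℓ0 : 0 < ℓ := by rw [hℓ]; linarith
  set D := (κ * (mT * ℓ / 4)) ^ 2 * (ℓ / 2) ^ 2 with hD
  have hD0 : 0 < D := by positivity
  have hδ := tendsto_deltaOne hm hC5_bandwidth hlam
  have hδ1 : ∀ᶠ n in atTop, |Cc| * deltaOne m n (h n) < mT * ℓ / 4 := by
    have h1 := hδ.const_mul |Cc|
    rw [mul_zero] at h1
    exact h1.eventually (gt_mem_nhds (by positivity))
  have hδ2 : ∀ᶠ n in atTop, deltaOne m n (h n) < 1 := hδ.eventually (gt_mem_nhds one_pos)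
  have hhab : ∀ᶠ n in atTop, h n < (b - a) / 2 :=
    hC5_bandwidth.tendsto_zero.eventually (gt_mem_nhds (by linarith))
  have hlog : ∀ᶠ n : ℕ in atTop, 4 / ℓ ≤ Real.log n :=
    (Real.tendsto_log_atTop.comp (tendsto_natCast_atTop_atTop (R := ℝ))).eventually
      (eventually_ge_atTop _)
  have hmuc := hC3.differentiable.continuousOn
  filter_upwards [hcount, hmodel.ae_noise_bounds hmu hmuc hf' hMT hm hR hC5_moment c]
    with ω hω ⟨Cε, hε⟩
  set A := 4 * MT + |Cc| with hA
  set C := max (2 * (M * (3 * |Cε|)) * (M * A) / D) (2 * (B * (M * A)) * (M * A) / D) with hCdef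
  refine ⟨C, ?_⟩
  filter_upwards [hω, hε, hR, hδ1, hδ2, hhab, hlog] with n hωn hεn hRn hδ1n hδ2n hhabn hlogn
  have hn := hRn.one_le
  have hh0 := hRn.h_pos
  have hn0 : (0 : ℝ) < n := by exact_mod_cast hn
  set N := n * h n with hN
  have hN1 : 1 ≤ N := hRn.one_le_log.trans hRn.log_le
  have hN0 : 0 < N := by linarith
  set δ := deltaOne m n (h n) with hδdef
  have hδ0 : 0 ≤ δ := Real.sqrt_nonneg _
  have hQL : truncLevel m h n * Real.log n = δ * N := by rw [hRn.trunc_log]; ring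
  rw [hQL] at hωn hεn
  refine iSup₂_le fun t₀ ht₀ => ENNReal.ofReal_le_ofReal ?_
  obtain ⟨c₁, hne0, hne1⟩ := (hmuHat n ω t₀ ht₀).normal_equations hn hh0 (mu t₀)
    (derivWithin mu (Icc a b) t₀)
  set s := (Finset.range n).sigma fun i => Finset.range (m n i) with hs
  set t : (Σ _ : ℕ, ℕ) → ℝ := fun x => T x.1 x.2 ω with htdef
  have ht : ∀ x ∈ s, t x ∈ Icc a b := fun x _ => (T x.1 x.2 ω).2
  set w : (Σ _ : ℕ, ℕ) → ℝ := fun x => (m n x.1 : ℝ)⁻¹ with hwdef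
  have hw : ∀ x ∈ s, 0 ≤ w x := fun x _ => by rw [hwdef]; positivity
  set ε : (Σ _ : ℕ, ℕ) → ℝ := fun x => observation X ξ T U ω x.1 x.2 - mu (T x.1 x.2 ω) with hεdef
  set ρ : (Σ _ : ℕ, ℕ) → ℝ := fun x =>
    mu (t x) - mu t₀ - derivWithin mu (Icc a b) t₀ * (t x - t₀) with hρdef
  have hcnt : ∀ p q, GridPair c h n p q → |∑ x ∈ s, w x * ind (gridBlock a n p q) (t x) -
      n * (designLaw a b f).real (gridBlock a n p q)| ≤ |Cc| * δ * N := by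
    intro p q hpq
    have h1 := hωn p q hpq
    rw [← sum_sigma_weight n (m n) fun i j => ind (gridBlock a n p q) (T i j ω)] at h1
    refine h1.trans ?_
    rw [mul_assoc]
    gcongr
    exact le_abs_self _
  have hNN : 4 ≤ ℓ * N := by
    have h1 := hlogn.trans hRn.log_le
    rwa [div_le_iff₀ hℓ0, mul_comm] at h1
  -- the hypotheses of `abs_intercept_le` hold with `N = n h` and noise level `δ`
  have hwin := window_mass_le hf' hMT hn hRn.h_le hN1 hc ht hw hcnt ht₀
  have hdet := det_ge hC2 hf hmT hn hh0 hhabn.le hc hw hcnt hu huv hv hκ hKκ hNN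
    (mul_le_mul_of_nonneg_right hδ1n.le hN0.le) ht₀
  have hnoise : ∀ I : Set ℝ, I.OrdConnected → (∀ x ∈ I, |x - t₀| ≤ h n) →
      |∑ x ∈ s, w x * ε x * ind I (t x)| ≤ 3 * |Cε| * δ * N := by
    intro I hI hIt
    have h1 := abs_sum_ind_ordConnected_le s (h := h) (c := c) hn hN1 (by linarith) ht
      (z := fun x => w x * ε x) (B := |Cε| * (δ * N)) (fun p q hpq => (hεn p q hpq).1.trans ?_)
      (fun p hp => ((hεn p (p + 1) hp).2 rfl).trans ?_) hI hIt
    · refine h1.trans (le_of_eq (by ring))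
    · gcongr; exact le_abs_self _
    · gcongr; exact le_abs_self _
  have hmain := abs_intercept_le hC2 hM0 hM s (fun x z B' => hKsum s x z B') (η := h n) (t₀ := t₀)
    (c₀ := muHat n ω t₀ - mu t₀) (c₁ := c₁) (N := N) (R := 3 * |Cε| * δ) (D := D) (B := B) (A := A)
    (t := t) (w := w) (ε := ε) (ρ := ρ) hh0 hw ?_ hnoise
    (fun x hx => hB t₀ ht₀ (t x) (ht x hx)) hB0 hD0 hN0 hdet ?_ ?_
  · refine hmain.trans ?_
    calc _ = 2 * (M * (3 * |Cε|)) * (M * A) / D * δ +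
            2 * (B * (M * A)) * (M * A) / D * h n ^ 2 := by
          ring
      _ ≤ C * δ + C * h n ^ 2 := by
          gcongr
          · exact le_max_left _ _
          · exact le_max_right _ _
      _ = _ := by ring
  · refine hwin.trans ?_
    rw [hA, add_mul]
    gcongr
    exact mul_le_of_le_one_right (abs_nonneg _) hδ2n.le
  · rw [← hne0]
    refine Finset.sum_congr rfl fun x _ => ?_
    simp only [hεdef, hρdef, htdef, hwdef]
    ring
  · rw [← hne1]
    refine Finset.sum_congr rfl fun x _ => ?_
    simp only [hεdef, hρdef, htdef, hwdef]
    ring
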